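/- **Setting.** A training set is $\mathcal Z=\{(R_1,s_1),\dots,(R_n,s_n)\}$, where each $R_i=\prod_{j=1}^d[a_{ij},b_{ij}]\subset\mathbb R^d$ with $a_{ij}<b_{ij}$ is an axis-aligned rectangle and $s_i\in[0,1]$; as inputs to algorithms, all $a_{ij},b_{ij},s_i$ are rational. A discrete distribution $\mathcal D$ on $\mathbb R^d$ is a finite set $\mathrm{supp}(\mathcal D)\subset\mathbb R^d$ of points with positive weights $w_x$ of sum $1$; its size is $|\mathcal D|=|\mathrm{supp}(\mathcal D)|$, and $s_{\mathcal D}(R)=\sum_{x\in\mathrm{supp}(\mathcal D)\cap R}w_x$. For $1\le p<\infty$ let $$\mathrm{err}_p(\mathcal D,\mathcal Z)=\frac1n\sum_{i=1}^n|s_{\mathcal D}(R_i)-s_i|^p,\qquad \mathrm{err}_\infty(\mathcal D,\mathcal Z)=\max_{1\le i\le n}|s_{\mathcal D}(R_i)-s_i|,$$ and let $\alpha^*_{p,k}(\mathcal Z)$ be the minimum of $\mathrm{err}_p(\mathcal D,\mathcal Z)$ over all discrete distributions $\mathcal D$ of size at most $k$. **Problem.** Fix $p\in[1,\infty]$, functions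 $f,g:\mathbb N\to\mathbb N$ with $f(n)\ge1$ and $g(n)\ge1$ for all $n$, and a constant $C$ with $g(n)\le C\,n$ for all $n\ge1$. In \textsc{Selectivity+} the input consists of $d,n,k\ge1$ with $g(n)\,k\le C\,n$ and a training set $\mathcal Z$ of $n$ rectangles in $\mathbb R^d$ with their selectivities. The task is to output a discrete distribution $\mathcal D$ (with rational points and weights) such that $|\mathcal D|\le g(n)\,k$ and $\mathrm{err}_p(\mathcal D,\mathcal Z)\le f(n)\,\alpha^*_{p,k}(\mathcal Z)$. **Theorem.** Assume $\mathsf{FPT}\ne\mathsf{W}[1]$, where $\mathsf W[1]$ is the class of the parameterized problems with a parameterized reduction to weighted satisfiability of Boolean circuits of weft at most $1$ and depth at most $D$, for some constant $D\ge 1$. Then for no computable function $h:\mathbb N\to\mathbb N$ is there an algorithm that solves \textsc{Selectivity+} in time $h(d)\cdot N^{O(1)}$, where $N\ge n$ is the bit length of the input. In particular, \textsc{Selectivity+} cannot be solved in $h(d)\cdot n^{O(1)}$ time. Here an algorithm is a program of a deterministic random access machine with uniform cost whose arithmetic is addition, truncated subtraction and halving of natural numbers (a model that is polynomially equivalent to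 Turing machines). -/

import Mathlib

/-! ## Random access machines

Structured programs for a random access machine with uniform cost. A program uses finitely many
registers and finitely many arrays (random access memories), all holding natural numbers. The
arithmetic is addition, truncated subtraction and halving; there is no multiplication, so the bit
length of the largest stored number grows by at most one per step (up to the constants of the
program), and running times are polynomially equivalent to those of Turing machines. -/

namespace Ram

/-- Programs; `x`, `y`, `z` are names of registers, `a` is the name of an array. -/
inductive Prog : Type
  /-- do nothing -/
  | skip : Prog
  /-- `x := c` -/
  | const (x c : ℕ) : Prog
  /-- `x := y + z` -/
  | add (x y z : ℕ) : Prog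
  /-- `x := y - z` (truncated at `0`) -/
  | sub (x y z : ℕ) : Prog
  /-- `x := y / 2` (rounded down) -/
  | half (x y : ℕ) : Prog
  /-- `x := a[y]` -/
  | load (x a y : ℕ) : Prog
  /-- `a[y] := x` -/
  | store (a y x : ℕ) : Prog
  /-- first `p`, then `q` -/
  | seq (p q : Prog) : Prog
  /-- if `x ≠ 0` then `p` else `q` -/
  | ite (x : ℕ) (p q : Prog) : Prog
  /-- while `x ≠ 0` do `p` -/
  | loop (x : ℕ) (p : Prog) : Prog

/-- The contents of the registers and of the arrays. -/
structure State : Type where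
  reg : ℕ → ℕ
  arr : ℕ → ℕ → ℕ

/-- Write `v` into register `x`. -/
def State.setReg (s : State) (x v : ℕ) : State :=
  { s with reg := Function.update s.reg x v }

/-- Write `v` into cell `i` of array `a`. -/
def State.setArr (s : State) (a i v : ℕ) : State :=
  { s with arr := Function.update s.arr a (Function.update (s.arr a) i v) }

/-- `Runs p s s' t`: started in state `s`, the program `p` halts in state `s'` after exactly `t`
steps. Every elementary instruction and every test costs one step. -/
inductive Runs : Prog → State → State → ℕ → Prop
  | skip (s : State) : Runs Prog.skip s s 1
  | const (x c : ℕ) (s : State) : Runs (Prog.const x c) s (s.setReg x c) 1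
  | add (x y z : ℕ) (s : State) :
      Runs (Prog.add x y z) s (s.setReg x (s.reg y + s.reg z)) 1
  | sub (x y z : ℕ) (s : State) :
      Runs (Prog.sub x y z) s (s.setReg x (s.reg y - s.reg z)) 1
  | half (x y : ℕ) (s : State) : Runs (Prog.half x y) s (s.setReg x (s.reg y / 2)) 1
  | load (x a y : ℕ) (s : State) :
      Runs (Prog.load x a y) s (s.setReg x (s.arr a (s.reg y))) 1
  | store (a y x : ℕ) (s : State) :
      Runs (Prog.store a y x) s (s.setArr a (s.reg y) (s.reg x)) 1
  | seq {p q : Prog} {s s₁ s₂ : State} {t₁ t₂ : ℕ} :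
      Runs p s s₁ t₁ → Runs q s₁ s₂ t₂ → Runs (Prog.seq p q) s s₂ (t₁ + t₂)
  | ite_true {x : ℕ} {p q : Prog} {s s₁ : State} {t : ℕ} :
      s.reg x ≠ 0 → Runs p s s₁ t → Runs (Prog.ite x p q) s s₁ (t + 1)
  | ite_false {x : ℕ} {p q : Prog} {s s₁ : State} {t : ℕ} :
      s.reg x = 0 → Runs q s s₁ t → Runs (Prog.ite x p q) s s₁ (t + 1)
  | loop_done {x : ℕ} {p : Prog} {s : State} :
      s.reg x = 0 → Runs (Prog.loop x p) s s 1
  | loop_step {x : ℕ} {p : Prog} {s s₁ s₂ : State} {t₁ t₂ : ℕ} :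
      s.reg x ≠ 0 → Runs p s s₁ t₁ → Runs (Prog.loop x p) s₁ s₂ t₂ →
      Runs (Prog.loop x p) s s₂ (t₁ + t₂ + 1)

/-- The initial state on input `x`: the input is in array `0`, its length is in register `0`,
everything else is `0`. -/
def start (x : List ℕ) : State where
  reg := fun r => if r = 0 then x.length else 0
  arr := fun a i => if a = 0 then x.getD i 0 else 0

/-- The output is read off array `0`, its length is read off register `0`. -/
def State.output (s : State) : List ℕ :=
  (List.range (s.reg 0)).map (s.arr 0)

/-- The bit length of a finite sequence of natural numbers: the binary digits of its entries and
one delimiter per entry. -/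
def size (x : List ℕ) : ℕ := (x.map fun a => Nat.size a + 1).sum

/-- On input `x` the program `p` halts with output `y` within time `T`, where one time unit is
charged for each entry of the output. -/
def OutputsIn (p : Prog) (x y : List ℕ) (T : ℕ) : Prop :=
  ∃ (s : State) (t : ℕ), Runs p (start x) s t ∧ s.output = y ∧ t + y.length ≤ T

end Ram

/-! ## Boolean circuits -/

/-- A node of a Boolean circuit, with the list of its in-neighbours. -/
inductive Gate : Type
  | input : Gate
  | not (u : ℕ) : Gate
  | and (us : List ℕ) : Gate
  | or (us : List ℕ) : Gate

namespace Gate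

/-- The in-neighbours. -/
def preds : Gate → List ℕ
  | input => []
  | not u => [u]
  | and us => us
  | or us => us

/-- And-nodes and or-nodes have indegree at least two. -/
def FanInOk : Gate → Prop
  | input => True
  | not _ => True
  | and us => 2 ≤ us.length
  | or us => 2 ≤ us.length

/-- The value `b` is the right one for the gate, if the values of the nodes are given by `v`. -/
def Agrees (v : ℕ → Bool) (b : Bool) : Gate → Prop
  | input => True
  | not u => b = !(v u)
  | and us => b = us.all v
  | or us => b = us.any v

/-- Encoding as a sequence of natural numbers. -/
def encode : Gate → List ℕ
  | input => [0]
  | not u => [1, u]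
  | and us => 2 :: us.length :: us
  | or us => 3 :: us.length :: us

end Gate

/-- A Boolean circuit, given by its nodes `0, 1, …, N - 1` in a topological order; the last node
is the output node. -/
abbrev Circuit : Type := List Gate

namespace Circuit

/-- There is at least one node, all edges lead from smaller to larger nodes, and the indegrees are
admissible. -/
def Valid (C : Circuit) : Prop :=
  C ≠ [] ∧ ∀ (i : ℕ) (g : Gate), C[i]? = some g → (∀ u ∈ g.preds, u < i) ∧ g.FanInOk

/-- There is an edge from `u` to `v`. -/
def Edge (C : Circuit) (u v : ℕ) : Prop := ∃ g : Gate, C[v]? = some g ∧ u ∈ g.preds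

/-- `l` is the sequence of nodes of a path from an input node to the output node. -/
def IsPath (C : Circuit) (l : List ℕ) : Prop :=
  l.IsChain C.Edge ∧ (∃ u, l.head? = some u ∧ C[u]? = some Gate.input) ∧
    l.getLast? = some (C.length - 1)

/-- The indegree of a node. -/
def inDegree (C : Circuit) (v : ℕ) : ℕ := ((C[v]?).map fun g => g.preds.length).getD 0

/-- Every path from an input node to the output node has at most `D` edges. -/
def DepthLE (C : Circuit) (D : ℕ) : Prop := ∀ l, C.IsPath l → l.length ≤ D + 1

/-- Every path from an input node to the output node has at most `t` large nodes, that is, nodes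
of indegree more than two. -/
def WeftLE (C : Circuit) (t : ℕ) : Prop :=
  ∀ l, C.IsPath l → l.countP (fun v => decide (2 < C.inDegree v)) ≤ t

/-- `v` assigns truth values to the nodes such that every node other than an input node has the
value that is determined by its in-neighbours. -/
def IsValuation (C : Circuit) (v : ℕ → Bool) : Prop :=
  ∀ (i : ℕ) (g : Gate), C[i]? = some g → g.Agrees v (v i)

/-- The circuit has a satisfying assignment with exactly `k` input nodes set to true. -/
def HasSatOfWeight (C : Circuit) (k : ℕ) : Prop :=
  ∃ v : ℕ → Bool, C.IsValuation v ∧ v (C.length - 1) = true ∧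
    {i | C[i]? = some Gate.input ∧ v i = true}.ncard = k

/-- Encoding as a sequence of natural numbers. -/
def encode (C : Circuit) : List ℕ := C.flatMap Gate.encode

end Circuit

/-! ## Parameterized complexity -/

/-- A parameterized problem: a set of pairs `(x, k)` of a word `x` and a parameter `k`. Words are
finite sequences of natural numbers; their length is `Ram.size`, that is, they are written over
the alphabet of the two binary digits and a delimiter. -/
abbrev ParamProblem : Type := Set (List ℕ × ℕ)

namespace ParamProblem

/-- The class FPT: membership of `(x, k)` is decided in time `f(k) · |(x, k)| ^ c` for a
computable function `f` and a constant `c`. -/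
def FPT : Set ParamProblem :=
  {L | ∃ (p : Ram.Prog) (f : ℕ → ℕ) (c : ℕ), Computable f ∧ ∀ (x : List ℕ) (k : ℕ),
    ((x, k) ∈ L → Ram.OutputsIn p (k :: x) [1] (f k * Ram.size (k :: x) ^ c)) ∧
    ((x, k) ∉ L → Ram.OutputsIn p (k :: x) [0] (f k * Ram.size (k :: x) ^ c))}

/-- There is a parameterized (many-one) reduction from `L` to `L'`. -/
def Reduces (L L' : ParamProblem) : Prop :=
  ∃ (p : Ram.Prog) (f g : ℕ → ℕ) (c : ℕ), Computable f ∧ Computable g ∧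
    ∀ (x : List ℕ) (k : ℕ), ∃ (x' : List ℕ) (k' : ℕ),
      Ram.OutputsIn p (k :: x) (k' :: x') (f k * Ram.size (k :: x) ^ c) ∧
      k' ≤ g k ∧ ((x, k) ∈ L ↔ (x', k') ∈ L')

/-- Weighted circuit satisfiability for the circuits of weft at most `t` and depth at most `D`,
parameterized by the weight. -/
def WeightedCircuitSat (t D : ℕ) : ParamProblem :=
  {z | ∃ C : Circuit, C.Valid ∧ C.WeftLE t ∧ C.DepthLE D ∧ C.encode = z.1 ∧ C.HasSatOfWeight z.2}

/-- The class W[1]. -/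
def W1 : Set ParamProblem :=
  {L | ∃ D : ℕ, 1 ≤ D ∧ Reduces L (WeightedCircuitSat 1 D)}

end ParamProblem

/-! ## Learning a discrete distribution from selectivities -/

/-- A training sample: an axis-aligned rectangle (with rational corners) and its observed
selectivity. -/
structure Sample (d : ℕ) : Type where
  lo : Fin d → ℚ
  hi : Fin d → ℚ
  lo_lt_hi : ∀ j, lo j < hi j
  sel : ℚ
  sel_nonneg : 0 ≤ sel
  sel_le_one : sel ≤ 1

/-- The rectangle of a sample, as a closed subset of `ℝ ^ d`. -/
def Sample.rect {d : ℕ} (z : Sample d) : Set (Fin d → ℝ) :=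
  {x | ∀ j, (z.lo j : ℝ) ≤ x j ∧ x j ≤ (z.hi j : ℝ)}

/-- A discrete distribution on `ℝ ^ d`: a finite set of points with positive weights that add up
to one. -/
structure DiscreteDist (d : ℕ) : Type where
  supp : Finset (Fin d → ℝ)
  weight : (Fin d → ℝ) → ℝ
  weight_pos : ∀ x ∈ supp, 0 < weight x
  sum_weight : ∑ x ∈ supp, weight x = 1

/-- The size of a discrete distribution. -/
def DiscreteDist.size {d : ℕ} (μ : DiscreteDist d) : ℕ := μ.supp.card

/-- The selectivity of a range over a discrete distribution. -/
noncomputable def DiscreteDist.selectivity {d : ℕ} (μ : DiscreteDist d) (R : Set (Fin d → ℝ)) :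
    ℝ :=
  ∑ x ∈ μ.supp, R.indicator μ.weight x

open scoped Classical in
/-- The empirical `ℓ_p` error: the mean of the `p`-th powers of the deviations for `p < ∞`, and the
maximal deviation for `p = ∞`. -/
noncomputable def empErr {d n : ℕ} (p : ENNReal) (μ : DiscreteDist d) (Z : Fin n → Sample d) : ℝ :=
  if p = ⊤ then ⨆ i, |μ.selectivity (Z i).rect - ((Z i).sel : ℝ)|
  else (1 / (n : ℝ)) * ∑ i, |μ.selectivity (Z i).rect - ((Z i).sel : ℝ)| ^ p.toReal

/-- The least error of the discrete distributions of size at most `k`. -/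
noncomputable def optErr {d n : ℕ} (p : ENNReal) (k : ℕ) (Z : Fin n → Sample d) : ℝ :=
  sInf {e | ∃ μ : DiscreteDist d, μ.size ≤ k ∧ e = empErr p μ Z}

/-! ### Encoding of inputs and outputs -/

/-- The input encoding of a rational number: positive part and negative part of the numerator, and
the denominator, in lowest terms. -/
def encodeRat (q : ℚ) : List ℕ := [q.num.toNat, (-q.num).toNat, q.den]

/-- The encoding of a sample: the end points of all sides of the rectangle, and the selectivity. -/
def Sample.encode {d : ℕ} (z : Sample d) : List ℕ :=
  (List.ofFn fun j => encodeRat (z.lo j) ++ encodeRat (z.hi j)).flatten ++ encodeRat z.sel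

/-- The encoding of a training set and a size parameter. -/
def encodeInstance {d n : ℕ} (Z : Fin n → Sample d) (k : ℕ) : List ℕ :=
  d :: n :: k :: (List.ofFn fun i => (Z i).encode).flatten

/-- Rational numbers in outputs: `(a, b, c)` with `c ≠ 0` stands for `(a - b) / c`, which need not
be in lowest terms. -/
structure RatCode : Type where
  a : ℕ
  b : ℕ
  c : ℕ
  c_ne_zero : c ≠ 0

/-- The number that is encoded. -/
noncomputable def RatCode.val (r : RatCode) : ℝ := ((r.a : ℝ) - (r.b : ℝ)) / (r.c : ℝ)

/-- The sequence of natural numbers that is written. -/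
def RatCode.word (r : RatCode) : List ℕ := [r.a, r.b, r.c]

/-- The output `y` describes the discrete distribution `μ`: it consists of the number `m` of
points, followed by the coordinates and the weight of each of the `m` distinct points. -/
def Describes {d : ℕ} (y : List ℕ) (μ : DiscreteDist d) : Prop :=
  ∃ (m : ℕ) (pt : Fin m → Fin d → RatCode) (wt : Fin m → RatCode),
    y = m :: (List.ofFn fun i =>
      (List.ofFn fun j => (pt i j).word).flatten ++ (wt i).word).flatten ∧
    (Function.Injective fun i j => (pt i j).val) ∧
    (μ.supp : Set (Fin d → ℝ)) = Set.range (fun i j => (pt i j).val) ∧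
    ∀ i, μ.weight (fun j => (pt i j).val) = (wt i).val

/-- The program `prog` solves Selectivity+ for the error `err_p`, with approximation factor `f` for
the error and `g` for the size, on all inputs with `g(n) k ≤ C n`, in time `h(d) N ^ c`, where `N`
is the bit length of the input: on each such input, it computes a discrete distribution of size at
most `g(n) k` whose error is at most `f(n)` times the least error for size `k`. -/
def SolvesSelectivityPlus (p : ENNReal) (f g : ℕ → ℕ) (C : ℝ) (h : ℕ → ℕ) (c : ℕ)
    (prog : Ram.Prog) : Prop :=
  ∀ (d n k : ℕ), 1 ≤ d → 1 ≤ n → 1 ≤ k → (g n : ℝ) * (k : ℝ) ≤ C * (n : ℝ) →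
    ∀ Z : Fin n → Sample d, ∃ (y : List ℕ) (μ : DiscreteDist d),
      Ram.OutputsIn prog (encodeInstance Z k) y (h d * Ram.size (encodeInstance Z k) ^ c) ∧
      Describes y μ ∧ μ.size ≤ g n * k ∧ empErr p μ Z ≤ (f n : ℝ) * optErr p k Z

/-! A program for Selectivity+ that runs in time `h(d) N ^ c` puts all of W[1] into FPT, and FPT is
contained in W[1] anyway.

Let a problem reduce to the weighted satisfiability of circuits of weft one and depth at most `D`,
with weight `k`. Call a gate *large* if it has more than two in-neighbours, and a *frontier* gate if
it is large and is reached from the output through gates that are not large. There are at most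
`Q = 2 ^ (D + 1)` frontier gates, and because of the weft no large gate lies below a frontier gate.
A satisfying assignment of weight `k` on a circuit with `N` gates is described by a vector
`z ∈ {0, …, N} ^ (k + Q)`: the first `k` entries are the true inputs, and the entry of a frontier
gate is a witness for its value, either an in-neighbour that determines the value or the number `N`,
which says that no in-neighbour does (`Net.ovr`). Such a vector is correct if and only if it passes a
test for each gate `u` (`Net.Test`, `Net.IsFrontier.isSol`, `Net.IsFrontier.exists_test`). The test
for `u` depends only on which entries of `z` are equal to which of few breakpoints: `u`, `N`, and
the gates that are reached from `u` or from the output through gates that are not large (`Net.IsFrontier.test_congr`, `Net.exists_isBreak_bound`). So for each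
`u`, the vectors that fail the test for `u` are the lattice points of at most
`2 ^ ((D + 4) (k + Q))` boxes; this bound depends only on `k` and `D`.

The instance of Selectivity+ lives in dimension `k + Q`. It consists of the cube `[0, N + 1] ^ (k + Q)`
with selectivity one and, for each box of bad vectors, of the corresponding box with selectivity
zero, where the lattice point `z` stands for the cell `∏ [z j, z j + 1]`. If there is a satisfying
assignment, then a single point has error zero. Hence the optimum for size one is zero, every
approximate solution has error zero as well, whatever the approximation factors are, and rounding any
of its points gives a satisfying assignment (`mem_supp_of_empErr_le`,
`Ram.Boxes.isSol_roundOff`). The decision procedure computes the reduction, writes this instance,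
runs the program for Selectivity+, rounds the first point of its output, and evaluates the circuit
(`Ram.outputsIn_decider`, `Ram.W1_subset_FPT`).

The programs are written in a small language of loops whose numbers of rounds are capped by one
number `M`. They are total, their meaning `Ram.den` is a function, and they compile to programs of
the random access machine that run in time polynomial in `M` (`Ram.St.runs_comp`,
`Ram.St.time_le`). -/

/-! ### Renaming of registers and arrays -/

namespace Ram

/-- The program with register `x` renamed to `ρ x` and array `a` renamed to `α a`. -/
def Prog.rename (ρ α : ℕ → ℕ) : Prog → Prog
  | .skip => .skip
  | .const x c => .const (ρ x) c
  | .add x y z => .add (ρ x) (ρ y) (ρ z)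
  | .sub x y z => .sub (ρ x) (ρ y) (ρ z)
  | .half x y => .half (ρ x) (ρ y)
  | .load x a y => .load (ρ x) (α a) (ρ y)
  | .store a y x => .store (α a) (ρ y) (ρ x)
  | .seq p q => .seq (p.rename ρ α) (q.rename ρ α)
  | .ite x p q => .ite (ρ x) (p.rename ρ α) (q.rename ρ α)
  | .loop x p => .loop (ρ x) (p.rename ρ α)

/-- `σ` contains a copy of `s` at the renamed registers and arrays. -/
def State.Embeds (ρ α : ℕ → ℕ) (s σ : State) : Prop :=
  (∀ r, σ.reg (ρ r) = s.reg r) ∧ ∀ a, σ.arr (α a) = s.arr a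

/-- `σ` and `σ'` agree outside the renamed registers and arrays. -/
def State.AgreesOff (ρ α : ℕ → ℕ) (σ σ' : State) : Prop :=
  (∀ r, r ∉ Set.range ρ → σ'.reg r = σ.reg r) ∧ ∀ a, a ∉ Set.range α → σ'.arr a = σ.arr a

theorem State.AgreesOff.refl (ρ α : ℕ → ℕ) (σ : State) : σ.AgreesOff ρ α σ :=
  ⟨fun _ _ => rfl, fun _ _ => rfl⟩

theorem State.AgreesOff.trans {ρ α : ℕ → ℕ} {σ₁ σ₂ σ₃ : State} (h : σ₁.AgreesOff ρ α σ₂)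
    (h' : σ₂.AgreesOff ρ α σ₃) : σ₁.AgreesOff ρ α σ₃ :=
  ⟨fun r hr => (h'.1 r hr).trans (h.1 r hr), fun a ha => (h'.2 a ha).trans (h.2 a ha)⟩

theorem State.agreesOff_setReg {ρ α : ℕ → ℕ} (σ : State) (x v : ℕ) :
    σ.AgreesOff ρ α (σ.setReg (ρ x) v) := by
  refine ⟨fun r hr => ?_, fun _ _ => rfl⟩
  have : r ≠ ρ x := fun h => hr ⟨x, h.symm⟩
  simp [State.setReg, this]

theorem State.agreesOff_setArr {ρ α : ℕ → ℕ} (σ : State) (a i v : ℕ) :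
    σ.AgreesOff ρ α (σ.setArr (α a) i v) := by
  refine ⟨fun _ _ => rfl, fun b hb => ?_⟩
  have : b ≠ α a := fun h => hb ⟨a, h.symm⟩
  simp [State.setArr, this]

theorem State.Embeds.setReg {ρ α : ℕ → ℕ} (hρ : ρ.Injective) {s σ : State}
    (h : s.Embeds ρ α σ) (x v : ℕ) : (s.setReg x v).Embeds ρ α (σ.setReg (ρ x) v) := by
  refine ⟨fun r => ?_, h.2⟩
  by_cases hr : r = x
  · subst hr; simp [State.setReg]
  · simp [State.setReg, hr, hρ.ne hr, h.1 r]

theorem State.Embeds.setArr {ρ α : ℕ → ℕ} (hα : α.Injective) {s σ : State}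
    (h : s.Embeds ρ α σ) (a i v : ℕ) : (s.setArr a i v).Embeds ρ α (σ.setArr (α a) i v) := by
  refine ⟨h.1, fun b => ?_⟩
  by_cases hb : b = a
  · subst hb; simp [State.setArr, h.2 b]
  · simp [State.setArr, hb, hα.ne hb, h.2 b]

/-- A renamed program does in its part of the memory what the program does, in the same time, and
leaves the rest of the memory alone. -/
theorem Runs.rename {ρ α : ℕ → ℕ} (hρ : ρ.Injective) (hα : α.Injective) {p : Prog} {s s' : State}
    {t : ℕ} (h : Runs p s s' t) : ∀ σ : State, s.Embeds ρ α σ →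
      ∃ σ', Runs (p.rename ρ α) σ σ' t ∧ s'.Embeds ρ α σ' ∧ σ.AgreesOff ρ α σ' := by
  have reg : ∀ {s σ : State} (x v : ℕ), s.Embeds ρ α σ → (s.setReg x v).Embeds ρ α
      (σ.setReg (ρ x) v) ∧ σ.AgreesOff ρ α (σ.setReg (ρ x) v) :=
    fun x v h => ⟨h.setReg hρ x v, State.agreesOff_setReg _ x v⟩
  induction h with
  | skip s => exact fun σ e => ⟨σ, .skip σ, e, .refl _ _ _⟩
  | const x c s => exact fun σ e => ⟨_, .const _ c σ, reg x c e⟩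
  | add x y z s =>
    intro σ e
    refine ⟨_, .add _ _ _ σ, ?_⟩
    rw [e.1, e.1]; exact reg x _ e
  | sub x y z s =>
    intro σ e
    refine ⟨_, .sub _ _ _ σ, ?_⟩
    rw [e.1, e.1]; exact reg x _ e
  | half x y s =>
    intro σ e
    refine ⟨_, .half _ _ σ, ?_⟩
    rw [e.1]; exact reg x _ e
  | load x a y s =>
    intro σ e
    refine ⟨_, .load _ _ _ σ, ?_⟩
    rw [e.1, e.2]; exact reg x _ e
  | store a y x s =>
    intro σ e
    refine ⟨_, .store _ _ _ σ, ?_⟩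
    rw [e.1, e.1]; exact ⟨e.setArr hα a _ _, State.agreesOff_setArr _ a _ _⟩
  | seq _ _ ih₁ ih₂ =>
    intro σ e
    obtain ⟨σ₁, r₁, e₁, a₁⟩ := ih₁ σ e
    obtain ⟨σ₂, r₂, e₂, a₂⟩ := ih₂ σ₁ e₁
    exact ⟨σ₂, .seq r₁ r₂, e₂, a₁.trans a₂⟩
  | ite_true hx _ ih =>
    intro σ e
    obtain ⟨σ₁, r₁, e₁, a₁⟩ := ih σ e
    exact ⟨σ₁, .ite_true (by rwa [e.1]) r₁, e₁, a₁⟩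
  | ite_false hx _ ih =>
    intro σ e
    obtain ⟨σ₁, r₁, e₁, a₁⟩ := ih σ e
    exact ⟨σ₁, .ite_false (by rwa [e.1]) r₁, e₁, a₁⟩
  | loop_done hx => exact fun σ e => ⟨σ, .loop_done (by rwa [e.1]), e, .refl _ _ _⟩
  | loop_step hx _ _ ih₁ ih₂ =>
    intro σ e
    obtain ⟨σ₁, r₁, e₁, a₁⟩ := ih₁ σ e
    obtain ⟨σ₂, r₂, e₂, a₂⟩ := ih₂ σ₁ e₁
    exact ⟨σ₂, .loop_step (by rwa [e.1]) r₁ r₂, e₂, a₁.trans a₂⟩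

end Ram

/-! ### A language of capped loops -/

namespace Ram

/-- Expressions; `var x` is a register, `arr a e` is a cell of an array. -/
inductive Ex : Type
  | lit (n : ℕ) : Ex
  | var (x : ℕ) : Ex
  | add (e e' : Ex) : Ex
  | sub (e e' : Ex) : Ex
  | half (e : Ex) : Ex
  | arr (a : ℕ) (e : Ex) : Ex

instance : Add Ex := ⟨Ex.add⟩
instance : Sub Ex := ⟨Ex.sub⟩
instance (n : ℕ) : OfNat Ex n := ⟨Ex.lit n⟩

/-- The value of an expression. -/
def Ex.ev (s : State) : Ex → ℕ
  | lit n => n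
  | var x => s.reg x
  | add e e' => e.ev s + e'.ev s
  | sub e e' => e.ev s - e'.ev s
  | half e => e.ev s / 2
  | arr a e => s.arr a (e.ev s)

@[simp] theorem Ex.ev_lit (s : State) (n : ℕ) : (Ex.lit n).ev s = n := rfl
@[simp] theorem Ex.ev_ofNat (s : State) (n : ℕ) :
    (ofNat(n) : Ex).ev s = OfNat.ofNat n := rfl
@[simp] theorem Ex.ev_zero (s : State) : (0 : Ex).ev s = 0 := rfl
@[simp] theorem Ex.ev_one (s : State) : (1 : Ex).ev s = 1 := rfl
@[simp] theorem Ex.ev_var (s : State) (x : ℕ) : (Ex.var x).ev s = s.reg x := rfl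
@[simp] theorem Ex.ev_add (s : State) (e e' : Ex) : (e + e').ev s = e.ev s + e'.ev s := rfl
@[simp] theorem Ex.ev_sub (s : State) (e e' : Ex) : (e - e').ev s = e.ev s - e'.ev s := rfl
@[simp] theorem Ex.ev_half (s : State) (e : Ex) : (Ex.half e).ev s = e.ev s / 2 := rfl
@[simp] theorem Ex.ev_arr (s : State) (a : ℕ) (e : Ex) : (Ex.arr a e).ev s = s.arr a (e.ev s) := rfl

/-- Statements. In `rep x e p` the body `p` is executed with `x = 0, 1, …, n - 1`, where `n` is the
value of `e` on entry or a global cap `M`, whichever is smaller. -/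
inductive St : Type
  | skip : St
  | set (x : ℕ) (e : Ex) : St
  | put (a : ℕ) (i e : Ex) : St
  | seq (p q : St) : St
  | ite (e : Ex) (p q : St) : St
  | rep (x : ℕ) (e : Ex) (p : St) : St

/-- Sequential composition of statements. -/
infixr:60 " ;; " => St.seq

/-- `f (n - 1) (⋯ (f 1 (f 0 s)))`. -/
def iter {σ : Type} (f : ℕ → σ → σ) (s : σ) : ℕ → σ
  | 0 => s
  | n + 1 => f n (iter f s n)

/-- The state transformation of a statement, when the number of repetitions of a loop is capped
by `M`. -/
def den (M : ℕ) : St → State → State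
  | .skip, s => s
  | .set x e, s => s.setReg x (e.ev s)
  | .put a i e, s => s.setArr a (i.ev s) (e.ev s)
  | .seq p q, s => den M q (den M p s)
  | .ite e p q, s => if e.ev s = 0 then den M q s else den M p s
  | .rep x e p, s => iter (fun i s => den M p (s.setReg x i)) s (min (e.ev s) M)

@[simp] theorem den_skip (M : ℕ) (s : State) : den M .skip s = s := rfl
@[simp] theorem den_set (M x : ℕ) (e : Ex) (s : State) :
    den M (.set x e) s = s.setReg x (e.ev s) := rfl
@[simp] theorem den_put (M a : ℕ) (i e : Ex) (s : State) :
    den M (.put a i e) s = s.setArr a (i.ev s) (e.ev s) := rfl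
@[simp] theorem den_seq (M : ℕ) (p q : St) (s : State) :
    den M (p ;; q) s = den M q (den M p s) := rfl
@[simp] theorem den_ite (M : ℕ) (e : Ex) (p q : St) (s : State) :
    den M (.ite e p q) s = if e.ev s = 0 then den M q s else den M p s := rfl

@[simp] theorem State.setReg_reg (s : State) (x v y : ℕ) :
    (s.setReg x v).reg y = if y = x then v else s.reg y := by
  simp [State.setReg, Function.update_apply]

@[simp] theorem State.setReg_arr (s : State) (x v : ℕ) : (s.setReg x v).arr = s.arr := rfl
@[simp] theorem State.setArr_reg (s : State) (a i v : ℕ) : (s.setArr a i v).reg = s.reg := rfl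

@[simp] theorem State.setArr_arr (s : State) (a i v b : ℕ) :
    (s.setArr a i v).arr b = if b = a then Function.update (s.arr a) i v else s.arr b := by
  by_cases h : b = a
  · subst h; simp [State.setArr]
  · simp [State.setArr, h]

/-- The registers that a statement may change. -/
def St.wReg : St → List ℕ
  | .skip => []
  | .set x _ => [x]
  | .put _ _ _ => []
  | .seq p q => p.wReg ++ q.wReg
  | .ite _ p q => p.wReg ++ q.wReg
  | .rep x _ p => x :: p.wReg

/-- The arrays that a statement may change. -/
def St.wArr : St → List ℕ
  | .skip => []
  | .set _ _ => []
  | .put a _ _ => [a]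
  | .seq p q => p.wArr ++ q.wArr
  | .ite _ p q => p.wArr ++ q.wArr
  | .rep _ _ p => p.wArr

theorem iter_reg {f : ℕ → State → State} {r : ℕ} (h : ∀ i s, (f i s).reg r = s.reg r) (s : State)
    (n : ℕ) : (iter f s n).reg r = s.reg r := by
  induction n with
  | zero => rfl
  | succ n ih => rw [iter, h, ih]

theorem iter_arr {f : ℕ → State → State} {a : ℕ} (h : ∀ i s, (f i s).arr a = s.arr a) (s : State)
    (n : ℕ) : (iter f s n).arr a = s.arr a := by
  induction n with
  | zero => rfl
  | succ n ih => rw [iter, h, ih]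

theorem den_reg {M : ℕ} {p : St} {r : ℕ} (h : r ∉ p.wReg) (s : State) :
    (den M p s).reg r = s.reg r := by
  induction p generalizing s with
  | skip => rfl
  | set x e => simp [St.wReg] at h; simp [h]
  | put a i e => rfl
  | seq p q ihp ihq => simp [St.wReg] at h; simp [ihq h.2, ihp h.1]
  | ite e p q ihp ihq =>
    simp [St.wReg] at h
    simp only [den_ite]; split_ifs
    exacts [ihq h.2 s, ihp h.1 s]
  | rep x e p ih =>
    simp [St.wReg] at h
    exact iter_reg (fun i s => by simp [ih h.2, h.1]) s _

theorem den_arr {M : ℕ} {p : St} {a : ℕ} (h : a ∉ p.wArr) (s : State) :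
    (den M p s).arr a = s.arr a := by
  induction p generalizing s with
  | skip => rfl
  | set x e => rfl
  | put b i e => simp [St.wArr] at h; simp [h]
  | seq p q ihp ihq => simp [St.wArr] at h; simp [ihq h.2, ihp h.1]
  | ite e p q ihp ihq =>
    simp [St.wArr] at h
    simp only [den_ite]; split_ifs
    exacts [ihq h.2 s, ihp h.1 s]
  | rep x e p ih =>
    simp [St.wArr] at h
    exact iter_arr (fun i s => by simp [ih h]) s _

/-- The rule for loops: an invariant `P` that holds with index `0` on entry, and whose index is
increased by one by each round, holds with index `n` at the end. Within the loop, whatever the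
body does not write is as it was on entry. -/
theorem den_rep {M x : ℕ} {e : Ex} {p : St} {s : State} (P : ℕ → State → Prop) (n : ℕ)
    (hn : e.ev s = n) (hM : n ≤ M) (h0 : P 0 s)
    (hs : ∀ i s', i < n → (∀ r, r ∉ x :: p.wReg → s'.reg r = s.reg r) →
      (∀ a, a ∉ p.wArr → s'.arr a = s.arr a) → P i s' → P (i + 1) (den M p (s'.setReg x i))) :
    P n (den M (.rep x e p) s) := by
  have key : ∀ i, i ≤ n → P i (iter (fun i s => den M p (s.setReg x i)) s i) := by
    intro i hi
    induction i with
    | zero => exact h0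
    | succ i ih =>
      refine hs i _ (by omega) (fun r hr => ?_) (fun a ha => ?_) (ih (by omega))
      · simp only [List.mem_cons, not_or] at hr
        exact iter_reg (fun i s => by simp [den_reg hr.2, hr.1]) s _
      · exact iter_arr (fun i s => by simp [den_arr ha]) s _
  have : den M (.rep x e p) s = iter (fun i s => den M p (s.setReg x i)) s n := by
    simp [den, hn, hM]
  rw [this]
  exact key n le_rfl

/-! ### Compilation -/

/-- The `j`-th auxiliary register of the compiled programs; register `0` of these holds the cap.
The register `x` of a statement is register `2 * x` of the compiled program. -/
def tmp (j : ℕ) : ℕ := 2 * j + 1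

/-- Compute the value of an expression into auxiliary register `j`, using only the auxiliary
registers from `j` on. -/
def Ex.comp : Ex → ℕ → Prog
  | lit n, j => .const (tmp j) n
  | var x, j => .seq (.const (tmp j) 0) (.add (tmp j) (2 * x) (tmp j))
  | add e e', j => .seq (e.comp j) (.seq (e'.comp (j + 1)) (.add (tmp j) (tmp j) (tmp (j + 1))))
  | sub e e', j => .seq (e.comp j) (.seq (e'.comp (j + 1)) (.sub (tmp j) (tmp j) (tmp (j + 1))))
  | half e, j => .seq (e.comp j) (.half (tmp j) (tmp j))
  | arr a e, j => .seq (e.comp j) (.load (tmp j) a (tmp j))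

/-- The running time of `Ex.comp`. -/
def Ex.cost : Ex → ℕ
  | lit _ => 1
  | var _ => 2
  | add e e' => e.cost + (e'.cost + 1)
  | sub e e' => e.cost + (e'.cost + 1)
  | half e => e.cost + 1
  | arr _ e => e.cost + 1

/-- The compiled statement. It uses only the auxiliary registers from `j` on, and reads the cap in
auxiliary register `0`. A loop keeps the number of remaining rounds in register `j` and the number
of completed rounds in register `j + 1`. -/
def St.comp : St → ℕ → Prog
  | .skip, _ => .skip
  | .set x e, j => .seq (e.comp j) (.seq (.const (tmp (j + 1)) 0)
      (.add (2 * x) (tmp j) (tmp (j + 1))))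
  | .put a i e, j => .seq (i.comp j) (.seq (e.comp (j + 1)) (.store a (tmp j) (tmp (j + 1))))
  | .seq p q, j => .seq (p.comp j) (q.comp j)
  | .ite e p q, j => .seq (e.comp j) (.ite (tmp j) (p.comp j) (q.comp j))
  | .rep x e p, j =>
      .seq (.seq (e.comp j) (.seq (.sub (tmp (j + 1)) (tmp j) (tmp 0))
        (.seq (.sub (tmp j) (tmp j) (tmp (j + 1))) (.const (tmp (j + 1)) 0))))
      (.loop (tmp j)
        (.seq (.seq (.const (tmp (j + 2)) 0) (.add (2 * x) (tmp (j + 1)) (tmp (j + 2))))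
        (.seq (p.comp (j + 2))
        (.seq (.const (tmp (j + 2)) 1) (.seq (.add (tmp (j + 1)) (tmp (j + 1)) (tmp (j + 2)))
          (.sub (tmp j) (tmp j) (tmp (j + 2))))))))

/-- A bound for the running time of the compiled statement under the cap `M`. -/
def St.time (M : ℕ) : St → ℕ
  | .skip => 1
  | .set _ e => e.cost + 2
  | .put _ i e => i.cost + (e.cost + 1)
  | .seq p q => p.time M + q.time M
  | .ite e p q => e.cost + (p.time M + q.time M + 1)
  | .rep _ e p => e.cost + 3 + (M * (p.time M + 6) + 1)

/-- The state `σ` of a compiled program represents the state `s`, and the cap is `M`. -/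
structure Sim (M : ℕ) (s σ : State) : Prop where
  reg : ∀ r, σ.reg (2 * r) = s.reg r
  arr : σ.arr = s.arr
  cap : σ.reg (tmp 0) = M

/-- `σ` and `σ'` have the same auxiliary registers below `j`. -/
def SameTmp (j : ℕ) (σ σ' : State) : Prop := ∀ i, i < j → σ'.reg (tmp i) = σ.reg (tmp i)

theorem tmp_ne (x j : ℕ) : 2 * x ≠ tmp j := by unfold tmp; omega
theorem tmp_inj {i j : ℕ} : tmp i = tmp j ↔ i = j := by unfold tmp; omega

theorem Sim.setTmp {M : ℕ} {s σ : State} (h : Sim M s σ) {j : ℕ} (hj : 1 ≤ j) (v : ℕ) :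
    Sim M s (σ.setReg (tmp j) v) :=
  ⟨fun r => by simp [tmp_ne, h.reg], h.arr, by
    rw [State.setReg_reg, if_neg (by rw [tmp_inj]; omega), h.cap]⟩

theorem Sim.setReg {M : ℕ} {s σ : State} (h : Sim M s σ) (x v : ℕ) :
    Sim M (s.setReg x v) (σ.setReg (2 * x) v) :=
  ⟨fun r => by simp [h.reg], h.arr, by simp [(tmp_ne _ _).symm, h.cap]⟩

theorem Sim.setArr {M : ℕ} {s σ : State} (h : Sim M s σ) (a i v : ℕ) :
    Sim M (s.setArr a i v) (σ.setArr a i v) :=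
  ⟨h.reg, by funext b; simp [h.arr], h.cap⟩

theorem SameTmp.refl (j : ℕ) (σ : State) : SameTmp j σ σ := fun _ _ => rfl

theorem SameTmp.trans {j : ℕ} {σ₁ σ₂ σ₃ : State} (h : SameTmp j σ₁ σ₂) (h' : SameTmp j σ₂ σ₃) :
    SameTmp j σ₁ σ₃ := fun i hi => (h' i hi).trans (h i hi)

theorem SameTmp.mono {i j : ℕ} {σ σ' : State} (h : SameTmp j σ σ') (hij : i ≤ j) :
    SameTmp i σ σ' := fun l hl => h l (by omega)

theorem sameTmp_setTmp {j l : ℕ} (h : j ≤ l) (σ : State) (v : ℕ) :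
    SameTmp j σ (σ.setReg (tmp l) v) := fun i hi => by
  rw [State.setReg_reg, if_neg (by rw [tmp_inj]; omega)]

theorem sameTmp_setReg (j : ℕ) (σ : State) (x v : ℕ) : SameTmp j σ (σ.setReg (2 * x) v) :=
  fun i _ => by rw [State.setReg_reg, if_neg (tmp_ne _ _).symm]

theorem Ex.runs_comp {M : ℕ} {s : State} (e : Ex) : ∀ {j : ℕ}, 1 ≤ j → ∀ {σ : State}, Sim M s σ →
    ∃ σ', Runs (e.comp j) σ σ' e.cost ∧ Sim M s σ' ∧ SameTmp j σ σ' ∧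
      σ'.reg (tmp j) = e.ev s := by
  induction e with
  | lit n =>
    intro j hj σ h
    exact ⟨_, .const _ _ _, h.setTmp hj _, sameTmp_setTmp le_rfl _ _, by simp⟩
  | var x =>
    intro j hj σ h
    exact ⟨_, .seq (.const _ _ _) (.add _ _ _ _), (h.setTmp hj _).setTmp hj _,
      (sameTmp_setTmp le_rfl _ _).trans (sameTmp_setTmp le_rfl _ _), by
        simp [tmp_ne, h.reg]⟩
  | add e e' ih ih' =>
    intro j hj σ h
    obtain ⟨σ₁, r₁, h₁, k₁, v₁⟩ := ih hj h
    obtain ⟨σ₂, r₂, h₂, k₂, v₂⟩ := ih' (j := j + 1) (by omega) h₁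
    refine ⟨_, .seq r₁ (.seq r₂ (.add _ _ _ _)), h₂.setTmp hj _,
      (k₁.trans (k₂.mono (by omega))).trans (sameTmp_setTmp le_rfl _ _), ?_⟩
    simp [v₂, k₂ j (by omega), v₁, Ex.ev]
  | sub e e' ih ih' =>
    intro j hj σ h
    obtain ⟨σ₁, r₁, h₁, k₁, v₁⟩ := ih hj h
    obtain ⟨σ₂, r₂, h₂, k₂, v₂⟩ := ih' (j := j + 1) (by omega) h₁
    refine ⟨_, .seq r₁ (.seq r₂ (.sub _ _ _ _)), h₂.setTmp hj _,
      (k₁.trans (k₂.mono (by omega))).trans (sameTmp_setTmp le_rfl _ _), ?_⟩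
    simp [v₂, k₂ j (by omega), v₁, Ex.ev]
  | half e ih =>
    intro j hj σ h
    obtain ⟨σ₁, r₁, h₁, k₁, v₁⟩ := ih hj h
    refine ⟨_, .seq r₁ (.half _ _ _), h₁.setTmp hj _, k₁.trans (sameTmp_setTmp le_rfl _ _), ?_⟩
    simp [v₁]
  | arr a e ih =>
    intro j hj σ h
    obtain ⟨σ₁, r₁, h₁, k₁, v₁⟩ := ih hj h
    refine ⟨_, .seq r₁ (.load _ _ _ _), h₁.setTmp hj _, k₁.trans (sameTmp_setTmp le_rfl _ _), ?_⟩
    simp [v₁, h₁.arr]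

/-- The compiled statement transforms states as the statement does, within the time bound. -/
theorem St.runs_comp {M : ℕ} (p : St) : ∀ {j : ℕ}, 1 ≤ j → ∀ {s σ : State}, Sim M s σ →
    ∃ σ' t, Runs (p.comp j) σ σ' t ∧ Sim M (den M p s) σ' ∧ SameTmp j σ σ' ∧ t ≤ p.time M := by
  induction p with
  | skip =>
    intro j hj s σ h
    exact ⟨σ, 1, .skip σ, h, .refl _ _, le_rfl⟩
  | set x e =>
    intro j hj s σ h
    obtain ⟨σ₁, r₁, h₁, k₁, v₁⟩ := e.runs_comp hj h
    refine ⟨_, _, .seq r₁ (.seq (.const _ _ _) (.add _ _ _ _)), ?_,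
      k₁.trans ((sameTmp_setTmp (by omega) _ _).trans (sameTmp_setReg _ _ _ _)), le_rfl⟩
    have : (σ₁.setReg (tmp (j + 1)) 0).reg (tmp j) + (σ₁.setReg (tmp (j + 1)) 0).reg (tmp (j + 1))
        = e.ev s := by simp [v₁, tmp_inj]
    rw [this]
    exact (h₁.setTmp (by omega) _).setReg _ _
  | put a i e =>
    intro j hj s σ h
    obtain ⟨σ₁, r₁, h₁, k₁, v₁⟩ := i.runs_comp hj h
    obtain ⟨σ₂, r₂, h₂, k₂, v₂⟩ := e.runs_comp (j := j + 1) (by omega) h₁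
    refine ⟨_, _, .seq r₁ (.seq r₂ (.store _ _ _ _)), ?_, k₁.trans (k₂.mono (by omega)), le_rfl⟩
    rw [v₂, k₂ j (by omega), v₁]
    exact h₂.setArr _ _ _
  | seq p q ihp ihq =>
    intro j hj s σ h
    obtain ⟨σ₁, t₁, r₁, h₁, k₁, b₁⟩ := ihp hj h
    obtain ⟨σ₂, t₂, r₂, h₂, k₂, b₂⟩ := ihq hj h₁
    exact ⟨σ₂, _, .seq r₁ r₂, h₂, k₁.trans k₂, add_le_add b₁ b₂⟩
  | ite e p q ihp ihq =>
    intro j hj s σ h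
    obtain ⟨σ₁, r₁, h₁, k₁, v₁⟩ := e.runs_comp hj h
    by_cases he : e.ev s = 0
    · obtain ⟨σ₂, t₂, r₂, h₂, k₂, b₂⟩ := ihq hj h₁
      refine ⟨σ₂, _, .seq r₁ (.ite_false (by rw [v₁, he]) r₂), ?_, k₁.trans k₂, ?_⟩
      · simpa [he] using h₂
      · simp only [St.time]; omega
    · obtain ⟨σ₂, t₂, r₂, h₂, k₂, b₂⟩ := ihp hj h₁
      refine ⟨σ₂, _, .seq r₁ (.ite_true (by rw [v₁]; exact he) r₂), ?_, k₁.trans k₂, ?_⟩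
      · simpa [he] using h₂
      · simp only [St.time]; omega
  | rep x e p ih =>
    intro j hj s σ h
    obtain ⟨σ₁, r₁, h₁, k₁, v₁⟩ := e.runs_comp hj h
    set n := min (e.ev s) M with hn
    set f : ℕ → State → State := fun i s => den M p (s.setReg x i) with hf
    set B : Prog := (.seq (.seq (.const (tmp (j + 2)) 0) (.add (2 * x) (tmp (j + 1)) (tmp (j + 2))))
        (.seq (p.comp (j + 2))
        (.seq (.const (tmp (j + 2)) 1) (.seq (.add (tmp (j + 1)) (tmp (j + 1)) (tmp (j + 2)))
          (.sub (tmp j) (tmp j) (tmp (j + 2))))))) with hB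
    -- the loop, started when `i` rounds are completed and `m` rounds remain
    have loop : ∀ m i σ, i + m = n → Sim M (iter f s i) σ → σ.reg (tmp j) = m →
        σ.reg (tmp (j + 1)) = i → ∃ σ' t, Runs (.loop (tmp j) B) σ σ' t ∧
          Sim M (iter f s n) σ' ∧ SameTmp j σ σ' ∧ t ≤ m * (p.time M + 6) + 1 := by
      intro m
      induction m with
      | zero =>
        intro i σ hi hσ h0 h1
        obtain rfl : i = n := by omega
        exact ⟨σ, 1, .loop_done h0, hσ, .refl _ _, by simp⟩
      | succ m ihm =>
        intro i σ hi hσ h0 h1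
        have a1 : ((σ.setReg (tmp (j + 2)) 0).reg (tmp (j + 1)) +
            (σ.setReg (tmp (j + 2)) 0).reg (tmp (j + 2))) = i := by simp [tmp_inj, h1]
        obtain ⟨σ₂, t₂, r₂, h₂, k₂, b₂⟩ := ih (j := j + 2) (by omega)
          ((hσ.setTmp (j := j + 2) (by omega) 0).setReg x i)
        have c1 : σ₂.reg (tmp j) = m + 1 := by
          rw [k₂ j (by omega)]; simp [(tmp_ne _ _).symm, tmp_inj, h0]
        have c2 : σ₂.reg (tmp (j + 1)) = i := by
          rw [k₂ (j + 1) (by omega)]; simp [(tmp_ne _ _).symm, tmp_inj, h1]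
        obtain ⟨σ₃, t₃, r₃, h₃, k₃, b₃⟩ := ihm (i + 1)
          (((σ₂.setReg (tmp (j + 2)) 1).setReg (tmp (j + 1)) (i + 1)).setReg (tmp j) m) (by omega)
          (((h₂.setTmp (by omega) _).setTmp (by omega) _).setTmp (by omega) _)
          (by simp) (by simp [tmp_inj])
        have e1 : ((σ₂.setReg (tmp (j + 2)) 1).reg (tmp (j + 1)) +
            (σ₂.setReg (tmp (j + 2)) 1).reg (tmp (j + 2))) = i + 1 := by simp [tmp_inj, c2]
        have e2 : ((σ₂.setReg (tmp (j + 2)) 1).setReg (tmp (j + 1)) (i + 1)).reg (tmp j) -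
            ((σ₂.setReg (tmp (j + 2)) 1).setReg (tmp (j + 1)) (i + 1)).reg (tmp (j + 2)) = m := by
          simp [tmp_inj, c1]
        have rb : Runs B σ (((σ₂.setReg (tmp (j + 2)) 1).setReg (tmp (j + 1)) (i + 1)).setReg
            (tmp j) m) (1 + 1 + (t₂ + (1 + (1 + 1)))) := by
          refine .seq (.seq (.const _ _ _) (.add _ _ _ _)) (.seq (s₁ := σ₂) ?_ (.seq (.const _ _ _)
            (.seq (s₁ := (σ₂.setReg (tmp (j + 2)) 1).setReg (tmp (j + 1)) (i + 1)) ?_ ?_)))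
          · rw [a1]; exact r₂
          · have := Runs.add (tmp (j + 1)) (tmp (j + 1)) (tmp (j + 2))
              (σ₂.setReg (tmp (j + 2)) 1)
            rwa [e1] at this
          · have := Runs.sub (tmp j) (tmp j) (tmp (j + 2))
              ((σ₂.setReg (tmp (j + 2)) 1).setReg (tmp (j + 1)) (i + 1))
            rwa [e2] at this
        refine ⟨σ₃, _, .loop_step (by omega) rb r₃, h₃, ?_, ?_⟩
        · exact ((((((sameTmp_setTmp (by omega) _ _).trans (sameTmp_setReg _ _ _ _)).trans
            (k₂.mono (by omega))).trans (sameTmp_setTmp (by omega) _ _)).trans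
            (sameTmp_setTmp (by omega) _ _)).trans (sameTmp_setTmp le_rfl _ _)).trans k₃
        · rw [Nat.succ_mul]; omega
    have hcap := h₁.cap
    have f1 : σ₁.reg (tmp j) - σ₁.reg (tmp 0) = e.ev s - M := by rw [v₁, hcap]
    have f2 : ((σ₁.setReg (tmp (j + 1)) (e.ev s - M)).reg (tmp j) -
        (σ₁.setReg (tmp (j + 1)) (e.ev s - M)).reg (tmp (j + 1))) = n := by
      simp [tmp_inj, v₁]; omega
    have r2 : Runs (.seq (.sub (tmp (j + 1)) (tmp j) (tmp 0))
        (.seq (.sub (tmp j) (tmp j) (tmp (j + 1))) (.const (tmp (j + 1)) 0))) σ₁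
        (((σ₁.setReg (tmp (j + 1)) (e.ev s - M)).setReg (tmp j) n).setReg (tmp (j + 1)) 0)
        (1 + (1 + 1)) := by
      refine .seq (s₁ := σ₁.setReg (tmp (j + 1)) (e.ev s - M)) ?_
        (.seq (s₁ := (σ₁.setReg (tmp (j + 1)) (e.ev s - M)).setReg (tmp j) n) ?_ (.const _ _ _))
      · have := Runs.sub (tmp (j + 1)) (tmp j) (tmp 0) σ₁
        rwa [f1] at this
      · have := Runs.sub (tmp j) (tmp j) (tmp (j + 1)) (σ₁.setReg (tmp (j + 1)) (e.ev s - M))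
        rwa [f2] at this
    obtain ⟨σ₃, t₃, r₃, h₃, k₃, b₃⟩ := loop n 0 _ (by omega)
      (((h₁.setTmp (j := j + 1) (by omega) (e.ev s - M)).setTmp hj n).setTmp (j := j + 1) (by omega) 0)
      (by simp [tmp_inj]) (by simp)
    refine ⟨σ₃, _, .seq (.seq r₁ r2) r₃, h₃, ?_, ?_⟩
    · exact (((k₁.trans (sameTmp_setTmp (by omega) _ _)).trans (sameTmp_setTmp le_rfl _ _)).trans
        (sameTmp_setTmp (by omega) _ _)).trans k₃
    · have : n * (p.time M + 6) ≤ M * (p.time M + 6) := Nat.mul_le_mul_right _ (min_le_right _ _)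
      simp only [St.time]; omega

/-- The running time is bounded by a polynomial in the cap. -/
theorem St.time_le (p : St) : ∃ K E : ℕ, ∀ M, p.time M ≤ K * (M + 1) ^ E := by
  -- both exponents can be raised to a common one
  have mono : ∀ {K E E' M : ℕ}, E ≤ E' → K * (M + 1) ^ E ≤ K * (M + 1) ^ E' := fun h =>
    Nat.mul_le_mul_left _ (Nat.pow_le_pow_right (by omega) h)
  have one : ∀ M E : ℕ, 1 ≤ (M + 1) ^ E := fun M E => Nat.one_le_pow _ _ (by omega)
  induction p with
  | skip => exact ⟨1, 0, by simp [St.time]⟩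
  | set x e => exact ⟨e.cost + 2, 0, by simp [St.time]⟩
  | put a i e => exact ⟨i.cost + (e.cost + 1), 0, by simp [St.time]⟩
  | seq p q ihp ihq =>
    obtain ⟨K, E, h⟩ := ihp
    obtain ⟨K', E', h'⟩ := ihq
    refine ⟨K + K', max E E', fun M => ?_⟩
    have h1 := (h M).trans (mono (le_max_left E E'))
    have h2 := (h' M).trans (mono (le_max_right E E'))
    simp only [St.time, add_mul]; omega
  | ite e p q ihp ihq =>
    obtain ⟨K, E, h⟩ := ihp
    obtain ⟨K', E', h'⟩ := ihq
    refine ⟨K + K' + (e.cost + 1), max E E', fun M => ?_⟩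
    have h1 := (h M).trans (mono (le_max_left E E'))
    have h2 := (h' M).trans (mono (le_max_right E E'))
    have h3 := Nat.mul_le_mul_left (e.cost + 1) (one M (max E E'))
    simp only [St.time, add_mul] at *; omega
  | rep x e p ih =>
    obtain ⟨K, E, h⟩ := ih
    refine ⟨K + 6 + (e.cost + 4), E + 1, fun M => ?_⟩
    have h1 : p.time M + 6 ≤ (K + 6) * (M + 1) ^ E := by
      have h3 := Nat.mul_le_mul_left 6 (one M E)
      have := h M
      simp only [add_mul] at *; omega
    have h2 : M * (p.time M + 6) ≤ (K + 6) * (M + 1) ^ (E + 1) := by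
      calc M * (p.time M + 6) ≤ (M + 1) * ((K + 6) * (M + 1) ^ E) :=
            Nat.mul_le_mul (by omega) h1
        _ = _ := by ring
    have h3 := Nat.mul_le_mul_left (e.cost + 4) (one M (E + 1))
    simp only [St.time]
    rw [add_mul (K + 6)]; omega

end Ram

/-! ### Circuits in arrays -/

/-- A Boolean circuit with gates `0, …, N - 1`, as it is stored in arrays: the type of gate `i` is
`typ i` (`0` for an input, `1` for a negation, `2` for a conjunction, `3` for a disjunction), and
its in-neighbours are `prd i 0, …, prd i (deg i - 1)`. The gate `N - 1` is the output. -/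
structure Net : Type where
  N : ℕ
  typ : ℕ → ℕ
  deg : ℕ → ℕ
  prd : ℕ → ℕ → ℕ

namespace Net

variable {G : Net}

/-- The arrays describe a valid circuit. -/
structure Ok (G : Net) : Prop where
  pos : 0 < G.N
  typ_le : ∀ i < G.N, G.typ i ≤ 3
  deg_input : ∀ i < G.N, G.typ i = 0 → G.deg i = 0
  deg_not : ∀ i < G.N, G.typ i = 1 → G.deg i = 1
  deg_big : ∀ i < G.N, 2 ≤ G.typ i → 2 ≤ G.deg i
  prd_lt : ∀ i < G.N, ∀ j < G.deg i, G.prd i j < i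

/-- The gate `i` as a node of a circuit. -/
def gate (G : Net) (i : ℕ) : Gate :=
  if G.typ i = 0 then .input
  else if G.typ i = 1 then .not (G.prd i 0)
  else if G.typ i = 2 then .and ((List.range (G.deg i)).map (G.prd i))
  else .or ((List.range (G.deg i)).map (G.prd i))

/-- The circuit. -/
def circuit (G : Net) : Circuit := (List.range G.N).map G.gate

theorem length_circuit : G.circuit.length = G.N := by simp [circuit]

theorem getElem?_circuit {i : ℕ} {g : Gate} :
    G.circuit[i]? = some g ↔ i < G.N ∧ G.gate i = g := by
  simp [circuit, List.getElem?_eq_some_iff]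

theorem Ok.preds_gate (h : G.Ok) {i : ℕ} (hi : i < G.N) :
    (G.gate i).preds = (List.range (G.deg i)).map (G.prd i) := by
  unfold gate
  split_ifs with h0 h1 h2
  · simp [Gate.preds, h.deg_input i hi h0]
  · simp [Gate.preds, h.deg_not i hi h1, List.range_succ]
  · rfl
  · rfl

theorem Ok.valid (h : G.Ok) : G.circuit.Valid := by
  refine ⟨fun h0 => ?_, fun i g hg => ?_⟩
  · have := length_circuit (G := G)
    rw [h0] at this
    have := h.pos
    simp_all
  · obtain ⟨hi, rfl⟩ := getElem?_circuit.1 hg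
    refine ⟨fun u hu => ?_, ?_⟩
    · rw [h.preds_gate hi] at hu
      simp only [List.mem_map, List.mem_range] at hu
      obtain ⟨j, hj, rfl⟩ := hu
      exact h.prd_lt i hi j hj
    · have := h.deg_big i hi
      unfold gate
      split_ifs <;> simp only [Gate.FanInOk, List.length_map, List.length_range] <;>
        exact this (by omega)

/-- A node has an in-neighbour, unless it is an input. -/
theorem Ok.typ_eq_zero (h : G.Ok) {i : ℕ} (hi : i < G.N) : G.typ i = 0 ↔ G.deg i = 0 := by
  refine ⟨h.deg_input i hi, fun h0 => ?_⟩
  have h1 := h.deg_not i hi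
  have h2 := h.deg_big i hi
  by_contra h3
  by_cases h4 : G.typ i = 1
  · have := h1 h4; omega
  · have := h2 (by omega); omega

/-! ### Depth and weft by dynamic programming -/

/-- `f i` is the largest sum of the weights `w` along a path that leads from an input to `i`,
expressed by the recursion along the edges. -/
def IsHeight (G : Net) (w f : ℕ → ℕ) : Prop :=
  ∀ i < G.N, f i = w i + (Finset.range (G.deg i)).sup fun j => f (G.prd i j)

theorem IsHeight.prd_le {w f : ℕ → ℕ} (h : G.IsHeight w f) {i j : ℕ} (hi : i < G.N)
    (hj : j < G.deg i) : w i + f (G.prd i j) ≤ f i := by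
  rw [h i hi]
  gcongr
  exact Finset.le_sup (f := fun j => f (G.prd i j)) (Finset.mem_range.2 hj)

theorem edge_iff (h : G.Ok) {a b : ℕ} :
    G.circuit.Edge a b ↔ b < G.N ∧ ∃ j < G.deg b, G.prd b j = a := by
  constructor
  · rintro ⟨g, hg, ha⟩
    obtain ⟨hb, rfl⟩ := getElem?_circuit.1 hg
    rw [h.preds_gate hb] at ha
    simpa [hb] using ha
  · rintro ⟨hb, j, hj, rfl⟩
    exact ⟨_, getElem?_circuit.2 ⟨hb, rfl⟩, by
      rw [h.preds_gate hb]; simp only [List.mem_map, List.mem_range]; exact ⟨j, hj, rfl⟩⟩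

theorem IsHeight.sum_le {w f : ℕ → ℕ} (hf : G.IsHeight w f) (h : G.Ok) (l : List ℕ) :
    ∀ i < G.N, l.IsChain G.circuit.Edge → l.getLast? = some i → (l.map w).sum ≤ f i := by
  induction l using List.reverseRecOn with
  | nil => simp
  | append_singleton l b ih =>
    intro i hi hc hl
    obtain rfl : b = i := by simpa using hl
    rcases l.eq_nil_or_concat with rfl | ⟨l', a, rfl⟩
    · simp [hf b hi]
    · rw [List.concat_eq_append] at *
      rw [List.isChain_append] at hc
      obtain ⟨hc1, -, hc2⟩ := hc
      obtain ⟨-, j, hj, rfl⟩ := (edge_iff h).1 (hc2 a (by simp) b (by simp))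
      have h1 := ih _ ((h.prd_lt b hi j hj).trans hi) hc1 (by simp)
      have h2 := hf.prd_le hi hj
      rw [List.map_append, List.sum_append, List.map_singleton, List.sum_singleton]
      omega

theorem IsHeight.exists_sum_eq {w f : ℕ → ℕ} (hf : G.IsHeight w f) (h : G.Ok) (i : ℕ) :
    i < G.N → ∃ l : List ℕ, l.IsChain G.circuit.Edge ∧
      (∃ u, l.head? = some u ∧ G.circuit[u]? = some Gate.input) ∧ l.getLast? = some i ∧
      (l.map w).sum = f i := by
  induction i using Nat.strong_induction_on with
  | _ i ih =>
    intro hi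
    by_cases h0 : G.deg i = 0
    · refine ⟨[i], by simp, ⟨i, rfl, getElem?_circuit.2 ⟨hi, ?_⟩⟩, rfl, ?_⟩
      · simp [gate, (h.typ_eq_zero hi).2 h0]
      · simp [hf i hi, h0]
    · obtain ⟨j, hj, hs⟩ := Finset.exists_mem_eq_sup (Finset.range (G.deg i))
        ⟨0, by simp; omega⟩ (fun j => f (G.prd i j))
      have hj' := Finset.mem_range.1 hj
      have hlt := h.prd_lt i hi j hj'
      obtain ⟨l, l1, ⟨u, l2, l3⟩, l4, l5⟩ := ih _ hlt (hlt.trans hi)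
      refine ⟨l ++ [i], ?_, ⟨u, ?_, l3⟩, by simp, ?_⟩
      · rw [List.isChain_append]
        refine ⟨l1, by simp, fun x hx y hy => ?_⟩
        rw [l4] at hx
        simp only [Option.mem_def, Option.some.injEq, List.head?_cons] at hx hy
        subst hx hy
        exact (edge_iff h).2 ⟨hi, j, hj', rfl⟩
      · rw [List.head?_append, l2]; rfl
      · rw [List.map_append, List.sum_append, l5, hf i hi, hs]; simp [add_comm]

/-- The largest weight of a path from an input to the output is the height of the output. -/
theorem IsHeight.forall_path_le_iff {w f : ℕ → ℕ} (hf : G.IsHeight w f) (h : G.Ok) (t : ℕ) :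
    (∀ l, G.circuit.IsPath l → (l.map w).sum ≤ t) ↔ f (G.N - 1) ≤ t := by
  have hN : G.N - 1 < G.N := by have := h.pos; omega
  constructor
  · intro hl
    obtain ⟨l, l1, l2, l3, l4⟩ := hf.exists_sum_eq h _ hN
    rw [← l4]
    exact hl l ⟨l1, l2, by rw [length_circuit]; exact l3⟩
  · rintro hl l ⟨l1, l2, l3⟩
    rw [length_circuit] at l3
    exact (hf.sum_le h l _ hN l1 l3).trans hl

theorem Ok.depthLE_iff (h : G.Ok) {f : ℕ → ℕ} (hf : G.IsHeight (fun _ => 1) f) (D : ℕ) :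
    G.circuit.DepthLE D ↔ f (G.N - 1) ≤ D + 1 := by
  rw [← hf.forall_path_le_iff h]
  simp [Circuit.DepthLE]

theorem Ok.inDegree (h : G.Ok) {i : ℕ} (hi : i < G.N) : G.circuit.inDegree i = G.deg i := by
  rw [Circuit.inDegree, getElem?_circuit.2 ⟨hi, rfl⟩]
  simp [h.preds_gate hi]

/-- The weight of a node that counts large nodes. -/
def large (G : Net) (i : ℕ) : ℕ := if 2 < G.deg i then 1 else 0

theorem Ok.weftLE_iff (h : G.Ok) {f : ℕ → ℕ} (hf : G.IsHeight G.large f) (t : ℕ) :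
    G.circuit.WeftLE t ↔ f (G.N - 1) ≤ t := by
  rw [← hf.forall_path_le_iff h]
  refine forall_congr' fun l => ?_
  refine imp_congr_right fun hl => ?_
  -- all nodes of a path are nodes of the circuit
  have hmem : ∀ l : List ℕ, ∀ i, l.IsChain G.circuit.Edge → l.getLast? = some i → i < G.N →
      ∀ v ∈ l, v < G.N := by
    intro l
    induction l using List.reverseRecOn with
    | nil => simp
    | append_singleton l b ih =>
      intro i hc hl hi v hv
      obtain rfl : b = i := by simpa using hl
      rcases l.eq_nil_or_concat with rfl | ⟨l', a, rfl⟩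
      · simp at hv; omega
      · rw [List.concat_eq_append] at *
        rw [List.isChain_append] at hc
        obtain ⟨hc1, -, hc2⟩ := hc
        obtain ⟨-, j, hj, rfl⟩ := (edge_iff h).1 (hc2 a (by simp) b (by simp))
        rcases List.mem_append.1 hv with hv | hv
        · exact ih _ hc1 (by simp) ((h.prd_lt b hi j hj).trans hi) v hv
        · simp at hv; omega
  have hN : G.N - 1 < G.N := by have := h.pos; omega
  have hall := hmem l (G.N - 1) hl.1 (by rw [hl.2.2, length_circuit]) hN
  have : l.countP (fun v => decide (2 < G.circuit.inDegree v)) = (l.map G.large).sum := by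
    clear hl
    induction l with
    | nil => rfl
    | cons a l ih =>
      rw [List.countP_cons, List.map_cons, List.sum_cons, ih fun v hv => hall v (by simp [hv]),
        h.inDegree (hall a (by simp)), add_comm, large]
      simp
  rw [this]

/-! ### Evaluation -/

open scoped Classical in
/-- The value of gate `i`, if `v` gives the values of its in-neighbours. An input is true if
`as i ≠ 0`. Where `ov i ≠ 0`, the value is overridden by `ov i - 1`. -/
noncomputable def rule (G : Net) (as ov v : ℕ → ℕ) (i : ℕ) : ℕ :=
  if ov i ≠ 0 then ov i - 1
  else if G.typ i = 0 then (if as i = 0 then 0 else 1)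
  else if G.typ i = 1 then 1 - v (G.prd i 0)
  else if G.typ i = 2 then (if ∀ j < G.deg i, v (G.prd i j) ≠ 0 then 1 else 0)
  else (if ∃ j < G.deg i, v (G.prd i j) ≠ 0 then 1 else 0)

/-- The values of the gates. -/
noncomputable def val (G : Net) (as ov : ℕ → ℕ) : ℕ → ℕ :=
  Ram.iter (fun i v => Function.update v i (G.rule as ov v i)) (fun _ => 0) G.N

theorem Ok.rule_congr (h : G.Ok) {as ov as' ov' v v' : ℕ → ℕ} {i : ℕ} (hi : i < G.N)
    (ho : ov i = ov' i) (ha : as i = 0 ↔ as' i = 0)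
    (hv : ov i = 0 → ∀ j < G.deg i, v (G.prd i j) = v' (G.prd i j)) :
    G.rule as ov v i = G.rule as' ov' v' i := by
  unfold rule
  rw [← ho]
  by_cases h0 : ov i = 0
  · have hv := hv h0
    have e1 : (∀ j < G.deg i, v (G.prd i j) ≠ 0) ↔ ∀ j < G.deg i, v' (G.prd i j) ≠ 0 :=
      forall₂_congr fun j hj => by rw [hv j hj]
    have e2 : (∃ j < G.deg i, v (G.prd i j) ≠ 0) ↔ ∃ j < G.deg i, v' (G.prd i j) ≠ 0 :=
      exists_congr fun j => and_congr_right fun hj => by rw [hv j hj]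
    have e3 : G.typ i = 1 → v (G.prd i 0) = v' (G.prd i 0) := fun h1 =>
      hv 0 (by rw [h.deg_not i hi h1]; omega)
    simp only [e1, e2, ha]
    split_ifs with h1 h2 <;> first | rfl | (rw [e3 (by assumption)])
  · simp [h0]

theorem Ok.val_eq (h : G.Ok) (as ov : ℕ → ℕ) :
    ∀ i < G.N, G.val as ov i = G.rule as ov (G.val as ov) i := by
  set f : ℕ → (ℕ → ℕ) → ℕ → ℕ := fun i v => Function.update v i (G.rule as ov v i) with hf
  have key : ∀ n ≤ G.N, ∀ i < n,
      Ram.iter f (fun _ => 0) n i = G.rule as ov (Ram.iter f (fun _ => 0) n) i := by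
    intro n
    induction n with
    | zero => intro _ i hi; omega
    | succ n ih =>
      intro hn i hi
      set v := Ram.iter f (fun _ => 0) n with hv
      have hstep : Ram.iter f (fun _ => 0) (n + 1) = Function.update v n (G.rule as ov v n) := rfl
      have hc : ∀ i ≤ n, G.rule as ov (Function.update v n (G.rule as ov v n)) i
          = G.rule as ov v i := fun i hi => by
        refine h.rule_congr (by omega) rfl Iff.rfl fun _ j hj => ?_
        have := h.prd_lt i (by omega) j hj
        rw [Function.update_of_ne (by omega)]
      rw [hstep, hc i (by omega)]
      by_cases e : i = n
      · subst e; rw [Function.update_self]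
      · rw [Function.update_of_ne e]; exact ih (by omega) i (by omega)
  exact key G.N le_rfl

/-- The recursion determines the values, and it suffices that the ingredients of the recursion agree
on a set of gates that is closed under taking in-neighbours of gates that are not overridden. -/
theorem Ok.val_congr (h : G.Ok) {as ov as' ov' v v' : ℕ → ℕ} (P : ℕ → Prop)
    (hv : ∀ i < G.N, v i = G.rule as ov v i) (hv' : ∀ i < G.N, v' i = G.rule as' ov' v' i)
    (hP : ∀ i < G.N, P i → ov i = ov' i ∧ (as i = 0 ↔ as' i = 0) ∧
      (ov i = 0 → ∀ j < G.deg i, P (G.prd i j))) :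
    ∀ i < G.N, P i → v i = v' i := by
  intro i
  induction i using Nat.strong_induction_on with
  | _ i ih =>
    intro hi hPi
    obtain ⟨h1, h2, h3⟩ := hP i hi hPi
    rw [hv i hi, hv' i hi]
    refine h.rule_congr hi h1 h2 fun h0 j hj => ?_
    have := h.prd_lt i hi j hj
    exact ih _ this (this.trans hi) (h3 h0 j hj)

theorem Ok.val_unique (h : G.Ok) {as ov v : ℕ → ℕ} (hv : ∀ i < G.N, v i = G.rule as ov v i) :
    ∀ i < G.N, v i = G.val as ov i := fun i hi =>
  h.val_congr (fun _ => True) hv (h.val_eq as ov) (fun _ _ _ => by simp) i hi trivial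

theorem Ok.val_le_one (h : G.Ok) {as ov : ℕ → ℕ} (ho : ∀ i, ov i ≤ 2) {i : ℕ} (hi : i < G.N) :
    G.val as ov i ≤ 1 := by
  rw [h.val_eq as ov i hi]
  have := ho i
  unfold rule
  split_ifs <;> omega

/-! ### Weighted satisfiability -/

/-- The number of the values `z 0, …, z (k - 1)` that are equal to `i`. -/
def cnt (k : ℕ) (z : ℕ → ℕ) (i : ℕ) : ℕ := ((Finset.range k).filter fun j => z j = i).card

theorem cnt_ne_zero {k : ℕ} {z : ℕ → ℕ} {i : ℕ} : cnt k z i ≠ 0 ↔ ∃ j < k, z j = i := by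
  simp [cnt, Finset.card_eq_zero, Finset.filter_eq_empty_iff]

/-- The values `z 0, …, z (k - 1)` are the true inputs of a satisfying assignment of weight `k`. -/
structure IsSol (G : Net) (k : ℕ) (z : ℕ → ℕ) : Prop where
  cnt_le : ∀ i < G.N, cnt k z i ≤ 1
  typ_eq : ∀ i < G.N, cnt k z i ≠ 0 → G.typ i = 0
  lt : ∀ j < k, z j < G.N
  val_ne : G.val (cnt k z) (fun _ => 0) (G.N - 1) ≠ 0

/-- Valuations of the circuit in terms of the evaluation rule. -/
theorem isValuation_iff (v : ℕ → Bool) :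
    G.circuit.IsValuation v ↔ ∀ i < G.N, (v i).toNat =
      G.rule (fun i => (v i).toNat) (fun _ => 0) (fun i => (v i).toNat) i := by
  have e : ∀ (b : Bool), b.toNat ≠ 0 ↔ b = true := by decide
  have e' : ∀ (b : Bool), b.toNat = 0 ↔ b = false := by decide
  have hg : ∀ i < G.N, ((G.gate i).Agrees v (v i) ↔ (v i).toNat =
      G.rule (fun i => (v i).toNat) (fun _ => 0) (fun i => (v i).toNat) i) := by
    intro i hi
    have a1 : ((List.range (G.deg i)).map (G.prd i)).all v = true ↔
        ∀ j < G.deg i, v (G.prd i j) = true := by simp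
    have a2 : ((List.range (G.deg i)).map (G.prd i)).any v = true ↔
        ∃ j < G.deg i, v (G.prd i j) = true := by simp
    unfold gate rule
    simp only [ne_eq, not_true_eq_false, if_false, e, e']
    split_ifs with h0 h1 h2 h3 h4 h5
    · simp [Gate.Agrees, h1]
    · simp [Gate.Agrees, h1]
    · simp only [Gate.Agrees]
      cases v i <;> cases v (G.prd i 0) <;> simp
    · rw [← a1] at h4
      simp only [Gate.Agrees, h4]
      cases v i <;> simp
    · rw [← a1] at h4
      rw [Bool.not_eq_true] at h4
      simp only [Gate.Agrees, h4]
      cases v i <;> simp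
    · rw [← a2] at h5
      simp only [Gate.Agrees, h5]
      cases v i <;> simp
    · rw [← a2] at h5
      rw [Bool.not_eq_true] at h5
      simp only [Gate.Agrees, h5]
      cases v i <;> simp
  constructor
  · exact fun hv i hi => (hg i hi).1 (hv i _ (getElem?_circuit.2 ⟨hi, rfl⟩))
  · intro hv i g hgi
    obtain ⟨hi, rfl⟩ := getElem?_circuit.1 hgi
    exact (hg i hi).2 (hv i hi)

theorem gate_eq_input {i : ℕ} : G.gate i = .input ↔ G.typ i = 0 := by
  unfold gate
  split_ifs <;> simp_all

theorem Ok.hasSat_iff (h : G.Ok) (k : ℕ) :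
    G.circuit.HasSatOfWeight k ↔ ∃ z, G.IsSol k z := by
  have hN : G.N - 1 < G.N := by have := h.pos; omega
  constructor
  · rintro ⟨v, hv, ho, hk⟩
    rw [isValuation_iff] at hv
    rw [length_circuit] at ho
    obtain ⟨S, hS⟩ : ∃ S, S = {i | G.circuit[i]? = some Gate.input ∧ v i = true} := ⟨_, rfl⟩
    rw [← hS] at hk
    have memS : ∀ i, i ∈ S ↔ i < G.N ∧ G.typ i = 0 ∧ v i = true := fun i => by
      rw [hS, Set.mem_ofPred_eq, getElem?_circuit, gate_eq_input, and_assoc]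
    have fin : S.Finite := (Set.finite_lt_nat G.N).subset fun i hi => ((memS i).1 hi).1
    clear hS
    obtain ⟨F, rfl⟩ : ∃ F : Finset ℕ, S = F := ⟨fin.toFinset, by simp⟩
    rw [Set.ncard_coe_finset] at hk
    let em := F.equivFin.symm
    let z : ℕ → ℕ := fun j => if hj : j < F.card then (em ⟨j, hj⟩ : ℕ) else 0
    have zmem : ∀ j < k, z j ∈ F := fun j hj => by
      rw [← hk] at hj; simp only [z, hj, dif_pos]; exact (em ⟨j, hj⟩).2
    have zsurj : ∀ i ∈ F, ∃ j < k, z j = i := fun i hi => by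
      refine ⟨(em.symm ⟨i, hi⟩ : ℕ), hk ▸ (em.symm ⟨i, hi⟩).2, ?_⟩
      simp [z, (em.symm ⟨i, hi⟩).2]
    have zinj : ∀ i < k, ∀ j < k, z i = z j → i = j := fun i hi j hj hij => by
      rw [← hk] at hi hj
      simp only [z, hi, hj, dif_pos] at hij
      simpa using em.injective (Subtype.ext hij)
    have cnt0 : ∀ i, cnt k z i ≠ 0 ↔ i ∈ F := fun i => by
      rw [cnt_ne_zero]
      exact ⟨fun ⟨j, hj, e⟩ => e ▸ zmem j hj, zsurj i⟩
    refine ⟨z, fun i hi => ?_, fun i hi hc => ?_, fun j hj => ?_, ?_⟩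
    · rw [cnt, Finset.card_le_one]
      intro a ha b hb
      simp only [Finset.mem_filter, Finset.mem_range] at ha hb
      exact zinj a ha.1 b hb.1 (ha.2.trans hb.2.symm)
    · exact ((memS i).1 ((cnt0 i).1 hc)).2.1
    · exact ((memS _).1 (zmem j hj)).1
    · have : ∀ i < G.N, (v i).toNat =
          G.rule (cnt k z) (fun _ => 0) (fun i => (v i).toNat) i := fun i hi => by
        rw [hv i hi]
        by_cases ht : G.typ i = 0
        · refine h.rule_congr hi rfl ?_ fun _ _ _ => rfl
          have := cnt0 i
          rw [← Finset.mem_coe, memS] at this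
          rw [← not_iff_not, ← ne_eq, ← ne_eq, this]
          simp [hi, ht]
        · simp [rule, ht]
      rw [← h.val_unique this _ hN, ho]
      decide
  · rintro ⟨z, hz⟩
    set v := G.val (cnt k z) (fun _ => 0) with hv
    have hle : ∀ i < G.N, v i ≤ 1 := fun i hi => h.val_le_one (fun _ => by omega) hi
    have hb : ∀ i < G.N, (decide (v i ≠ 0)).toNat = v i := fun i hi => by
      have := hle i hi
      interval_cases v i <;> simp
    have h0 : ∀ i < G.N, G.typ i = 0 → (v i ≠ 0 ↔ cnt k z i ≠ 0) := fun i hi ht => by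
      rw [hv, h.val_eq _ _ i hi]; simp [rule, ht]
    refine ⟨fun i => decide (v i ≠ 0), ?_, ?_, ?_⟩
    · rw [isValuation_iff]
      intro i hi
      rw [hb i hi]
      conv_lhs => rw [hv, h.val_eq _ _ i hi]
      by_cases ht : G.typ i = 0
      · refine h.rule_congr hi rfl ?_ fun _ j hj => ?_
        · have := h0 i hi ht
          rw [hb i hi]; tauto
        · rw [h.deg_input i hi ht] at hj; omega
      · have hc : ∀ j < G.deg i, G.val (cnt k z) (fun _ => 0) (G.prd i j) =
            (decide (v (G.prd i j) ≠ 0)).toNat := fun j hj =>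
          (hb _ ((h.prd_lt i hi j hj).trans hi)).symm
        rw [h.rule_congr (as' := cnt k z) (ov' := fun _ => 0)
          (v' := fun i => (decide (v i ≠ 0)).toNat) hi rfl Iff.rfl fun _ => hc]
        simp [rule, ht]
    · rw [length_circuit]; simpa using hz.val_ne
    · have : {i | G.circuit[i]? = some Gate.input ∧ decide (v i ≠ 0) = true} =
          ((Finset.range k).image z : Finset ℕ) := by
        ext i
        simp only [Set.mem_ofPred_eq, getElem?_circuit, gate_eq_input, decide_eq_true_eq,
          Finset.coe_image, Finset.coe_range, Set.mem_image, Set.mem_Iio]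
        rw [← cnt_ne_zero]
        constructor
        · rintro ⟨⟨hi, ht⟩, hvi⟩; exact (h0 i hi ht).1 hvi
        · intro hc
          obtain ⟨j, hj, rfl⟩ := cnt_ne_zero.1 hc
          have hi := hz.lt j hj
          have ht := hz.typ_eq _ hi hc
          exact ⟨⟨hi, ht⟩, (h0 _ hi ht).2 hc⟩
      rw [this, Set.ncard_coe_finset, Finset.card_image_of_injOn, Finset.card_range]
      intro a ha b hb hab
      simp only [Finset.coe_range, Set.mem_Iio] at ha hb
      have := hz.cnt_le (z a) (hz.lt a ha)
      rw [cnt, Finset.card_le_one] at this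
      exact this a (by simp [ha]) b (by simp [hb, hab])

end Net

/-! ### Gates reached through gates of small fan-in -/

namespace Net

variable {G : Net}

/-- The gate `b` is reached from `r` against the direction of the edges through gates of indegree
at most two. The gate `b` itself may be large. -/
inductive Reach (G : Net) (r : ℕ) : ℕ → Prop
  | refl : Reach G r r
  | step {w j : ℕ} : Reach G r w → G.deg w ≤ 2 → j < G.deg w → Reach G r (G.prd w j)

theorem Reach.lt (h : G.Ok) {r b : ℕ} (hb : G.Reach r b) (hr : r < G.N) : b < G.N := by
  induction hb with
  | refl => exact hr
  | step _ _ hj ih => exact (h.prd_lt _ ih _ hj).trans ih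

theorem Reach.head {r b : ℕ} (hb : G.Reach r b) :
    b = r ∨ G.deg r ≤ 2 ∧ ∃ j < G.deg r, G.Reach (G.prd r j) b := by
  induction hb with
  | refl => exact .inl rfl
  | step _ hd hj ih =>
    rcases ih with rfl | ⟨h1, i, hi, hr⟩
    · exact .inr ⟨hd, _, hj, .refl⟩
    · exact .inr ⟨h1, i, hi, hr.step hd hj⟩

theorem Reach.height_le {w f : ℕ → ℕ} (hf : G.IsHeight w f) (h : G.Ok) {r b : ℕ}
    (hb : G.Reach r b) (hr : r < G.N) : f b ≤ f r := by
  induction hb with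
  | refl => exact le_rfl
  | step hw _ hj ih => have := hf.prd_le (hw.lt h hr) hj; omega

/-- Few gates are reached from a gate of small height: the search branches at most twice at each
level. -/
theorem exists_reach_bound (h : G.Ok) {f : ℕ → ℕ} (hf : G.IsHeight (fun _ => 1) f) (n : ℕ) :
    ∀ r < G.N, f r ≤ n → ∃ F : Finset ℕ, (∀ b, G.Reach r b → b ∈ F) ∧ F.card + 1 ≤ 2 ^ n := by
  induction n with
  | zero => intro r hr hn; have := hf r hr; simp only at this; omega
  | succ n ih =>
    intro r hr hn
    have hF : ∀ j < G.deg r, ∃ F : Finset ℕ, (∀ b, G.Reach (G.prd r j) b → b ∈ F) ∧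
        F.card + 1 ≤ 2 ^ n := fun j hj =>
      ih _ ((h.prd_lt r hr j hj).trans hr) (by have := hf.prd_le hr hj; omega)
    choose! F hF1 hF2 using hF
    by_cases hd : G.deg r ≤ 2
    · refine ⟨insert r ((Finset.range (G.deg r)).biUnion F), fun b hb => ?_, ?_⟩
      · rcases hb.head with rfl | ⟨-, j, hj, hb⟩
        · simp
        · simp only [Finset.mem_insert, Finset.mem_biUnion, Finset.mem_range]
          exact .inr ⟨j, hj, hF1 j hj b hb⟩
      · have h1 := Finset.card_insert_le r ((Finset.range (G.deg r)).biUnion F)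
        have h2 := Finset.card_biUnion_le_card_mul (Finset.range (G.deg r)) F (2 ^ n - 1)
          fun j hj => by have := hF2 j (Finset.mem_range.1 hj); omega
        rw [Finset.card_range] at h2
        have h3 : G.deg r * (2 ^ n - 1) ≤ 2 * (2 ^ n - 1) := Nat.mul_le_mul_right _ hd
        have h4 : 1 ≤ 2 ^ n := Nat.one_le_two_pow
        rw [pow_succ]; omega
    · refine ⟨{r}, fun b hb => ?_, ?_⟩
      · rcases hb.head with rfl | ⟨h1, -⟩
        · simp
        · exact absurd h1 hd
      · have h4 : 1 ≤ 2 ^ n := Nat.one_le_two_pow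
        rw [pow_succ, Finset.card_singleton]; omega

/-! ### A local test for satisfying assignments -/

/-- A numbering of the large gates that are reached from the output: `fr i ≠ 0` says that `i` is
one of them, and then `fr i - 1` is its number. There are at most `Q` of them. -/
structure IsFrontier (G : Net) (Q : ℕ) (fr : ℕ → ℕ) : Prop where
  ne_zero : ∀ i < G.N, fr i ≠ 0 ↔ G.Reach (G.N - 1) i ∧ 2 < G.deg i
  inj : ∀ i < G.N, ∀ i' < G.N, fr i ≠ 0 → fr i = fr i' → i = i'
  le : ∀ i < G.N, fr i ≤ Q

/-- The overriding values (plus one) of the frontier gates that are claimed by the witnesses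
`z k, z (k + 1), …`. The witness of gate `i` is a gate `u < N`, which says that `u` is an
in-neighbour of `i` that decides the value of `i` (a false one for a conjunction, a true one for a
disjunction), or it is `N`, which says that there is no such in-neighbour. -/
def ovr (G : Net) (k : ℕ) (fr z : ℕ → ℕ) (i : ℕ) : ℕ :=
  if fr i = 0 then 0 else if z (k + fr i - 1) = G.N then 4 - G.typ i else G.typ i - 1

/-- The vector `z` passes the local test at gate `u`. Its first `k` entries are the inputs that are
true, the further ones are the witnesses of the frontier gates. The test demands that the output is
true if the frontier gates have the claimed values, that `u` is consistent with these claims, and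
that `u`, if it is chosen as a true input, is an input and is chosen only once. -/
structure Test (G : Net) (k : ℕ) (fr : ℕ → ℕ) (u : ℕ) (z : ℕ → ℕ) : Prop where
  out : G.val (cnt k z) (G.ovr k fr z) (G.N - 1) ≠ 0
  cnt_top : cnt k z G.N = 0
  cnt_le : cnt k z u ≤ 1
  typ_eq : cnt k z u ≠ 0 → G.typ u = 0
  wit : ∀ i < G.N, fr i ≠ 0 → z (k + fr i - 1) = u →
    (∃ j < G.deg i, G.prd i j = u) ∧ G.val (cnt k z) (G.ovr k fr z) u + 1 = G.ovr k fr z i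
  no_wit : ∀ i < G.N, fr i ≠ 0 → z (k + fr i - 1) = G.N → (∃ j < G.deg i, G.prd i j = u) →
    G.val (cnt k z) (G.ovr k fr z) u + 1 = G.ovr k fr z i

theorem IsFrontier.typ (h : G.Ok) {Q : ℕ} {fr : ℕ → ℕ} (hfr : G.IsFrontier Q fr) {i : ℕ}
    (hi : i < G.N) (h0 : fr i ≠ 0) : G.typ i = 2 ∨ G.typ i = 3 := by
  have h1 := ((hfr.ne_zero i hi).1 h0).2
  have h2 := h.typ_le i hi
  have h3 := h.deg_input i hi
  have h4 := h.deg_not i hi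
  by_contra h5
  have : G.typ i = 0 ∨ G.typ i = 1 := by omega
  rcases this with h6 | h6
  · have := h3 h6; omega
  · have := h4 h6; omega

/-- If all local tests are passed, then the claimed values are the true values. -/
theorem IsFrontier.isSol (h : G.Ok) {Q k : ℕ} {fr z : ℕ → ℕ} (hfr : G.IsFrontier Q fr)
    (hz : ∀ j < k + Q, z j ≤ G.N) (ht : ∀ u < G.N, G.Test k fr u z) : G.IsSol k z := by
  have hN := h.pos
  set v := G.val (cnt k z) (G.ovr k fr z) with hv
  refine ⟨fun i hi => (ht i hi).cnt_le, fun i hi => (ht i hi).typ_eq, fun j hj => ?_, ?_⟩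
  · refine lt_of_le_of_ne (hz j (by omega)) fun e => ?_
    exact cnt_ne_zero.2 ⟨j, hj, e⟩ (ht 0 hN).cnt_top
  · have : ∀ i < G.N, v i = G.rule (cnt k z) (fun _ => 0) v i := by
      intro i hi
      have hvi := h.val_eq (cnt k z) (G.ovr k fr z) i hi
      rw [← hv] at hvi
      by_cases h0 : fr i = 0
      · rw [hvi]
        exact h.rule_congr hi (by simp [ovr, h0]) Iff.rfl fun _ _ _ => rfl
      · have hq := hfr.le i hi
        have hle := hz (k + fr i - 1) (by omega)
        have hov : G.ovr k fr z i =
            if z (k + fr i - 1) = G.N then 4 - G.typ i else G.typ i - 1 := by simp [ovr, h0]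
        have htyp := hfr.typ h hi h0
        have hpos : G.ovr k fr z i ≠ 0 := by rw [hov]; split_ifs <;> omega
        have hvi' : v i = G.ovr k fr z i - 1 := by rw [hvi]; simp [rule, hpos]
        by_cases hw : z (k + fr i - 1) = G.N
        · -- no in-neighbour decides the value
          have hall : ∀ j < G.deg i, v (G.prd i j) + 1 = G.ovr k fr z i := fun j hj =>
            (ht _ ((h.prd_lt i hi j hj).trans hi)).no_wit i hi h0 hw ⟨j, hj, rfl⟩
          rw [if_pos hw] at hov
          rw [hvi', hov]
          rcases htyp with e | e
          · have : ∀ j < G.deg i, v (G.prd i j) ≠ 0 := fun j hj => by have := hall j hj; omega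
            simpa [rule, e] using this
          · have : ∀ j < G.deg i, v (G.prd i j) = 0 := fun j hj => by have := hall j hj; omega
            simpa [rule, e] using this
        · -- the witness decides the value
          obtain ⟨⟨j, hj, e1⟩, e2⟩ := (ht _ (by omega)).wit i hi h0 rfl
          rw [← hv] at e2
          rw [if_neg hw] at hov
          rw [hvi', hov]
          rcases htyp with e | e
          · have : ∃ j < G.deg i, v (G.prd i j) = 0 := ⟨j, hj, by rw [e1]; omega⟩
            have h' : ¬ ∀ j < G.deg i, v (G.prd i j) ≠ 0 := by push Not; exact this
            simp [rule, e, h']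
          · have : ∃ j < G.deg i, v (G.prd i j) ≠ 0 := ⟨j, hj, by rw [e1]; omega⟩
            simp [rule, e, this]
    rw [← h.val_unique this _ (by omega)]
    exact (ht 0 hN).out

/-- A satisfying assignment passes all local tests, with suitable witnesses. -/
theorem IsFrontier.exists_test (h : G.Ok) {Q k : ℕ} {fr : ℕ → ℕ} (hfr : G.IsFrontier Q fr)
    {z₀ : ℕ → ℕ} (hz : G.IsSol k z₀) :
    ∃ z : ℕ → ℕ, (∀ j < k + Q, z j ≤ G.N) ∧ ∀ u < G.N, G.Test k fr u z := by
  classical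
  set v := G.val (cnt k z₀) (fun _ => 0) with hv
  have hvr : ∀ i < G.N, v i = G.rule (cnt k z₀) (fun _ => 0) v i := h.val_eq _ _
  have hle : ∀ i < G.N, v i ≤ 1 := fun i hi => h.val_le_one (fun _ => by omega) hi
  -- the witness of gate `i`: an in-neighbour with the value that decides the gate
  have hwit : ∀ i, ∃ y, (∃ j < G.deg i, G.prd i j = y ∧ v y = G.typ i - 2) ∨
      y = G.N ∧ ∀ j < G.deg i, v (G.prd i j) ≠ G.typ i - 2 := fun i => by
    by_cases hc : ∃ j < G.deg i, v (G.prd i j) = G.typ i - 2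
    · obtain ⟨j, hj, hc⟩ := hc
      exact ⟨_, .inl ⟨j, hj, rfl, hc⟩⟩
    · exact ⟨G.N, .inr ⟨rfl, fun j hj e => hc ⟨j, hj, e⟩⟩⟩
  choose wit hwit using hwit
  have wit_le : ∀ i < G.N, wit i ≤ G.N := fun i hi => by
    rcases hwit i with ⟨j, hj, e, -⟩ | ⟨e, -⟩
    · have := h.prd_lt i hi j hj; omega
    · omega
  obtain ⟨z, hz1, hz2, hz3⟩ : ∃ z : ℕ → ℕ, (∀ j < k, z j = z₀ j) ∧ (∀ j < k + Q, z j ≤ G.N) ∧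
      ∀ i < G.N, fr i ≠ 0 → z (k + fr i - 1) = wit i := by
    refine ⟨fun j => if j < k then z₀ j else
      if hi : ∃ i < G.N, fr i ≠ 0 ∧ k + fr i - 1 = j then wit hi.choose else 0, ?_, ?_, ?_⟩
    · intro j hj; simp [hj]
    · intro j hj
      dsimp only
      split_ifs with h1 h2
      · exact (hz.lt j h1).le
      · exact wit_le _ h2.choose_spec.1
      · exact Nat.zero_le _
    · intro i hi h0
      have hex : ∃ i' < G.N, fr i' ≠ 0 ∧ k + fr i' - 1 = k + fr i - 1 := ⟨i, hi, h0, rfl⟩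
      have h1 : ¬ k + fr i - 1 < k := by omega
      dsimp only
      rw [if_neg h1, dif_pos hex]
      congr 1
      obtain ⟨a1, a2, a3⟩ := hex.choose_spec
      exact hfr.inj _ a1 i hi a2 (by omega)
  have hcnt : cnt k z = cnt k z₀ := by
    funext i
    unfold cnt
    congr 1
    exact Finset.filter_congr fun j hj => by rw [hz1 j (Finset.mem_range.1 hj)]
  have hne : ∀ i < G.N, fr i ≠ 0 → (∃ j < G.deg i, G.prd i j = wit i ∧ v (wit i) = G.typ i - 2) →
      wit i ≠ G.N := fun i hi _ ⟨j, hj, e, _⟩ => by have := h.prd_lt i hi j hj; omega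
  have hovr : ∀ i < G.N, fr i ≠ 0 → G.ovr k fr z i = v i + 1 := by
    intro i hi h0
    have htyp := hfr.typ h hi h0
    simp only [ovr, h0, if_false, hz3 i hi h0]
    rw [hvr i hi]
    rcases hwit i with hw | ⟨hw, hw'⟩
    · rw [if_neg (hne i hi h0 hw)]
      obtain ⟨j, hj, e1, e2⟩ := hw
      rw [← e1] at e2
      rcases htyp with e | e
      · have : ¬ ∀ j < G.deg i, v (G.prd i j) ≠ 0 := fun hc => hc j hj (by omega)
        simp [rule, e, this]
      · have : ∃ j < G.deg i, v (G.prd i j) ≠ 0 := ⟨j, hj, by omega⟩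
        simp [rule, e, this]
    · rw [if_pos hw]
      rcases htyp with e | e
      · have : ∀ j < G.deg i, v (G.prd i j) ≠ 0 := fun j hj => by have := hw' j hj; omega
        simpa [rule, e] using this
      · have : ∀ j < G.deg i, v (G.prd i j) = 0 := fun j hj => by
          have := hw' j hj; have := hle _ ((h.prd_lt i hi j hj).trans hi); omega
        have h' : ¬ ∃ j < G.deg i, v (G.prd i j) ≠ 0 := by push Not; exact this
        simp only [rule, e, h']
        simp
  have hval : ∀ i < G.N, v i = G.val (cnt k z) (G.ovr k fr z) i := by
    refine h.val_unique fun i hi => ?_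
    by_cases h0 : fr i = 0
    · rw [hcnt]
      conv_lhs => rw [hvr i hi]
      exact h.rule_congr hi (by simp [ovr, h0]) Iff.rfl fun _ _ _ => rfl
    · simp [rule, hovr i hi h0]
  have hN := h.pos
  refine ⟨z, hz2, fun u hu => ⟨?_, ?_, ?_, ?_, ?_, ?_⟩⟩
  · rw [← hval _ (by omega)]; exact hz.val_ne
  · by_contra h0
    rw [hcnt, ← ne_eq, cnt_ne_zero] at h0
    obtain ⟨j, hj, e⟩ := h0
    have := hz.lt j hj
    omega
  · rw [hcnt]; exact hz.cnt_le u hu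
  · rw [hcnt]; exact hz.typ_eq u hu
  · intro i hi h0 hzu
    rw [hz3 i hi h0] at hzu
    rw [← hval u hu, hovr i hi h0]
    rcases hwit i with ⟨j, hj, e1, e2⟩ | ⟨hw, -⟩
    · refine ⟨⟨j, hj, by omega⟩, ?_⟩
      rw [hzu] at e1 e2
      rw [e2, hvr i hi]
      rcases hfr.typ h hi h0 with e | e
      · have : ¬ ∀ j < G.deg i, v (G.prd i j) ≠ 0 := fun hc => hc j hj (by rw [e1]; omega)
        simp [rule, e, this]
      · have : ∃ j < G.deg i, v (G.prd i j) ≠ 0 := ⟨j, hj, by rw [e1]; omega⟩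
        simp [rule, e, this]
    · omega
  · intro i hi h0 hzu ⟨j, hj, e1⟩
    rw [hz3 i hi h0] at hzu
    rw [← hval u hu, hovr i hi h0]
    rcases hwit i with hw | ⟨-, hw⟩
    · exact absurd hzu (hne i hi h0 hw)
    · have hu1 := hw j hj
      have hu2 := hle u hu
      rw [e1] at hu1
      congr 1
      rw [hvr i hi]
      rcases hfr.typ h hi h0 with e | e
      · have : ∀ j < G.deg i, v (G.prd i j) ≠ 0 := fun j hj => by have := hw j hj; omega
        simp only [rule, e, if_pos this]
        simp; omega
      · have : ∀ j < G.deg i, v (G.prd i j) = 0 := fun j hj => by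
          have := hw j hj; have := hle _ ((h.prd_lt i hi j hj).trans hi); omega
        have h' : ¬ ∃ j < G.deg i, v (G.prd i j) ≠ 0 := by push Not; exact this
        simp only [rule, e, h']
        simp; omega

/-- The breakpoints for the test at `u`: the gates that are reached from the output or from `u`,
and the entries with a special meaning. A gate `u` of height more than `D + 1` is no
in-neighbour of a frontier gate, so what is reached from it does not matter. -/
def IsBreak (G : Net) (D : ℕ) (f : ℕ → ℕ) (u b : ℕ) : Prop :=
  G.Reach (G.N - 1) b ∨ (f u ≤ D + 1 ∧ G.Reach u b) ∨ b = u ∨ b = G.N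

/-- In a circuit of weft one, the test at `u` depends only on which entries are equal to which
breakpoints: a frontier gate is the only large gate on its paths, so the gates reached from its
in-neighbours depend only on inputs among the breakpoints. -/
theorem IsFrontier.test_congr (h : G.Ok) {Q k D : ℕ} {fr f₁ f₂ : ℕ → ℕ}
    (hfr : G.IsFrontier Q fr) (hf₁ : G.IsHeight (fun _ => 1) f₁) (hf₂ : G.IsHeight G.large f₂)
    (hD : f₁ (G.N - 1) ≤ D + 1) (hW : f₂ (G.N - 1) ≤ 1) {u : ℕ} (hu : u < G.N) {z z' : ℕ → ℕ}
    (hzz : ∀ j < k + Q, ∀ b, G.IsBreak D f₁ u b → (z j = b ↔ z' j = b)) (ht : G.Test k fr u z) :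
    G.Test k fr u z' := by
  have hN := h.pos
  have hcnt : ∀ b, G.IsBreak D f₁ u b → cnt k z b = cnt k z' b := fun b hb => by
    unfold cnt
    congr 1
    exact Finset.filter_congr fun j hj =>
      hzz j (by have := Finset.mem_range.1 hj; omega) b hb
  have hzN : ∀ i < G.N, fr i ≠ 0 → (z (k + fr i - 1) = G.N ↔ z' (k + fr i - 1) = G.N) :=
    fun i hi h0 => hzz _ (by have := hfr.le i hi; omega) _ (.inr (.inr (.inr rfl)))
  have hzu : ∀ i < G.N, fr i ≠ 0 → (z (k + fr i - 1) = u ↔ z' (k + fr i - 1) = u) :=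
    fun i hi h0 => hzz _ (by have := hfr.le i hi; omega) _ (.inr (.inr (.inl rfl)))
  have hovr : ∀ i < G.N, G.ovr k fr z i = G.ovr k fr z' i := fun i hi => by
    by_cases h0 : fr i = 0
    · simp [ovr, h0]
    · simp [ovr, h0, hzN i hi h0]
  have hout : G.val (cnt k z) (G.ovr k fr z) (G.N - 1) =
      G.val (cnt k z') (G.ovr k fr z') (G.N - 1) := by
    refine h.val_congr (G.Reach (G.N - 1)) (h.val_eq _ _) (h.val_eq _ _) (fun i hi hr => ?_) _
      (by omega) .refl
    refine ⟨hovr i hi, by rw [hcnt i (.inl hr)], fun h0 j hj => ?_⟩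
    by_cases hd : G.deg i ≤ 2
    · exact hr.step hd hj
    · have h1 : fr i ≠ 0 := (hfr.ne_zero i hi).2 ⟨hr, by omega⟩
      have := hfr.typ h hi h1
      unfold ovr at h0
      rw [if_neg h1] at h0
      split_ifs at h0 <;> omega
  have hval : ∀ i < G.N, fr i ≠ 0 → (∃ j < G.deg i, G.prd i j = u) →
      G.val (cnt k z) (G.ovr k fr z) u = G.val (cnt k z') (G.ovr k fr z') u := by
    rintro i hi h0 ⟨j, hj, rfl⟩
    obtain ⟨hr, hd⟩ := (hfr.ne_zero i hi).1 h0
    have b1 := hr.height_le hf₁ h (by omega)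
    have b2 := hr.height_le hf₂ h (by omega)
    have c1 := hf₁.prd_le hi hj
    have c2 := hf₂.prd_le hi hj
    have hl : G.large i = 1 := by simp [large, hd]
    refine h.val_congr (G.Reach (G.prd i j)) (h.val_eq _ _) (h.val_eq _ _)
      (fun b hb hrb => ?_) _ hu .refl
    have hbr : G.IsBreak D f₁ (G.prd i j) b := .inr (.inl ⟨by omega, hrb⟩)
    refine ⟨hovr b hb, by rw [hcnt b hbr], fun _ l hl' => hrb.step ?_ hl'⟩
    by_contra hlarge
    have e1 := hrb.height_le hf₂ h hu
    have e2 := hf₂ b hb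
    have e3 : G.large b = 1 := by simp only [large]; rw [if_pos (by omega)]
    omega
  have hbu : G.IsBreak D f₁ u u := .inr (.inr (.inl rfl))
  refine ⟨hout ▸ ht.out, ?_, ?_, ?_, ?_, ?_⟩
  · rw [← hcnt _ (.inr (.inr (.inr rfl)))]; exact ht.cnt_top
  · rw [← hcnt u hbu]; exact ht.cnt_le
  · rw [← hcnt u hbu]; exact ht.typ_eq
  · intro i hi h0 hz
    obtain ⟨e1, e2⟩ := ht.wit i hi h0 ((hzu i hi h0).2 hz)
    exact ⟨e1, by rw [← hval i hi h0 e1, ← hovr i hi, e2]⟩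
  · intro i hi h0 hz hp
    rw [← hval i hi h0 hp, ← hovr i hi]
    exact ht.no_wit i hi h0 ((hzN i hi h0).2 hz) hp

/-- There are few breakpoints. -/
theorem exists_isBreak_bound (h : G.Ok) {f : ℕ → ℕ} (hf : G.IsHeight (fun _ => 1) f) {D : ℕ}
    (hD : f (G.N - 1) ≤ D + 1) {u : ℕ} (hu : u < G.N) :
    ∃ F : Finset ℕ, (∀ b, G.IsBreak D f u b → b ∈ F) ∧ F.card ≤ 2 ^ (D + 2) := by
  have hN := h.pos
  obtain ⟨F, hF, cF⟩ := exists_reach_bound h hf (D + 1) (G.N - 1) (by omega) hD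
  obtain ⟨F', hF', cF'⟩ : ∃ F' : Finset ℕ, (∀ b, f u ≤ D + 1 ∧ G.Reach u b → b ∈ F') ∧
      u ∈ F' ∧ F'.card + 1 ≤ 2 ^ (D + 1) := by
    by_cases hc : f u ≤ D + 1
    · obtain ⟨F', hF', cF'⟩ := exists_reach_bound h hf (D + 1) u hu hc
      exact ⟨F', fun b hb => hF' b hb.2, hF' u .refl, cF'⟩
    · exact ⟨{u}, fun b hb => absurd hb.1 hc, by simp, by
        rw [Finset.card_singleton, pow_succ]; have := Nat.one_le_two_pow (n := D); omega⟩
  classical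
  refine ⟨insert G.N (F ∪ F'), fun b hb => ?_, ?_⟩
  · simp only [Finset.mem_insert, Finset.mem_union]
    rcases hb with hb | hb | rfl | rfl
    exacts [.inr (.inl (hF b hb)), .inr (.inr (hF' b hb)), .inr (.inr cF'.1), .inl rfl]
  · have h1 := Finset.card_insert_le G.N (F ∪ F')
    have h2 := Finset.card_union_le F F'
    have := cF'.2
    rw [pow_succ 2 (D + 1)]; omega

end Net

/-! ### Boxes of unit cells as training sets -/

/-- The entry-wise order relations `lo j ≤ z j ≤ hi j` for `j < d`; a pair `(lo, hi)` stands for the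
box of the unit cells `∏ [z j, z j + 1]` with these `z`. -/
def InBox (d : ℕ) (b : (ℕ → ℕ) × (ℕ → ℕ)) (z : ℕ → ℕ) : Prop := ∀ j < d, b.1 j ≤ z j ∧ z j ≤ b.2 j

/-- The rectangle `∏ [lo j, hi j + 1]` as a sample of selectivity one or zero. The maximum makes the
rectangle nondegenerate for every pair `(lo, hi)`. -/
def boxSample (d : ℕ) (b : (ℕ → ℕ) × (ℕ → ℕ)) (t : Bool) : Sample d where
  lo j := (b.1 j : ℕ)
  hi j := (max (b.1 j) (b.2 j) + 1 : ℕ)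
  lo_lt_hi j := by
    have : b.1 j < max (b.1 j) (b.2 j) + 1 := by omega
    exact_mod_cast this
  sel := (t.toNat : ℕ)
  sel_nonneg := by positivity
  sel_le_one := by cases t <;> simp

/-- The encoding of `boxSample`. -/
def boxWord (d : ℕ) (b : (ℕ → ℕ) × (ℕ → ℕ)) (t : ℕ) : List ℕ :=
  ((List.range d).map fun j => [b.1 j, 0, 1, b.2 j + 1, 0, 1]).flatten ++ [t, 0, 1]

theorem encodeRat_natCast (n : ℕ) : encodeRat (n : ℚ) = [n, 0, 1] := by
  simp [encodeRat]

theorem encode_boxSample {d : ℕ} {b : (ℕ → ℕ) × (ℕ → ℕ)} (hb : ∀ j < d, b.1 j ≤ b.2 j) (t : Bool) :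
    (boxSample d b t).encode = boxWord d b t.toNat := by
  unfold Sample.encode boxWord boxSample
  simp only [encodeRat_natCast]
  congr 2
  rw [List.ofFn_eq_map, ← List.map_coe_finRange_eq_range, List.map_map]
  refine List.map_congr_left fun j _ => ?_
  simp [max_eq_right (hb j j.2)]

/-- The training set that asks for all points to lie in `[0, N + 1] ^ d` and outside of some
boxes. -/
def boxInstance (d N : ℕ) (Bs : List ((ℕ → ℕ) × (ℕ → ℕ))) : Fin (Bs.length + 1) → Sample d :=
  Fin.cons (boxSample d (fun _ => 0, fun _ => N) true) fun i => boxSample d Bs[i] false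

theorem encode_boxInstance {d N : ℕ} {Bs : List ((ℕ → ℕ) × (ℕ → ℕ))}
    (hB : ∀ b ∈ Bs, ∀ j < d, b.1 j ≤ b.2 j) :
    encodeInstance (boxInstance d N Bs) 1 = d :: (Bs.length + 1) :: 1 ::
      (boxWord d (fun _ => 0, fun _ => N) 1 ++ Bs.flatMap fun b => boxWord d b 0) := by
  unfold encodeInstance boxInstance
  rw [List.ofFn_succ]
  simp only [Fin.cons_zero, Fin.cons_succ, List.flatten_cons]
  rw [encode_boxSample (fun _ _ => Nat.zero_le _)]
  congr 4
  rw [List.flatMap_def]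
  congr 1
  apply List.ext_getElem
  · simp
  · intro i h1 h2
    simp only [List.getElem_ofFn, List.getElem_map, Fin.getElem_fin]
    rw [encode_boxSample (hB _ (List.getElem_mem _))]
    rfl

theorem mem_rect_boxSample {d : ℕ} {b : (ℕ → ℕ) × (ℕ → ℕ)} (hb : ∀ j < d, b.1 j ≤ b.2 j) {t : Bool}
    {x : Fin d → ℝ} :
    x ∈ (boxSample d b t).rect ↔ ∀ j : Fin d, (b.1 j : ℝ) ≤ x j ∧ x j ≤ (b.2 j : ℝ) + 1 := by
  unfold Sample.rect boxSample
  refine forall_congr' fun j => ?_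
  simp only [max_eq_right (hb j j.2)]
  push_cast
  rfl

/-! ### Exact solutions -/

theorem empErr_nonneg {d n : ℕ} (p : ENNReal) (μ : DiscreteDist d) (Z : Fin n → Sample d) :
    0 ≤ empErr p μ Z := by
  unfold empErr
  split_ifs
  · exact Real.iSup_nonneg fun _ => abs_nonneg _
  · exact mul_nonneg (by positivity) (Finset.sum_nonneg fun _ _ => by positivity)

theorem empErr_eq_zero_iff {d n : ℕ} {p : ENNReal} (hp : 1 ≤ p) (μ : DiscreteDist d)
    (Z : Fin n → Sample d) :
    empErr p μ Z = 0 ↔ ∀ i, μ.selectivity (Z i).rect = (Z i).sel := by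
  unfold empErr
  split_ifs with h
  · constructor
    · intro h0 i
      have := le_ciSup
        (Set.finite_range fun i => |μ.selectivity (Z i).rect - ((Z i).sel : ℝ)|).bddAbove i
      rw [h0] at this
      have := abs_nonpos_iff.1 this
      linarith
    · intro h0
      simp [h0]
  · have hp0 : p.toReal ≠ 0 := by
      rw [ne_eq, ENNReal.toReal_eq_zero_iff]
      rintro (h1 | h1)
      · rw [h1] at hp; simp at hp
      · exact h h1
    constructor
    · intro h0 i
      have hn : (n : ℝ) ≠ 0 := by
        have := i.pos
        positivity
      rcases mul_eq_zero.1 h0 with h1 | h1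
      · exact absurd h1 (by positivity)
      · rw [Finset.sum_eq_zero_iff_of_nonneg fun _ _ => by positivity] at h1
        have := h1 i (Finset.mem_univ i)
        rw [Real.rpow_eq_zero (abs_nonneg _) hp0, abs_eq_zero] at this
        linarith
    · intro h0
      simp [h0, Real.zero_rpow hp0]

theorem DiscreteDist.selectivity_eq_zero {d : ℕ} {μ : DiscreteDist d} {R : Set (Fin d → ℝ)} :
    μ.selectivity R = 0 ↔ ∀ x ∈ μ.supp, x ∉ R := by
  unfold DiscreteDist.selectivity
  rw [Finset.sum_eq_zero_iff_of_nonneg fun x hx =>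
    Set.indicator_apply_nonneg fun _ => (μ.weight_pos x hx).le]
  refine forall₂_congr fun x hx => ?_
  rw [Set.indicator_apply_eq_zero]
  have := (μ.weight_pos x hx).ne'
  tauto

theorem DiscreteDist.selectivity_eq_one {d : ℕ} {μ : DiscreteDist d} {R : Set (Fin d → ℝ)} :
    μ.selectivity R = 1 ↔ ∀ x ∈ μ.supp, x ∈ R := by
  have h : μ.selectivity R + μ.selectivity Rᶜ = 1 := by
    rw [← μ.sum_weight]
    unfold DiscreteDist.selectivity
    rw [← Finset.sum_add_distrib]
    refine Finset.sum_congr rfl fun x _ => ?_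
    rw [Set.indicator_self_add_compl_apply]
  have h' : μ.selectivity R = 1 ↔ μ.selectivity Rᶜ = 0 :=
    ⟨fun e => by linarith, fun e => by linarith⟩
  rw [h', DiscreteDist.selectivity_eq_zero]
  simp

/-- The distribution that is concentrated in one point. -/
def diracDist {d : ℕ} (x : Fin d → ℝ) : DiscreteDist d where
  supp := {x}
  weight := fun _ => 1
  weight_pos := by simp
  sum_weight := by simp

/-- If some unit cell of `[0, N + 1] ^ d` lies in none of the boxes, then the least error is zero,
already for size one; so every approximate solution is exact, and all of its points lie outside of
all boxes. -/
theorem mem_supp_of_empErr_le {d N n : ℕ} {p : ENNReal} (hp : 1 ≤ p)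
    {Bs : List ((ℕ → ℕ) × (ℕ → ℕ))} (hB : ∀ b ∈ Bs, ∀ j < d, b.1 j ≤ b.2 j)
    (hz : ∃ z : ℕ → ℕ, (∀ j < d, z j ≤ N) ∧ ∀ b ∈ Bs, ¬ InBox d b z) {μ : DiscreteDist d}
    (hμ : empErr p μ (boxInstance d N Bs) ≤ (n : ℝ) * optErr p 1 (boxInstance d N Bs)) :
    ∀ x ∈ μ.supp, (∀ j, 0 ≤ x j ∧ x j ≤ N + 1) ∧
      ∀ b ∈ Bs, ¬ ∀ j : Fin d, (b.1 j : ℝ) ≤ x j ∧ x j ≤ (b.2 j : ℝ) + 1 := by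
  -- exact distributions
  have key : ∀ ν : DiscreteDist d, empErr p ν (boxInstance d N Bs) = 0 ↔
      ∀ x ∈ ν.supp, (∀ j, 0 ≤ x j ∧ x j ≤ N + 1) ∧
        ∀ b ∈ Bs, ¬ ∀ j : Fin d, (b.1 j : ℝ) ≤ x j ∧ x j ≤ (b.2 j : ℝ) + 1 := by
    intro ν
    have e1 : ν.selectivity (boxInstance d N Bs 0).rect = (boxInstance d N Bs 0).sel ↔
        ∀ x ∈ ν.supp, ∀ j, 0 ≤ x j ∧ x j ≤ N + 1 := by
      have : (boxInstance d N Bs 0).sel = 1 := rfl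
      rw [this, Rat.cast_one, DiscreteDist.selectivity_eq_one]
      refine forall₂_congr fun x _ => ?_
      simp only [boxInstance, Fin.cons_zero]
      rw [mem_rect_boxSample fun _ _ => Nat.zero_le _]
      simp
    have e2 : ∀ i : Fin Bs.length, ν.selectivity (boxInstance d N Bs i.succ).rect =
        (boxInstance d N Bs i.succ).sel ↔
        ∀ x ∈ ν.supp, ¬ ∀ j : Fin d, (Bs[i].1 j : ℝ) ≤ x j ∧ x j ≤ (Bs[i].2 j : ℝ) + 1 := by
      intro i
      have : (boxInstance d N Bs i.succ).sel = 0 := rfl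
      rw [this, Rat.cast_zero, DiscreteDist.selectivity_eq_zero]
      refine forall₂_congr fun x _ => ?_
      simp only [boxInstance, Fin.cons_succ]
      exact not_congr (mem_rect_boxSample (hB _ (List.getElem_mem _)))
    rw [empErr_eq_zero_iff hp, Fin.forall_fin_succ, e1]
    simp only [e2]
    constructor
    · rintro ⟨h1, h2⟩ x hx
      refine ⟨h1 x hx, fun b hb => ?_⟩
      obtain ⟨i, hi, rfl⟩ := List.getElem_of_mem hb
      exact h2 ⟨i, hi⟩ x hx
    · exact fun h => ⟨fun x hx => (h x hx).1, fun i x hx => (h x hx).2 _ (List.getElem_mem _)⟩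
  rw [← key]
  obtain ⟨z, hz1, hz2⟩ := hz
  have h0 : empErr p (diracDist fun j : Fin d => (z j : ℝ) + 1 / 2) (boxInstance d N Bs) = 0 := by
    rw [key]
    intro x hx
    obtain rfl : x = _ := Finset.mem_singleton.1 hx
    refine ⟨fun j => ⟨by positivity, ?_⟩, fun b hb hc => hz2 b hb fun j hj => ?_⟩
    · have : (z j : ℝ) ≤ N := by exact_mod_cast hz1 j j.2
      dsimp only; linarith
    · obtain ⟨c1, c2⟩ := hc ⟨j, hj⟩
      dsimp only at c1 c2
      constructor
      · have : b.1 j < z j + 1 := by exact_mod_cast (by linarith : (b.1 j : ℝ) < z j + 1)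
        omega
      · have : z j < b.2 j + 1 := by exact_mod_cast (by linarith : (z j : ℝ) < b.2 j + 1)
        omega
  have h1 : optErr p 1 (boxInstance d N Bs) ≤ 0 := by
    refine csInf_le ⟨0, ?_⟩ ⟨_, ?_, h0.symm⟩
    · rintro e ⟨ν, -, rfl⟩
      exact empErr_nonneg _ _ _
    · simp [DiscreteDist.size, diracDist]
  have h2 : (n : ℝ) * optErr p 1 (boxInstance d N Bs) ≤ 0 :=
    mul_nonpos_of_nonneg_of_nonpos (by positivity) h1
  exact le_antisymm (hμ.trans h2) (empErr_nonneg _ _ _)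

theorem DiscreteDist.supp_nonempty {d : ℕ} (μ : DiscreteDist d) : μ.supp.Nonempty := by
  rw [Finset.nonempty_iff_ne_empty]
  intro h
  have := μ.sum_weight
  rw [h] at this
  simp at this

/-- A described distribution has a first point, whose coordinates are found behind the number of the
points. -/
theorem Describes.exists_point {d : ℕ} {y : List ℕ} {μ : DiscreteDist d} (h : Describes y μ) :
    ∃ x ∈ μ.supp, ∀ j : Fin d, y.getD (3 * j + 3) 0 ≠ 0 ∧
      x j = ((y.getD (3 * j + 1) 0 : ℝ) - (y.getD (3 * j + 2) 0 : ℝ)) / (y.getD (3 * j + 3) 0 : ℝ) := by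
  obtain ⟨m, pt, wt, rfl, -, hs, -⟩ := h
  obtain ⟨x₀, hx₀⟩ := μ.supp_nonempty
  have : x₀ ∈ Set.range fun i j => (pt i j).val := by rw [← hs]; exact hx₀
  obtain ⟨i₀, -⟩ := this
  obtain ⟨m, rfl⟩ : ∃ m', m = m' + 1 := ⟨m - 1, by have := i₀.pos; omega⟩
  refine ⟨fun j => (pt 0 j).val, ?_, fun j => ?_⟩
  · rw [← Finset.mem_coe, hs]; exact ⟨0, rfl⟩
  · -- the code of coordinate `j` is found by skipping `j` codes of length three
    have key : ∀ (d : ℕ) (c : Fin d → RatCode) (l : List ℕ) (j : Fin d),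
        ((List.ofFn fun j => (c j).word).flatten ++ l).drop (3 * j) =
          (c j).word ++ ((List.ofFn fun j => (c j).word).flatten ++ l).drop (3 * j + 3) := by
      intro d
      induction d with
      | zero => exact fun _ _ j => j.elim0
      | succ d ih =>
        intro c l j
        rw [List.ofFn_succ]
        refine Fin.cases ?_ (fun j => ?_) j
        · simp [RatCode.word]
        · have := ih (fun j => c j.succ) l j
          simp only [List.flatten_cons, List.append_assoc, Fin.val_succ]
          have e1 : 3 * (j.1 + 1) = (c 0).word.length + 3 * j := by simp [RatCode.word]; ring
          rw [e1, List.drop_length_add_append, this, add_assoc, List.drop_length_add_append]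
    set L : List ℕ := (List.ofFn fun i : Fin (m + 1) =>
      (List.ofFn fun j => (pt i j).word).flatten ++ (wt i).word).flatten with hL
    obtain ⟨l, hl⟩ : ∃ l, L = (List.ofFn fun j => (pt 0 j).word).flatten ++ l := by
      rw [hL, List.ofFn_succ]
      simp only [List.flatten_cons, List.append_assoc]
      exact ⟨_, rfl⟩
    have hk := key d (pt 0) l j
    rw [← hl] at hk
    have get : ∀ i, L.getD (3 * j + i) 0 = (L.drop (3 * j)).getD i 0 := fun i => by
      simp [List.getD_eq_getElem?_getD, List.getElem?_drop]
    have g0 : ((m + 1) :: L).getD (3 * j + 1) 0 = (pt 0 j).a := by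
      rw [List.getD_cons_succ, ← add_zero (3 * j.1), get, hk]; rfl
    have g1 : ((m + 1) :: L).getD (3 * j + 2) 0 = (pt 0 j).b := by
      rw [List.getD_cons_succ, get, hk]; rfl
    have g2 : ((m + 1) :: L).getD (3 * j + 3) 0 = (pt 0 j).c := by
      rw [List.getD_cons_succ, get, hk]; rfl
    rw [g0, g1, g2]
    exact ⟨(pt 0 j).c_ne_zero, rfl⟩

/-! ### The memory layout of the decision procedure -/

namespace Ram

-- Register and array numbers `3 r` are left to the reduction from the given problem, the numbers
-- `3 r + 1` to the program for Selectivity+.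

/-- the length of the input, and in the end that of the answer -/
local notation "rLen" => (0 : ℕ)
/-- the length of the instance that is passed to the program for Selectivity+ -/
local notation "rOut" => (1 : ℕ)
/-- the number of gates -/
local notation "rN" => (2 : ℕ)
/-- the position of the reader -/
local notation "rP" => (5 : ℕ)
/-- whether the input has been found correct so far -/
local notation "rOk" => (8 : ℕ)
local notation "rI" => (11 : ℕ)
local notation "rJ" => (14 : ℕ)
local notation "rA" => (17 : ℕ)
local notation "rB" => (20 : ℕ)
/-- the gate whose test is considered -/
local notation "rU" => (23 : ℕ)
/-- the number of the vector that is tested -/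
local notation "rE" => (26 : ℕ)
/-- the bound for the depth -/
local notation "rD" => (29 : ℕ)
/-- the weight -/
local notation "rK" => (32 : ℕ)
/-- the dimension -/
local notation "rDim" => (35 : ℕ)
/-- the binary logarithm of the number of cells per coordinate -/
local notation "rBeta" => (38 : ℕ)
/-- the number of vectors that are tested for each gate -/
local notation "rTot" => (41 : ℕ)
/-- the result of a test -/
local notation "rR" => (44 : ℕ)
/-- the number of cells -/
local notation "rCnt" => (47 : ℕ)
/-- the number of boxes -/
local notation "rNum" => (50 : ℕ)

local notation "rT" => (53 : ℕ)
/-- the number of cells that are reserved for each coordinate -/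
local notation "rPow" => (56 : ℕ)
/-- the position of the writer -/
local notation "rW" => (59 : ℕ)

/-- the input, and in the end the answer -/
local notation "aIn" => (0 : ℕ)
/-- the instance that is passed to the program for Selectivity+, and then its output -/
local notation "aOut" => (1 : ℕ)
local notation "aTyp" => (2 : ℕ)
local notation "aDeg" => (5 : ℕ)
/-- the position in the input of the first in-neighbour of a gate -/
local notation "aOff" => (8 : ℕ)
/-- the largest number of gates on a path -/
local notation "aHt" => (11 : ℕ)
/-- the largest number of large gates on a path -/
local notation "aWt" => (14 : ℕ)
/-- the number of times a gate is chosen as a true input -/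
local notation "aAs" => (17 : ℕ)
/-- the overriding values -/
local notation "aOv" => (20 : ℕ)
local notation "aVal" => (23 : ℕ)
/-- marks of breakpoints -/
local notation "aMk" => (26 : ℕ)
/-- the numbering of the frontier gates -/
local notation "aFr" => (29 : ℕ)
/-- the least elements of the cells -/
local notation "aRep" => (32 : ℕ)
/-- the greatest elements of the cells -/
local notation "aHi" => (35 : ℕ)
/-- the vector that is tested -/
local notation "aZ" => (38 : ℕ)
/-- the upper corner of the cell of the vector that is tested -/
local notation "aW" => (41 : ℕ)

/-- The circuit that is stored in the memory. -/
def netOf (s : State) : Net where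
  N := s.reg rN
  typ := s.arr aTyp
  deg := s.arr aDeg
  prd i j := s.arr aIn (s.arr aOff i + j)

theorem netOf_congr {s s' : State} (hN : s'.reg rN = s.reg rN) (h0 : s'.arr aIn = s.arr aIn)
    (h1 : s'.arr aTyp = s.arr aTyp) (h2 : s'.arr aDeg = s.arr aDeg)
    (h3 : s'.arr aOff = s.arr aOff) : netOf s' = netOf s := by
  simp [netOf, hN, h0, h1, h2, h3]

/-- A statement that does not write the registers and arrays of the circuit. -/
def St.KeepsNet (p : St) : Prop :=
  rN ∉ p.wReg ∧ aIn ∉ p.wArr ∧ aTyp ∉ p.wArr ∧ aDeg ∉ p.wArr ∧ aOff ∉ p.wArr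

instance (p : St) : Decidable p.KeepsNet := by unfold St.KeepsNet; infer_instance

theorem netOf_den {p : St} (h : p.KeepsNet) (M : ℕ) (s : State) :
    netOf (den M p s) = netOf s :=
  netOf_congr (den_reg h.1 s) (den_arr h.2.1 s) (den_arr h.2.2.1 s) (den_arr h.2.2.2.1 s)
    (den_arr h.2.2.2.2 s)

/-- The cap exceeds the number of gates and all indegrees. -/
def Fits (M : ℕ) (G : Net) : Prop := G.N + 1 ≤ M ∧ ∀ i < G.N, G.deg i ≤ M

/-! ### Evaluation of the circuit -/

/-- Evaluate the conjunction or disjunction `rI`. -/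
def junctionP : St :=
  .set rA (3 - .arr aTyp (.var rI)) ;;
  .rep rJ (.arr aDeg (.var rI))
    (.ite (.arr aVal (.arr aIn (.arr aOff (.var rI) + .var rJ)))
      (.ite (.arr aTyp (.var rI) - 2) (.set rA 1) .skip)
      (.ite (.arr aTyp (.var rI) - 2) .skip (.set rA 0))) ;;
  .put aVal (.var rI) (.var rA)

/-- Evaluate gate `rI`. -/
def gateP : St :=
  .ite (.arr aOv (.var rI)) (.put aVal (.var rI) (.arr aOv (.var rI) - 1))
    (.ite (.arr aTyp (.var rI))
      (.ite (.arr aTyp (.var rI) - 1) junctionP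
        (.put aVal (.var rI) (1 - .arr aVal (.arr aIn (.arr aOff (.var rI))))))
      (.ite (.arr aAs (.var rI)) (.put aVal (.var rI) 1) (.put aVal (.var rI) 0)))

/-- Evaluate all gates. -/
def evalP : St := .rep rI (.var rN) gateP

open scoped Classical in
theorem den_junctionP {M i : ℕ} {s : State} (hi : s.reg rI = i) (hM : (netOf s).deg i ≤ M)
    (ht : (netOf s).typ i = 2 ∨ (netOf s).typ i = 3) :
    (den M junctionP s).arr aVal = Function.update (s.arr aVal) i
      (if (netOf s).typ i = 2 then
        (if ∀ j < (netOf s).deg i, s.arr aVal ((netOf s).prd i j) ≠ 0 then 1 else 0)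
      else (if ∃ j < (netOf s).deg i, s.arr aVal ((netOf s).prd i j) ≠ 0 then 1 else 0)) := by
  unfold junctionP
  rw [den_seq, den_seq, den_put]
  have key := den_rep (M := M) (x := rJ) (e := .arr aDeg (.var rI))
    (p := (.ite (.arr aVal (.arr aIn (.arr aOff (.var rI) + .var rJ)))
      (.ite (.arr aTyp (.var rI) - 2) (.set rA 1) .skip)
      (.ite (.arr aTyp (.var rI) - 2) .skip (.set rA 0))))
    (s := den M (.set rA (3 - .arr aTyp (.var rI))) s)
    (fun n s' => s'.reg rA = if (netOf s).typ i = 2 then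
        (if ∀ j < n, s.arr aVal ((netOf s).prd i j) ≠ 0 then 1 else 0)
      else (if ∃ j < n, s.arr aVal ((netOf s).prd i j) ≠ 0 then 1 else 0))
    ((netOf s).deg i) (by simp [netOf, hi]) hM
    (by
      simp only [netOf] at ht ⊢
      rcases ht with h | h <;> simp [hi, h])
    (by
      intro n s' hn hr ha ih
      have e1 := hr rI (by decide)
      have e2 := ha aVal (by decide)
      have e3 := ha aTyp (by decide)
      have e4 := ha aIn (by decide)
      have e5 := ha aOff (by decide)
      simp only [den_set, State.setReg_reg, State.setReg_arr] at e1 e2 e3 e4 e5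
      simp [hi] at e1
      simp only [netOf] at ht ih ⊢
      simp only [Nat.lt_succ_iff_lt_or_eq, or_imp, forall_and, forall_eq, or_and_right, exists_or,
        exists_eq_left]
      rcases ht with h | h
      · by_cases hv : s.arr aVal (s.arr aIn (s.arr aOff i + n)) = 0
        · simp [e1, e2, e3, e4, e5, h, hv]
        · simp [e1, e2, e3, e4, e5, h, hv] at ih ⊢; exact ih
      · by_cases hv : s.arr aVal (s.arr aIn (s.arr aOff i + n)) = 0
        · simp [e1, e2, e3, e4, e5, h, hv] at ih ⊢; exact ih
        · simp [e1, e2, e3, e4, e5, h, hv])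
  rw [State.setArr_arr, if_pos rfl, Ex.ev_var, Ex.ev_var, key, den_reg (by decide),
    den_arr (by decide), den_reg (by decide), den_arr (by decide), hi]

theorem den_gateP {M i : ℕ} {s : State} (hi : s.reg rI = i) (hM : (netOf s).deg i ≤ M)
    (ht : (netOf s).typ i ≤ 3) :
    (den M gateP s).arr aVal = Function.update (s.arr aVal) i
      ((netOf s).rule (s.arr aAs) (s.arr aOv) (s.arr aVal) i) := by
  unfold gateP
  have hj := den_junctionP (M := M) hi hM
  rw [Net.rule]
  have htyp : (netOf s).typ = s.arr aTyp := rfl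
  simp only [den_ite, den_put, Ex.ev_arr, Ex.ev_var, Ex.ev_sub, Ex.ev_one, Ex.ev_zero, hi]
  rw [htyp] at hj ht ⊢
  by_cases h0 : s.arr aOv i = 0
  · rw [if_pos h0, if_neg (not_not.2 h0)]
    by_cases h1 : s.arr aTyp i = 0
    · rw [if_pos h1, if_pos h1]
      split_ifs <;> simp
    · rw [if_neg h1, if_neg h1]
      by_cases h2 : s.arr aTyp i = 1
      · rw [if_pos h2, if_pos (by omega)]
        simp [netOf]
      · rw [if_neg h2, if_neg (by omega)]
        exact hj (by omega)
  · rw [if_neg h0, if_pos h0]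
    simp

theorem den_evalP {M : ℕ} {s : State} {G : Net} (hG : netOf s = G) (h : G.Ok) (hM : Fits M G) :
    ∀ i < G.N, (den M evalP s).arr aVal i = G.val (s.arr aAs) (s.arr aOv) i := by
  unfold evalP
  refine den_rep (fun n s' => ∀ i < n, s'.arr aVal i = G.val (s.arr aAs) (s.arr aOv) i) G.N
    (by rw [← hG]; rfl) (by have := hM.1; omega) (by simp) ?_
  intro n s' hn hr ha ih
  have hnet : netOf (s'.setReg rI n) = G := by
    rw [← hG]
    exact netOf_congr (hr _ (by decide)) (ha _ (by decide)) (ha _ (by decide)) (ha _ (by decide))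
      (ha _ (by decide))
  rw [den_gateP (i := n) (by simp) (by rw [hnet]; exact hM.2 n hn)
    (by rw [hnet]; exact h.typ_le n hn), hnet]
  have e1 := ha aAs (by decide)
  have e2 := ha aOv (by decide)
  simp only [State.setReg_arr, e1, e2]
  intro i hi
  by_cases hin : i = n
  · subst hin
    rw [Function.update_self, h.val_eq _ _ i hn]
    exact h.rule_congr hn rfl Iff.rfl fun _ j hj => ih _ (h.prd_lt i hn j hj)
  · rw [Function.update_of_ne hin]
    exact ih i (by omega)

/-! ### Marking breakpoints, numbering the frontier gates -/

/-- Mark the in-neighbours of gate `rI`. -/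
def markPredsP : St :=
  .rep rJ (.arr aDeg (.var rI)) (.put aMk (.arr aIn (.arr aOff (.var rI) + .var rJ)) 1)

/-- Mark everything that is reached from marked gates. -/
def markP : St :=
  .rep rB (.var rN)
    (.set rI (.var rN - 1 - .var rB) ;;
    .ite (.arr aMk (.var rI)) (.ite (.arr aDeg (.var rI) - 2) .skip markPredsP) .skip)

/-- Set the entries `0, …, N` of the array `a` to `0`. -/
def clearP (a : ℕ) : St := .rep rI (.var rN + 1) (.put a (.var rI) 0)

/-- Number the frontier gates. -/
def frontP : St :=
  clearP aMk ;; .put aMk (.var rN - 1) 1 ;; markP ;; .set rA 0 ;;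
  .rep rI (.var rN) (.ite (.arr aMk (.var rI))
    (.ite (.arr aDeg (.var rI) - 2)
      (.set rA (.var rA + 1) ;; .put aFr (.var rI) (.var rA)) (.put aFr (.var rI) 0))
    (.put aFr (.var rI) 0))

theorem den_clearP {M a : ℕ} {s : State} (hM : s.reg rN + 1 ≤ M) :
    ∀ i ≤ s.reg rN, (den M (clearP a) s).arr a i = 0 := by
  have := den_rep (M := M) (x := rI) (e := .var rN + 1) (p := .put a (.var rI) 0) (s := s)
    (fun n s' => ∀ i < n, s'.arr a i = 0) (s.reg rN + 1) (by simp) hM (by simp)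
    (by
      intro n s' hn hr ha ih i hi
      simp [Function.update_apply]
      intro hin
      exact ih i (by omega))
  exact fun i hi => this i (by omega)

theorem den_markPredsP {M i : ℕ} {s : State} (hi : s.reg rI = i) (hM : (netOf s).deg i ≤ M)
    (b : ℕ) : (den M markPredsP s).arr aMk b ≠ 0 ↔
      s.arr aMk b ≠ 0 ∨ ∃ j < (netOf s).deg i, (netOf s).prd i j = b := by
  unfold markPredsP
  refine den_rep (fun n s' => s'.arr aMk b ≠ 0 ↔
    s.arr aMk b ≠ 0 ∨ ∃ j < n, (netOf s).prd i j = b) ((netOf s).deg i) (by simp [netOf, hi]) hM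
    (by simp) ?_
  intro n s' hn hr ha ih
  have e1 := hr rI (by decide)
  have e2 := ha aIn (by decide)
  have e3 := ha aOff (by decide)
  rw [hi] at e1
  simp only [Nat.lt_succ_iff_lt_or_eq, or_and_right, exists_or, exists_eq_left]
  rw [← or_assoc, ← ih]
  simp only [den_put, Ex.ev_arr, Ex.ev_add, Ex.ev_var, Ex.ev_one, State.setReg_arr,
    State.setReg_reg, State.setArr_arr, if_true, e2, e3, Function.update_apply, netOf]
  simp only [e1]
  simp only [Nat.reduceEqDiff, if_false]
  by_cases hb : b = s.arr aIn (s.arr aOff i + n)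
  · simp [hb]
  · simp [hb, Ne.symm hb]

theorem den_markP {M : ℕ} {s : State} {G : Net} (hG : netOf s = G) (h : G.Ok) (hM : Fits M G) :
    ∀ b < G.N, (den M markP s).arr aMk b ≠ 0 ↔
      ∃ r < G.N, s.arr aMk r ≠ 0 ∧ G.Reach r b := by
  have key : (∀ b, s.arr aMk b ≠ 0 → (den M markP s).arr aMk b ≠ 0) ∧
      (∀ w < G.N, G.N - G.N ≤ w → (den M markP s).arr aMk w ≠ 0 → G.deg w ≤ 2 →
        ∀ j < G.deg w, (den M markP s).arr aMk (G.prd w j) ≠ 0) ∧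
      ∀ b < G.N, (den M markP s).arr aMk b ≠ 0 → ∃ r < G.N, s.arr aMk r ≠ 0 ∧ G.Reach r b := by
    unfold markP
    refine den_rep (fun n s' => (∀ b, s.arr aMk b ≠ 0 → s'.arr aMk b ≠ 0) ∧
      (∀ w < G.N, G.N - n ≤ w → s'.arr aMk w ≠ 0 → G.deg w ≤ 2 →
        ∀ j < G.deg w, s'.arr aMk (G.prd w j) ≠ 0) ∧
      ∀ b < G.N, s'.arr aMk b ≠ 0 → ∃ r < G.N, s.arr aMk r ≠ 0 ∧ G.Reach r b) G.N
      (by rw [← hG]; rfl) (by have := hM.1; omega) ?_ ?_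
    · exact ⟨fun _ => id, fun w hw hw' => by omega, fun b hb hmk => ⟨b, hb, hmk, .refl⟩⟩
    · rintro n s' hn hr ha ⟨ih1, ih2, ih3⟩
      have hN : s'.reg rN = G.N := by rw [hr _ (by decide), ← hG]; rfl
      set s₁ := den M (.set rI (.var rN - 1 - .var rB)) (s'.setReg rB n) with hs₁
      have hnet : netOf s₁ = G := by
        rw [← hG]
        exact netOf_congr (hr _ (by decide)) (ha _ (by decide)) (ha _ (by decide))
          (ha _ (by decide)) (ha _ (by decide))
      have hI : s₁.reg rI = G.N - 1 - n := by simp [hs₁, hN]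
      have hmk : s₁.arr aMk = s'.arr aMk := rfl
      have hdeg : s₁.arr aDeg = G.deg := by rw [← hnet]; rfl
      rw [den_seq, ← hs₁, den_ite, den_ite]
      simp only [Ex.ev_arr, Ex.ev_var, Ex.ev_sub, hI, hdeg, hmk, Ex.ev_ofNat, den_skip]
      set i := G.N - 1 - n with hi
      have hiN : i < G.N := by omega
      by_cases h0 : s'.arr aMk i = 0
      · rw [if_pos h0, hmk]
        refine ⟨ih1, fun w hw hw' hmw => ih2 w hw ?_ hmw, ih3⟩
        have : w ≠ i := fun e => hmw (e ▸ h0)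
        omega
      · rw [if_neg h0]
        by_cases hd : G.deg i ≤ 2
        · rw [if_pos (by omega)]
          have hm := den_markPredsP (M := M) hI (by rw [hnet]; exact hM.2 i hiN)
          simp only [hnet, hmk] at hm
          refine ⟨fun b hb => (hm b).2 (.inl (ih1 b hb)), fun w hw hw' hmw hdw j hj => ?_,
            fun b hb hmb => ?_⟩
          · by_cases hwi : w = i
            · subst hwi
              exact (hm _).2 (.inr ⟨j, hj, rfl⟩)
            · have hwi' : s'.arr aMk w ≠ 0 := by
                rcases (hm w).1 hmw with h1 | ⟨l, hl, e⟩
                · exact h1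
                · have := h.prd_lt i hiN l hl; omega
              exact (hm _).2 (.inl (ih2 w hw (by omega) hwi' hdw j hj))
          · rcases (hm b).1 hmb with h1 | ⟨l, hl, rfl⟩
            · exact ih3 b hb h1
            · obtain ⟨r, hr1, hr2, hr3⟩ := ih3 i hiN h0
              exact ⟨r, hr1, hr2, hr3.step hd hl⟩
        · rw [if_neg (by omega), hmk]
          refine ⟨ih1, fun w hw hw' hmw hdw => ih2 w hw ?_ hmw hdw, ih3⟩
          have : w ≠ i := fun e => hd (e ▸ hdw)
          omega
  obtain ⟨k1, k2, k3⟩ := key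
  refine fun b hb => ⟨k3 b hb, ?_⟩
  rintro ⟨r, hr, hmr, hreach⟩
  induction hreach with
  | refl => exact k1 r hmr
  | step hw hd hj ih => exact k2 _ (hw.lt h hr) (by omega) (ih (hw.lt h hr)) hd _ hj

theorem den_frontP {M : ℕ} {s : State} {G : Net} (hG : netOf s = G) (h : G.Ok) (hM : Fits M G)
    {f : ℕ → ℕ} (hf : G.IsHeight (fun _ => 1) f) {D : ℕ} (hD : f (G.N - 1) ≤ D + 1) :
    G.IsFrontier (2 ^ (D + 1)) ((den M frontP s).arr aFr) := by
  classical
  have hN0 := h.pos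
  have hN : s.reg rN = G.N := by rw [← hG]; rfl
  unfold frontP
  simp only [den_seq]
  set s₁ := den M (.put aMk (.var rN - 1) 1) (den M (clearP aMk) s) with hs₁
  have hmk₁ : ∀ b < G.N, s₁.arr aMk b ≠ 0 ↔ b = G.N - 1 := fun b hb => by
    have h1 := den_clearP (M := M) (a := aMk) (s := s) (by rw [hN]; exact hM.1) b (by omega)
    have h2 : (den M (clearP aMk) s).reg rN = G.N := by rw [den_reg (by decide), hN]
    rw [hs₁]
    simp [Function.update_apply, h1, h2]
  have hG₁ : netOf s₁ = G := by rw [hs₁, netOf_den (by decide), netOf_den (by decide), hG]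
  have hm := den_markP hG₁ h hM
  set s₂ := den M (.set rA 0) (den M markP s₁) with hs₂
  have hG₂ : netOf s₂ = G := by rw [hs₂, netOf_den (by decide), netOf_den (by decide), hG₁]
  have hmk₂ : ∀ b < G.N, s₂.arr aMk b ≠ 0 ↔ G.Reach (G.N - 1) b := fun b hb => by
    have : s₂.arr aMk = (den M markP s₁).arr aMk := rfl
    rw [this, hm b hb]
    constructor
    · rintro ⟨r, hr, h1, h2⟩
      rw [hmk₁ r hr] at h1
      exact h1 ▸ h2
    · exact fun h1 => ⟨G.N - 1, by omega, (hmk₁ _ (by omega)).2 rfl, h1⟩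
  have hA₂ : s₂.reg rA = 0 := by simp [hs₂]
  -- the number of frontier gates below `n`
  set c : ℕ → ℕ := fun n => ((Finset.range n).filter
    fun i => G.Reach (G.N - 1) i ∧ 2 < G.deg i).card with hc
  have hcs : ∀ n, c (n + 1) = c n + if G.Reach (G.N - 1) n ∧ 2 < G.deg n then 1 else 0 :=
    fun n => by
      simp only [hc, Finset.range_add_one, Finset.filter_insert]
      split_ifs
      · rw [Finset.card_insert_of_notMem (by simp)]
      · rfl
  have hmono : Monotone c := monotone_nat_of_le_succ fun n => by rw [hcs]; omega
  obtain ⟨F, hF, cF⟩ := Net.exists_reach_bound h hf (D + 1) (G.N - 1) (by omega) hD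
  have hcle : c G.N ≤ 2 ^ (D + 1) := by
    have : c G.N ≤ F.card := Finset.card_le_card fun i hi => hF i (Finset.mem_filter.1 hi).2.1
    omega
  obtain ⟨-, key⟩ := den_rep (M := M) (x := rI) (e := .var rN)
    (p := .ite (.arr aMk (.var rI)) (.ite (.arr aDeg (.var rI) - 2)
      (.set rA (.var rA + 1) ;; .put aFr (.var rI) (.var rA)) (.put aFr (.var rI) 0))
      (.put aFr (.var rI) 0)) (s := s₂)
    (fun n s' => s'.reg rA = c n ∧ ∀ i < n, s'.arr aFr i =
      if G.Reach (G.N - 1) i ∧ 2 < G.deg i then c i + 1 else 0) G.N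
    (by rw [← hG₂]; rfl) (by have := hM.1; omega) ⟨by simp [hA₂, hc], by simp⟩ (by
      rintro n s' hn hr ha ⟨ih1, ih2⟩
      have e1 : s'.arr aMk = s₂.arr aMk := ha _ (by decide)
      have e2 : s'.arr aDeg = G.deg := by rw [ha _ (by decide), ← hG₂]; rfl
      have e3 := hmk₂ n hn
      have last : ∀ (a : ℕ → ℕ) v, (∀ i < n, a i =
          if G.Reach (G.N - 1) i ∧ 2 < G.deg i then c i + 1 else 0) →
          v = (if G.Reach (G.N - 1) n ∧ 2 < G.deg n then c n + 1 else 0) → ∀ i < n + 1,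
          Function.update a n v i =
            if G.Reach (G.N - 1) i ∧ 2 < G.deg i then c i + 1 else 0 := by
        intro a v h1 h2 i hi
        by_cases hin : i = n
        · subst hin; rw [Function.update_self, h2]
        · rw [Function.update_of_ne hin]; exact h1 i (by omega)
      rw [hcs]
      simp only [den_ite, den_seq, den_set, den_put, Ex.ev_arr, Ex.ev_var, Ex.ev_sub, Ex.ev_add,
        Ex.ev_ofNat, State.setReg_arr, State.setReg_reg, if_true, e1, e2,
        Nat.reduceEqDiff, if_false]
      by_cases h0 : G.Reach (G.N - 1) n
      · rw [if_neg (e3.2 h0)]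
        by_cases h2 : 2 < G.deg n
        · rw [if_neg (by omega), if_pos ⟨h0, h2⟩]
          refine ⟨by simp [ih1], ?_⟩
          simp only [State.setArr_arr, if_true, State.setReg_arr]
          exact last _ _ ih2 (by simp [h0, h2, ih1])
        · rw [if_pos (by omega), if_neg (by tauto)]
          refine ⟨by simp [ih1], ?_⟩
          simp only [State.setArr_arr, if_true, State.setReg_arr]
          exact last _ _ ih2 (by simp [h2])
      · rw [if_pos (by by_contra h1; exact h0 (e3.1 h1)), if_neg (by tauto)]
        refine ⟨by simp [ih1], ?_⟩
        simp only [State.setArr_arr, if_true, State.setReg_arr]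
        exact last _ _ ih2 (by simp [h0]))
  refine ⟨fun i hi => ?_, fun i hi i' hi' h0 hii => ?_, fun i hi => ?_⟩
  · rw [key i hi]; split_ifs with h1 <;> simp [h1]
  · rw [key i hi] at h0 hii
    rw [key i' hi'] at hii
    have lt : ∀ a b, G.Reach (G.N - 1) a ∧ 2 < G.deg a → a < b → c a + 1 ≤ c b :=
      fun a b ha hab => by
        have := hcs a
        rw [if_pos ha] at this
        have := hmono (show a + 1 ≤ b by omega)
        omega
    split_ifs at h0 hii with h1 h2
    · rcases lt_trichotomy i i' with h3 | h3 | h3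
      · have := lt _ _ h1 h3; omega
      · exact h3
      · have := lt _ _ h2 h3; omega
    all_goals omega
  · rw [key i hi]
    split_ifs with h1
    · have := hcs i
      rw [if_pos h1] at this
      have := hmono (show i + 1 ≤ G.N by omega)
      omega
    · omega

/-! ### Cells and vectors of cells -/

/-- Mark the breakpoints for the test at gate `rU`. -/
def breaksP : St :=
  clearP aMk ;; .put aMk (.var rN - 1) 1 ;;
  .ite (.var rD + 2 - .arr aHt (.var rU)) (.put aMk (.var rU) 1) .skip ;;
  markP ;; .put aMk (.var rU) 1 ;; .put aMk (.var rN) 1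

theorem den_breaksP {M : ℕ} {s : State} {G : Net} (hG : netOf s = G) (h : G.Ok) (hM : Fits M G)
    (hu : s.reg rU < G.N) : ∀ b ≤ G.N, (den M breaksP s).arr aMk b ≠ 0 ↔
      G.IsBreak (s.reg rD) (s.arr aHt) (s.reg rU) b := by
  have hN0 := h.pos
  have hN : s.reg rN = G.N := by rw [← hG]; rfl
  unfold breaksP
  simp only [den_seq]
  set s₁ := den M (.ite (.var rD + 2 - .arr aHt (.var rU)) (.put aMk (.var rU) 1) .skip)
    (den M (.put aMk (.var rN - 1) 1) (den M (clearP aMk) s)) with hs₁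
  have hmk₁ : ∀ b < G.N, s₁.arr aMk b ≠ 0 ↔
      b = G.N - 1 ∨ (s.arr aHt (s.reg rU) ≤ s.reg rD + 1 ∧ b = s.reg rU) := fun b hb => by
    have h1 := den_clearP (M := M) (a := aMk) (s := s) (by rw [hN]; exact hM.1) b (by omega)
    have h2 : (den M (clearP aMk) s).reg rN = G.N := by rw [den_reg (by decide), hN]
    have h3 : (den M (clearP aMk) s).reg rD = s.reg rD := den_reg (by decide) s
    have h4 : (den M (clearP aMk) s).reg rU = s.reg rU := den_reg (by decide) s
    have h5 : (den M (clearP aMk) s).arr aHt = s.arr aHt := den_arr (by decide) s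
    rw [hs₁]
    by_cases hc : s.arr aHt (s.reg rU) ≤ s.reg rD + 1
    · have hc' : s.reg rD + 2 - s.arr aHt (s.reg rU) ≠ 0 := by omega
      simp [Function.update_apply, h1, h2, h3, h4, h5, hc, hc']
      split_ifs <;> simp [*]
    · have hc' : s.reg rD + 2 - s.arr aHt (s.reg rU) = 0 := by omega
      simp [Function.update_apply, h1, h2, h3, h4, h5, hc, hc']
  have hG₁ : netOf s₁ = G := by
    rw [hs₁, netOf_den (by decide), netOf_den (by decide), netOf_den (by decide), hG]
  have hm := den_markP hG₁ h hM
  have hU : (den M markP s₁).reg rU = s.reg rU := by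
    rw [den_reg (by decide), hs₁, den_reg (by decide), den_reg (by decide), den_reg (by decide)]
  have hN' : (den M markP s₁).reg rN = G.N := by
    rw [den_reg (by decide), hs₁, den_reg (by decide), den_reg (by decide), den_reg (by decide), hN]
  intro b hb
  have key : b < G.N → ((den M markP s₁).arr aMk b ≠ 0 ↔ G.Reach (G.N - 1) b ∨
      (s.arr aHt (s.reg rU) ≤ s.reg rD + 1 ∧ G.Reach (s.reg rU) b)) := fun hb => by
    rw [hm b hb]
    constructor
    · rintro ⟨r, hr, h1, h2⟩
      rcases (hmk₁ r hr).1 h1 with rfl | ⟨h3, rfl⟩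
      exacts [.inl h2, .inr ⟨h3, h2⟩]
    · rintro (h2 | ⟨h3, h2⟩)
      exacts [⟨_, by omega, (hmk₁ _ (by omega)).2 (.inl rfl), h2⟩,
        ⟨_, hu, (hmk₁ _ hu).2 (.inr ⟨h3, rfl⟩), h2⟩]
  simp only [den_put, State.setArr_arr, if_true, Ex.ev_var, State.setArr_reg, hU, hN', Ex.ev_one,
    Function.update_apply, Net.IsBreak]
  by_cases h1 : b = G.N
  · simp [h1]
  · by_cases h2 : b = s.reg rU
    · simp [h2]
    · have := key (by omega)
      simp only [h1, h2, if_false, this, or_false]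

/-- Start a new cell with `rI`. -/
def newCellP : St :=
  .put aRep (.var rCnt) (.var rI) ;; .put aHi (.var rCnt) (.var rI) ;; .set rCnt (.var rCnt + 1)

/-- List the maximal intervals of `0, …, N` that contain no breakpoint or consist of one
breakpoint. -/
def cellsP : St :=
  .rep rI (.var rPow) (.put aRep (.var rI) 0 ;; .put aHi (.var rI) 0) ;;
  .set rCnt 0 ;;
  .rep rI (.var rN + 1)
    (.ite (.arr aMk (.var rI)) newCellP
      (.ite (.var rI)
        (.ite (.arr aMk (.var rI - 1)) newCellP (.put aHi (.var rCnt - 1) (.var rI)))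
        newCellP))

/-- The interval `[r, t]` consists of one element or contains no element with the property `B`. -/
def Uniform (B : ℕ → Prop) (r t : ℕ) : Prop := r = t ∨ ∀ b, r ≤ b → b ≤ t → ¬ B b

/-- The intervals `[rep i, hi i]` with `i < c` are a partition of `{0, …, n - 1}` into uniform
intervals, and the last one ends with `n - 1`. -/
structure IsCells (B : ℕ → Prop) (n c : ℕ) (rep hi : ℕ → ℕ) : Prop where
  le : ∀ i < c, rep i ≤ hi i
  lt : ∀ i < c, hi i < n
  uniform : ∀ i < c, Uniform B (rep i) (hi i)
  cover : ∀ v < n, ∃ i < c, rep i ≤ v ∧ v ≤ hi i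
  last : 0 < n → 0 < c ∧ hi (c - 1) = n - 1

theorem IsCells.new {B : ℕ → Prop} {n c : ℕ} {rep hi : ℕ → ℕ} (h : IsCells B n c rep hi) :
    IsCells B (n + 1) (c + 1) (Function.update rep c n) (Function.update hi c n) := by
  have e : ∀ (f : ℕ → ℕ) i, i < c → Function.update f c n i = f i := fun f i hi =>
    Function.update_of_ne (by omega) _ _
  have split : ∀ i < c + 1, i < c ∨ i = c := fun i hi => by omega
  refine ⟨fun i hi' => ?_, fun i hi' => ?_, fun i hi' => ?_, fun v hv => ?_, fun _ => ?_⟩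
  · rcases split i hi' with h1 | rfl
    · rw [e _ i h1, e _ i h1]; exact h.le i h1
    · simp
  · rcases split i hi' with h1 | rfl
    · rw [e _ i h1]; have := h.lt i h1; omega
    · simp
  · rcases split i hi' with h1 | rfl
    · rw [e _ i h1, e _ i h1]; exact h.uniform i h1
    · simp [Uniform]
  · by_cases hvn : v = n
    · exact ⟨c, by omega, by simp [hvn]⟩
    · obtain ⟨i, h1, h2⟩ := h.cover v (by omega)
      exact ⟨i, by omega, by rwa [e _ i h1, e _ i h1]⟩
  · simp

theorem IsCells.extend {B : ℕ → Prop} {n c : ℕ} {rep hi : ℕ → ℕ} (h : IsCells B n c rep hi)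
    (hn : 0 < n) (h1 : ¬ B n) (h2 : ¬ B (n - 1)) :
    IsCells B (n + 1) c rep (Function.update hi (c - 1) n) := by
  obtain ⟨hc, hl⟩ := h.last hn
  have e : ∀ i, i < c → i ≠ c - 1 → Function.update hi (c - 1) n i = hi i := fun i _ h1 =>
    Function.update_of_ne h1 _ _
  have hle := h.le (c - 1) (by omega)
  refine ⟨fun i hi' => ?_, fun i hi' => ?_, fun i hi' => ?_, fun v hv => ?_, fun _ => ?_⟩
  · by_cases hi0 : i = c - 1
    · subst hi0; rw [Function.update_self]; omega
    · rw [e i hi' hi0]; exact h.le i hi'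
  · by_cases hi0 : i = c - 1
    · subst hi0; rw [Function.update_self]; omega
    · rw [e i hi' hi0]; have := h.lt i hi'; omega
  · by_cases hi0 : i = c - 1
    · subst hi0
      rw [Function.update_self]
      refine .inr fun b hb1 hb2 hb => ?_
      rcases h.uniform (c - 1) (by omega) with hu | hu
      · have : b = n - 1 ∨ b = n := by omega
        rcases this with rfl | rfl
        exacts [h2 hb, h1 hb]
      · by_cases hbn : b = n
        · exact h1 (hbn ▸ hb)
        · exact hu b hb1 (by omega) hb
    · rw [e i hi' hi0]; exact h.uniform i hi'
  · by_cases hvn : v = n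
    · refine ⟨c - 1, by omega, by omega, by rw [Function.update_self]; omega⟩
    · obtain ⟨i, h1, h2, h3⟩ := h.cover v (by omega)
      refine ⟨i, h1, h2, ?_⟩
      by_cases hi0 : i = c - 1
      · subst hi0; rw [Function.update_self]; omega
      · rwa [e i h1 hi0]
  · simp [hc]

open scoped Classical in
/-- A cell begins at `0`, at each breakpoint and behind each breakpoint. -/
theorem card_newCell_le {B : ℕ → Prop} {F : Finset ℕ} (hF : ∀ b, B b → b ∈ F) (n : ℕ) :
    ((Finset.range n).filter fun i => i = 0 ∨ B i ∨ B (i - 1)).card ≤ 2 * F.card + 1 := by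
  have hsub : ((Finset.range n).filter fun i => i = 0 ∨ B i ∨ B (i - 1)) ⊆
      insert 0 (F ∪ F.image (· + 1)) := by
    intro i hi
    simp only [Finset.mem_filter, Finset.mem_insert, Finset.mem_union, Finset.mem_image] at hi ⊢
    obtain ⟨-, hi⟩ := hi
    by_cases h0 : i = 0
    · exact .inl h0
    · rcases hi with h1 | h1 | h1
      exacts [absurd h1 h0, .inr (.inl (hF i h1)), .inr (.inr ⟨i - 1, hF _ h1, by omega⟩)]
  refine (Finset.card_le_card hsub).trans ?_
  have h1 := Finset.card_insert_le 0 (F ∪ F.image (· + 1))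
  have h2 := Finset.card_union_le F (F.image (· + 1))
  have h3 : (F.image (· + 1)).card ≤ F.card := Finset.card_image_le
  omega

theorem den_cellsP {M : ℕ} {s : State} {B : ℕ → Prop} (hM : s.reg rN + 1 ≤ M)
    (hP : s.reg rPow ≤ M) (hmk : ∀ b ≤ s.reg rN, s.arr aMk b ≠ 0 ↔ B b) {F : Finset ℕ}
    (hF : ∀ b, B b → b ∈ F) (hc : 2 * F.card + 1 ≤ s.reg rPow) :
    (∀ i < s.reg rPow, (den M cellsP s).arr aRep i ≤ (den M cellsP s).arr aHi i ∧
      (den M cellsP s).arr aHi i ≤ s.reg rN ∧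
      Uniform B ((den M cellsP s).arr aRep i) ((den M cellsP s).arr aHi i)) ∧
    ∀ v ≤ s.reg rN, ∃ i < s.reg rPow, (den M cellsP s).arr aRep i ≤ v ∧
      v ≤ (den M cellsP s).arr aHi i := by
  classical
  unfold cellsP
  simp only [den_seq]
  set s₁ := den M (.rep rI (.var rPow) (.put aRep (.var rI) 0 ;; .put aHi (.var rI) 0)) s with hs₁
  have h₁ : ∀ i < s.reg rPow, s₁.arr aRep i = 0 ∧ s₁.arr aHi i = 0 :=
    den_rep (M := M) (x := rI) (e := .var rPow)
      (p := .put aRep (.var rI) 0 ;; .put aHi (.var rI) 0) (s := s)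
      (fun n s' => ∀ i < n, s'.arr aRep i = 0 ∧ s'.arr aHi i = 0) (s.reg rPow) rfl hP (by simp)
      (by
        intro n s' hn hr ha ih i hi
        by_cases hin : i = n
        · simp [hin]
        · simpa [Function.update_apply, hin] using ih i (by omega))
  have hN₁ : s₁.reg rN = s.reg rN := den_reg (by decide) s
  have hmk₁ : s₁.arr aMk = s.arr aMk := den_arr (by decide) s
  set s₂ := den M (.set rCnt 0) s₁ with hs₂
  set new : ℕ → Prop := fun i => i = 0 ∨ B i ∨ B (i - 1) with hnew
  set c : ℕ → ℕ := fun n => ((Finset.range n).filter new).card with hcdef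
  have hcs : ∀ n, c (n + 1) = c n + if new n then 1 else 0 := fun n => by
    simp only [hcdef, Finset.range_add_one, Finset.filter_insert]
    split_ifs
    · rw [Finset.card_insert_of_notMem (by simp)]
    · rfl
  have hcle : ∀ n, c n ≤ s.reg rPow := fun n => (card_newCell_le hF n).trans hc
  have key := den_rep (M := M) (x := rI) (e := .var rN + 1)
    (p := .ite (.arr aMk (.var rI)) newCellP
      (.ite (.var rI)
        (.ite (.arr aMk (.var rI - 1)) newCellP (.put aHi (.var rCnt - 1) (.var rI)))
        newCellP)) (s := s₂)
    (fun n s' => s'.reg rCnt = c n ∧ IsCells B n (c n) (s'.arr aRep) (s'.arr aHi) ∧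
      ∀ i < s.reg rPow, c n ≤ i → s'.arr aRep i = 0 ∧ s'.arr aHi i = 0) (s.reg rN + 1)
    (by simp [hs₂, hN₁]) hM
    ⟨by simp [hs₂, hcdef], ⟨by simp [hcdef], by simp [hcdef], by simp [hcdef], by simp, by simp⟩,
      fun i hi _ => h₁ i hi⟩
    (by
      rintro n s' hn hr ha ⟨ih1, ih2, ih3⟩
      have e1 : s'.arr aMk = s.arr aMk := (ha _ (by decide)).trans hmk₁
      have hnewcell : new n → (den M newCellP (s'.setReg rI n)).reg rCnt = c (n + 1) ∧
          IsCells B (n + 1) (c (n + 1)) ((den M newCellP (s'.setReg rI n)).arr aRep)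
            ((den M newCellP (s'.setReg rI n)).arr aHi) ∧
          ∀ i < s.reg rPow, c (n + 1) ≤ i → (den M newCellP (s'.setReg rI n)).arr aRep i = 0 ∧
            (den M newCellP (s'.setReg rI n)).arr aHi i = 0 := by
        intro hn
        rw [hcs, if_pos hn]
        simp only [newCellP, den_seq, den_put, den_set, Ex.ev_var, Ex.ev_add, Ex.ev_one,
          State.setReg_reg, State.setReg_arr, State.setArr_reg, State.setArr_arr, if_true,
          Nat.reduceEqDiff, if_false, ih1]
        refine ⟨trivial, ih2.new, fun i hi hci => ?_⟩
        rw [Function.update_of_ne (by omega), Function.update_of_ne (by omega)]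
        exact ih3 i hi (by omega)
      have hb1 := hmk n (by omega)
      have hb2 := hmk (n - 1) (by omega)
      simp only [den_ite, Ex.ev_arr, Ex.ev_var, Ex.ev_sub, Ex.ev_one, State.setReg_reg, if_true,
        State.setReg_arr, e1]
      by_cases c1 : s.arr aMk n = 0
      · rw [if_pos c1]
        by_cases c2 : n = 0
        · rw [if_pos c2]; exact hnewcell (.inl c2)
        · rw [if_neg c2]
          by_cases c3 : s.arr aMk (n - 1) = 0
          · rw [if_pos c3]
            have n1 : ¬ B n := fun hb => hb1.2 hb c1
            have n2 : ¬ B (n - 1) := fun hb => hb2.2 hb c3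
            have hnn : ¬ new n := by rintro (h | h | h); exacts [c2 h, n1 h, n2 h]
            rw [hcs, if_neg hnn, add_zero]
            simp only [den_put, Ex.ev_var, Ex.ev_sub, Ex.ev_one,
              State.setReg_reg, State.setReg_arr, State.setArr_reg, State.setArr_arr, if_true,
              Nat.reduceEqDiff, if_false, ih1]
            refine ⟨trivial, ih2.extend (by omega) n1 n2, fun i hi hci => ?_⟩
            have := (ih2.last (by omega)).1
            rw [Function.update_of_ne (by omega)]
            exact ih3 i hi hci
          · rw [if_neg c3]; exact hnewcell (.inr (.inr (hb2.1 c3)))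
      · rw [if_neg c1]; exact hnewcell (.inr (.inl (hb1.1 c1))))
  obtain ⟨-, k2, k3⟩ := key
  refine ⟨fun i hi => ?_, fun v hv => ?_⟩
  · by_cases hic : i < c (s.reg rN + 1)
    · exact ⟨k2.le i hic, by have := k2.lt i hic; omega, k2.uniform i hic⟩
    · obtain ⟨h1, h2⟩ := k3 i hi (by omega)
      rw [h1, h2]
      exact ⟨le_rfl, Nat.zero_le _, .inl rfl⟩
  · obtain ⟨i, h1, h2⟩ := k2.cover v (by omega)
    exact ⟨i, h1.trans_le (hcle _), h2⟩

/-- The corners of the box number `rE`: the cell of coordinate `j` is given by digit number `j` of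
the number of the box in base `2 ^ β`. -/
def decodeP : St :=
  .set rA (.var rE) ;;
  .rep rJ (.var rDim)
    (.set rB (.var rA) ;;
    .rep rI (.var rBeta) (.set rB (.half (.var rB))) ;;
    .set rT (.var rB) ;;
    .rep rI (.var rBeta) (.set rT (.var rT + .var rT)) ;;
    .put aZ (.var rJ) (.arr aRep (.var rA - .var rT)) ;;
    .put aW (.var rJ) (.arr aHi (.var rA - .var rT)) ;;
    .set rA (.var rB))

theorem den_halve {M : ℕ} {s : State} (hM : s.reg rBeta ≤ M) :
    (den M (.rep rI (.var rBeta) (.set rB (.half (.var rB)))) s).reg rB =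
      s.reg rB / 2 ^ s.reg rBeta :=
  den_rep (fun n s' => s'.reg rB = s.reg rB / 2 ^ n) (s.reg rBeta) rfl hM (by simp)
    fun n s' hn hr ha ih => by simp [ih, pow_succ, Nat.div_div_eq_div_mul]

theorem den_double {M t : ℕ} (ht : t ∉ [rI, rBeta]) {s : State} (hM : s.reg rBeta ≤ M) :
    (den M (.rep rI (.var rBeta) (.set t (.var t + .var t))) s).reg t =
      s.reg t * 2 ^ s.reg rBeta := by
  have ht' : t ≠ rI := fun e => ht (by simp [e])
  exact den_rep (fun n s' => s'.reg t = s.reg t * 2 ^ n) (s.reg rBeta) rfl hM (by simp)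
    fun n s' hn hr ha ih => by simp [ih, pow_succ, ht']; ring

theorem den_decodeP {M : ℕ} {s : State} (hd : s.reg rDim ≤ M) (hb : s.reg rBeta ≤ M) :
    ∀ j < s.reg rDim, (den M decodeP s).arr aZ j =
        s.arr aRep (s.reg rE / (2 ^ s.reg rBeta) ^ j % 2 ^ s.reg rBeta) ∧
      (den M decodeP s).arr aW j =
        s.arr aHi (s.reg rE / (2 ^ s.reg rBeta) ^ j % 2 ^ s.reg rBeta) := by
  unfold decodeP
  rw [den_seq]
  set P := 2 ^ s.reg rBeta with hP
  refine (den_rep (fun n s' => s'.reg rA = s.reg rE / P ^ n ∧ ∀ j < n,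
    s'.arr aZ j = s.arr aRep (s.reg rE / P ^ j % P) ∧
    s'.arr aW j = s.arr aHi (s.reg rE / P ^ j % P)) (s.reg rDim) (by simp) hd
    (by simp) ?_).2
  rintro n s' hn hr ha ⟨ih1, ih2⟩
  have hβ : s'.reg rBeta = s.reg rBeta := hr _ (by decide)
  have e1 : s'.arr aRep = s.arr aRep := ha _ (by decide)
  have e2 : s'.arr aHi = s.arr aHi := ha _ (by decide)
  simp only [den_seq]
  set s₁ := den M (.set rB (.var rA)) (s'.setReg rJ n) with hs₁
  set s₂ := den M (.rep rI (.var rBeta) (.set rB (.half (.var rB)))) s₁ with hs₂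
  have b₁ : s₁.reg rBeta = s.reg rBeta := by simp [hs₁, hβ]
  have h₂ : s₂.reg rB = s.reg rE / P ^ n / P := by
    rw [hs₂, den_halve (by rw [b₁]; exact hb), b₁]
    simp [hs₁, ih1, hP]
  set s₃ := den M (.set rT (.var rB)) s₂ with hs₃
  have b₃ : s₃.reg rBeta = s.reg rBeta := by rw [hs₃, den_reg (by decide), den_reg (by decide), b₁]
  set s₄ := den M (.rep rI (.var rBeta) (.set rT (.var rT + .var rT))) s₃ with hs₄
  have h₄ : s₄.reg rT = s.reg rE / P ^ n / P * P := by
    rw [hs₄, den_double (by decide) (by rw [b₃]; exact hb), b₃]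
    simp [hs₃, h₂, hP]
  have hA : s₄.reg rA = s.reg rE / P ^ n := by
    rw [hs₄, den_reg (by decide), hs₃, den_reg (by decide), hs₂, den_reg (by decide)]
    simp [hs₁, ih1]
  have hB : s₄.reg rB = s.reg rE / P ^ n / P := by
    rw [hs₄, den_reg (by decide)]; simp [hs₃, h₂]
  have hJ : s₄.reg rJ = n := by
    rw [hs₄, den_reg (by decide), hs₃, den_reg (by decide), hs₂, den_reg (by decide)]
    simp [hs₁]
  have harr : ∀ a, s₄.arr a = s'.arr a := fun a => by
    rw [hs₄, den_arr (by simp [St.wArr]), hs₃, den_arr (by simp [St.wArr]), hs₂,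
      den_arr (by simp [St.wArr])]
    rfl
  have hdig : s.reg rE / P ^ n - s.reg rE / P ^ n / P * P = s.reg rE / P ^ n % P := by
    rw [Nat.mod_eq_sub, Nat.mul_comm]
  simp only [den_put, den_set, Ex.ev_arr, Ex.ev_var, Ex.ev_sub, State.setReg_reg, State.setReg_arr,
    State.setArr_reg, State.setArr_arr, if_true, Nat.reduceEqDiff, if_false, hA, hB, hJ, h₄, harr,
    e1, e2, hdig]
  refine ⟨by rw [Nat.div_div_eq_div_mul, pow_succ], fun j hj => ?_⟩
  by_cases hjn : j = n
  · simp [hjn]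
  · rw [Function.update_of_ne hjn, Function.update_of_ne hjn]
    exact ih2 j (by omega)

/-- Every sequence of digits belongs to a number. -/
theorem exists_digits {P d : ℕ} {g : ℕ → ℕ} (hg : ∀ j < d, g j < P) :
    ∃ e < P ^ d, ∀ j < d, e / P ^ j % P = g j := by
  induction d generalizing g with
  | zero => exact ⟨0, by simp, by simp⟩
  | succ d ih =>
    obtain ⟨e, he, h⟩ := ih (g := fun j => g (j + 1)) fun j hj => hg _ (by omega)
    have h0 := hg 0 (by omega)
    have hdiv : (g 0 + P * e) / P = e := by
      rw [Nat.add_mul_div_left _ _ (by omega), Nat.div_eq_of_lt h0, zero_add]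
    refine ⟨g 0 + P * e, ?_, fun j hj => ?_⟩
    · calc g 0 + P * e < P * (e + 1) := by rw [mul_add]; omega
        _ ≤ P * P ^ d := Nat.mul_le_mul_left _ he
        _ = P ^ (d + 1) := by ring
    · cases j with
      | zero => simp [Nat.add_mul_mod_self_left, Nat.mod_eq_of_lt h0]
      | succ j =>
        rw [pow_succ', ← Nat.div_div_eq_div_mul, hdiv]
        exact h j (by omega)

/-! ### The test as a program -/

/-- Nonzero if and only if the two values differ. -/
def Ex.ne (e e' : Ex) : Ex := (e - e') + (e' - e)

theorem Ex.ev_ne_eq_zero {s : State} {e e' : Ex} : (e.ne e').ev s = 0 ↔ e.ev s = e'.ev s := by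
  simp only [Ex.ne, Ex.ev_add, Ex.ev_sub]; omega

/-- Reject if `e` is nonzero. -/
def rejectP (e : Ex) : St := .ite e (.set rR 0) .skip

theorem den_rejectP {M : ℕ} {e : Ex} {s : State} :
    (den M (rejectP e) s).reg rR ≠ 0 ↔ s.reg rR ≠ 0 ∧ e.ev s = 0 := by
  simp only [rejectP, den_ite]
  split_ifs with h <;> simp [h]

/-- Count how often each gate is chosen as a true input. -/
def countP : St :=
  clearP aAs ;;
  .rep rJ (.var rK) (.put aAs (.arr aZ (.var rJ)) (.arr aAs (.arr aZ (.var rJ)) + 1))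

/-- Compute the overriding values. -/
def overrideP : St :=
  .rep rI (.var rN)
    (.ite (.arr aFr (.var rI))
      (.ite (Ex.ne (.arr aZ (.var rK + .arr aFr (.var rI) - 1)) (.var rN))
        (.put aOv (.var rI) (.arr aTyp (.var rI) - 1))
        (.put aOv (.var rI) (4 - .arr aTyp (.var rI))))
      (.put aOv (.var rI) 0))

/-- Find out whether `rU` is an in-neighbour of `rI`. -/
def isPredP : St :=
  .set rA 0 ;;
  .rep rJ (.arr aDeg (.var rI))
    (.ite (Ex.ne (.arr aIn (.arr aOff (.var rI) + .var rJ)) (.var rU)) .skip (.set rA 1))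

/-- Reject if the value of gate `rU` differs from the overriding value of gate `rI`. -/
def agreeP : St :=
  .ite (Ex.ne (.arr aVal (.var rU) + 1) (.arr aOv (.var rI))) (.set rR 0) .skip

/-- The consistency of gate `rU` with the witness of the frontier gate `rI`. -/
def witnessP : St :=
  isPredP ;;
  .ite (Ex.ne (.arr aZ (.var rK + .arr aFr (.var rI) - 1)) (.var rU)) .skip
    (.ite (.var rA) agreeP (.set rR 0)) ;;
  .ite (Ex.ne (.arr aZ (.var rK + .arr aFr (.var rI) - 1)) (.var rN)) .skip
    (.ite (.var rA) agreeP .skip)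

/-- Evaluate the circuit for the vector `aZ`. -/
def prepareP : St := countP ;; overrideP ;; evalP

/-- The conditions of the test that do not concern the witnesses. -/
def choiceP : St :=
  .set rR (.arr aVal (.var rN - 1)) ;;
  rejectP (.arr aAs (.var rN)) ;; rejectP (.arr aAs (.var rU) - 1) ;;
  .ite (.arr aAs (.var rU)) (rejectP (.arr aTyp (.var rU))) .skip

/-- The test of the vector `aZ` at gate `rU`. -/
def testP : St :=
  prepareP ;; choiceP ;; .rep rI (.var rN) (.ite (.arr aFr (.var rI)) witnessP .skip)

theorem cnt_succ (n : ℕ) (z : ℕ → ℕ) (i : ℕ) :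
    Net.cnt (n + 1) z i = Net.cnt n z i + if z n = i then 1 else 0 := by
  unfold Net.cnt
  rw [Finset.range_add_one, Finset.filter_insert]
  split_ifs
  · rw [Finset.card_insert_of_notMem (by simp)]
  · rfl

theorem den_countP {M : ℕ} {s : State} (hN : s.reg rN + 1 ≤ M) (hK : s.reg rK ≤ M) :
    ∀ i ≤ s.reg rN, (den M countP s).arr aAs i = Net.cnt (s.reg rK) (s.arr aZ) i := by
  unfold countP
  rw [den_seq]
  have h0 := den_clearP (a := aAs) hN
  have hZ : (den M (clearP aAs) s).arr aZ = s.arr aZ := den_arr (by decide) s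
  refine den_rep (fun n s' => ∀ i ≤ s.reg rN, s'.arr aAs i = Net.cnt n (s.arr aZ) i)
    (s.reg rK) (den_reg (by decide) s) hK (fun i hi => by rw [h0 i hi]; simp [Net.cnt]) ?_
  intro n s' hn hr ha ih i hi
  have e1 : s'.arr aZ = s.arr aZ := (ha _ (by decide)).trans hZ
  simp only [den_put, Ex.ev_arr, Ex.ev_var, Ex.ev_add, Ex.ev_one, State.setReg_reg,
    State.setReg_arr, State.setArr_arr, if_true, e1, Function.update_apply, cnt_succ]
  by_cases hz : i = s.arr aZ n
  · rw [if_pos hz, if_pos hz.symm, ← hz, ih i hi]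
  · rw [if_neg hz, if_neg (Ne.symm hz), ih i hi, add_zero]

theorem den_overrideP {M : ℕ} {s : State} (hN : s.reg rN ≤ M) :
    ∀ i < s.reg rN, (den M overrideP s).arr aOv i =
      (netOf s).ovr (s.reg rK) (s.arr aFr) (s.arr aZ) i := by
  unfold overrideP
  refine den_rep (fun n s' => ∀ i < n, s'.arr aOv i =
      (netOf s).ovr (s.reg rK) (s.arr aFr) (s.arr aZ) i) (s.reg rN) rfl hN (by simp) ?_
  intro n s' hn hr ha ih i hi
  have e1 : s'.arr aZ = s.arr aZ := ha _ (by decide)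
  have e2 : s'.arr aFr = s.arr aFr := ha _ (by decide)
  have e3 : s'.arr aTyp = s.arr aTyp := ha _ (by decide)
  have e4 : s'.reg rN = s.reg rN := hr _ (by decide)
  have e5 : s'.reg rK = s.reg rK := hr _ (by decide)
  simp only [den_ite, den_put, Ex.ev_ne_eq_zero, Ex.ev_arr, Ex.ev_var, Ex.ev_add, Ex.ev_sub,
    Ex.ev_ofNat, State.setReg_reg, State.setReg_arr, if_true, e1, e2, e3, e4, e5,
    Nat.reduceEqDiff, if_false]
  by_cases hin : i = n
  · subst hin
    simp only [Net.ovr, netOf]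
    split_ifs <;> simp_all
  · have := ih i (by omega)
    split_ifs <;> simp [hin, this]

theorem den_isPredP {M i : ℕ} {s : State} (hi : s.reg rI = i) (hM : (netOf s).deg i ≤ M) :
    (den M isPredP s).reg rA ≠ 0 ↔ ∃ j < (netOf s).deg i, (netOf s).prd i j = s.reg rU := by
  unfold isPredP
  rw [den_seq]
  refine den_rep (fun n s' => s'.reg rA ≠ 0 ↔ ∃ j < n, (netOf s).prd i j = s.reg rU)
    ((netOf s).deg i) (by simp [netOf, hi]) hM (by simp) ?_
  intro n s' hn hr ha ih
  have e1 : s'.reg rI = i := by rw [hr _ (by decide), ← hi]; simp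
  have e2 : s'.reg rU = s.reg rU := by rw [hr _ (by decide)]; simp
  have e3 : s'.arr aIn = s.arr aIn := ha _ (by decide)
  have e4 : s'.arr aOff = s.arr aOff := ha _ (by decide)
  have hp : (netOf s).prd i n = s.arr aIn (s.arr aOff i + n) := rfl
  simp only [Nat.lt_succ_iff_lt_or_eq, or_and_right, exists_or, exists_eq_left, ← ih, hp]
  simp only [den_ite, den_set, den_skip, Ex.ev_ne_eq_zero, Ex.ev_arr, Ex.ev_var, Ex.ev_add,
    State.setReg_reg, State.setReg_arr, if_true, e1, e2, e3, e4, Nat.reduceEqDiff, if_false,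
    Ex.ev_one]
  split_ifs with h
  · simp [h]
  · simp [h]

theorem den_witnessP {M i : ℕ} {s : State} (hi : s.reg rI = i) (hM : (netOf s).deg i ≤ M) :
    (den M witnessP s).reg rR ≠ 0 ↔ s.reg rR ≠ 0 ∧
      (s.arr aZ (s.reg rK + s.arr aFr i - 1) = s.reg rU →
        (∃ j < (netOf s).deg i, (netOf s).prd i j = s.reg rU) ∧
          s.arr aVal (s.reg rU) + 1 = s.arr aOv i) ∧
      (s.arr aZ (s.reg rK + s.arr aFr i - 1) = s.reg rN →
        (∃ j < (netOf s).deg i, (netOf s).prd i j = s.reg rU) →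
          s.arr aVal (s.reg rU) + 1 = s.arr aOv i) := by
  have key := den_isPredP hi hM
  unfold witnessP
  rw [den_seq, den_seq]
  set s₁ := den M isPredP s with hs₁
  have r1 : ∀ r, r ∉ [rA, rJ] → s₁.reg r = s.reg r := fun r hr => by
    refine den_reg ?_ s
    simp only [isPredP, St.wReg, List.cons_append, List.nil_append, List.mem_cons] at hr ⊢
    tauto
  have a1 : ∀ a, s₁.arr a = s.arr a := fun a => den_arr (by simp [isPredP, St.wArr]) s
  have i1 := (r1 rI (by decide)).trans hi
  have i2 := r1 rU (by decide)
  have i3 := r1 rN (by decide)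
  have i4 := r1 rK (by decide)
  have i5 := r1 rR (by decide)
  simp only [den_ite, agreeP, den_set, den_skip, Ex.ev_ne_eq_zero, Ex.ev_arr, Ex.ev_var,
    Ex.ev_add, Ex.ev_sub, Ex.ev_one, i1, i2, i4, a1]
  rw [← key]
  by_cases c1 : s.arr aZ (s.reg rK + s.arr aFr i - 1) = s.reg rU <;>
  by_cases c2 : s.arr aZ (s.reg rK + s.arr aFr i - 1) = s.reg rN <;>
  by_cases c3 : s₁.reg rA = 0 <;>
  by_cases c4 : s.arr aVal (s.reg rU) + 1 = s.arr aOv i <;>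
  simp [c1, c2, c3, c4, i1, i2, i3, i4, i5, a1] <;> simp_all

theorem den_prepareP {M : ℕ} {s : State} {G : Net} (hG : netOf s = G) (h : G.Ok) (hM : Fits M G)
    (hK : s.reg rK ≤ M) :
    (∀ i ≤ G.N, (den M prepareP s).arr aAs i = Net.cnt (s.reg rK) (s.arr aZ) i) ∧
    (∀ i < G.N, (den M prepareP s).arr aOv i = G.ovr (s.reg rK) (s.arr aFr) (s.arr aZ) i) ∧
    ∀ i < G.N, (den M prepareP s).arr aVal i =
      G.val (Net.cnt (s.reg rK) (s.arr aZ)) (G.ovr (s.reg rK) (s.arr aFr) (s.arr aZ)) i := by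
  have hN : s.reg rN = G.N := by rw [← hG]; rfl
  have hM1 := hM.1
  unfold prepareP
  simp only [den_seq]
  set s₁ := den M countP s with hs₁
  set s₂ := den M overrideP s₁ with hs₂
  have hG₁ : netOf s₁ = G := by rw [hs₁, netOf_den (by decide), hG]
  have hG₂ : netOf s₂ = G := by rw [hs₂, netOf_den (by decide), hG₁]
  have hAs : ∀ i ≤ G.N, s₂.arr aAs i = Net.cnt (s.reg rK) (s.arr aZ) i := fun i hi => by
    rw [hs₂, den_arr (by decide), hs₁, den_countP (by omega) hK i (by omega)]
  have hOv : ∀ i < G.N, s₂.arr aOv i = G.ovr (s.reg rK) (s.arr aFr) (s.arr aZ) i := fun i hi => by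
    have e1 : s₁.reg rN = G.N := by rw [hs₁, den_reg (by decide), hN]
    have e2 : s₁.reg rK = s.reg rK := den_reg (by decide) s
    have e3 : s₁.arr aFr = s.arr aFr := den_arr (by decide) s
    have e4 : s₁.arr aZ = s.arr aZ := den_arr (by decide) s
    rw [hs₂, den_overrideP (by omega) i (by omega), hG₁, e2, e3, e4]
  refine ⟨fun i hi => ?_, fun i hi => ?_, fun i hi => ?_⟩
  · rw [den_arr (by decide), hAs i hi]
  · rw [den_arr (by decide), hOv i hi]
  · rw [den_evalP hG₂ h hM i hi]
    refine h.val_congr (fun _ => True) (h.val_eq _ _) (h.val_eq _ _) (fun i hi _ => ?_) i hi trivial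
    rw [hAs i hi.le, hOv i hi]
    exact ⟨rfl, Iff.rfl, fun _ _ _ => trivial⟩

theorem den_choiceP {M : ℕ} {s : State} : (den M choiceP s).reg rR ≠ 0 ↔
    s.arr aVal (s.reg rN - 1) ≠ 0 ∧ s.arr aAs (s.reg rN) = 0 ∧ s.arr aAs (s.reg rU) ≤ 1 ∧
      (s.arr aAs (s.reg rU) ≠ 0 → s.arr aTyp (s.reg rU) = 0) := by
  unfold choiceP
  simp only [den_seq]
  set t₁ := den M (.set rR (.arr aVal (.var rN - 1))) s with ht₁
  set t₂ := den M (rejectP (.arr aAs (.var rN))) t₁ with ht₂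
  set t₃ := den M (rejectP (.arr aAs (.var rU) - 1)) t₂ with ht₃
  have f1 : t₂.reg rU = s.reg rU := by rw [ht₂, den_reg (by decide), ht₁, den_reg (by decide)]
  have f2 : t₂.arr aAs = s.arr aAs := by rw [ht₂, den_arr (by decide), ht₁, den_arr (by decide)]
  have f3 : t₃.reg rU = s.reg rU := by rw [ht₃, den_reg (by decide), f1]
  have f4 : t₃.arr aAs = s.arr aAs := by rw [ht₃, den_arr (by decide), f2]
  have f5 : t₃.arr aTyp = s.arr aTyp := by
    rw [ht₃, den_arr (by decide), ht₂, den_arr (by decide), ht₁, den_arr (by decide)]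
  have f6 : t₁.reg rR = s.arr aVal (s.reg rN - 1) := by simp [ht₁]
  have f7 : t₁.reg rN = s.reg rN := by simp [ht₁]
  have f8 : t₁.arr aAs = s.arr aAs := rfl
  have g3 : t₃.reg rR ≠ 0 ↔ (s.arr aVal (s.reg rN - 1) ≠ 0 ∧ s.arr aAs (s.reg rN) = 0) ∧
      s.arr aAs (s.reg rU) - 1 = 0 := by
    rw [ht₃, den_rejectP, ht₂, den_rejectP, ← ht₂]
    simp only [Ex.ev_sub, Ex.ev_arr, Ex.ev_var, Ex.ev_one, f1, f2, f6, f7, f8]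
  rw [den_ite]
  simp only [Ex.ev_arr, Ex.ev_var, f3, f4, den_skip]
  by_cases c : s.arr aAs (s.reg rU) = 0
  · rw [if_pos c, g3, Nat.sub_eq_zero_iff_le]
    tauto
  · rw [if_neg c, den_rejectP, g3, Nat.sub_eq_zero_iff_le]
    simp only [Ex.ev_arr, Ex.ev_var, f3, f5]
    tauto

theorem den_witnessesP {M : ℕ} {s : State} {G : Net} (hG : netOf s = G) (hM : Fits M G) :
    (den M (.rep rI (.var rN) (.ite (.arr aFr (.var rI)) witnessP .skip)) s).reg rR ≠ 0 ↔
      s.reg rR ≠ 0 ∧ ∀ i < G.N, s.arr aFr i ≠ 0 →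
        (s.arr aZ (s.reg rK + s.arr aFr i - 1) = s.reg rU →
          (∃ j < G.deg i, G.prd i j = s.reg rU) ∧ s.arr aVal (s.reg rU) + 1 = s.arr aOv i) ∧
        (s.arr aZ (s.reg rK + s.arr aFr i - 1) = G.N →
          (∃ j < G.deg i, G.prd i j = s.reg rU) →
            s.arr aVal (s.reg rU) + 1 = s.arr aOv i) := by
  have hN : s.reg rN = G.N := by rw [← hG]; rfl
  have hM1 := hM.1
  obtain ⟨C, hC⟩ : ∃ C : ℕ → Prop, C = fun i =>
      (s.arr aZ (s.reg rK + s.arr aFr i - 1) = s.reg rU →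
        (∃ j < G.deg i, G.prd i j = s.reg rU) ∧ s.arr aVal (s.reg rU) + 1 = s.arr aOv i) ∧
      (s.arr aZ (s.reg rK + s.arr aFr i - 1) = G.N →
        (∃ j < G.deg i, G.prd i j = s.reg rU) →
          s.arr aVal (s.reg rU) + 1 = s.arr aOv i) := ⟨_, rfl⟩
  have key := den_rep (M := M) (x := rI) (e := .var rN)
    (p := .ite (.arr aFr (.var rI)) witnessP .skip) (s := s)
    (fun n s' => s'.reg rR ≠ 0 ↔ s.reg rR ≠ 0 ∧ ∀ i < n, s.arr aFr i ≠ 0 → C i) G.N hN (by omega)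
    (by simp) (by
      intro n s' hn hr ha ih
      have hG' : netOf (s'.setReg rI n) = G := by
        rw [← hG]
        exact netOf_congr (hr _ (by decide)) (ha _ (by decide)) (ha _ (by decide))
          (ha _ (by decide)) (ha _ (by decide))
      have hw := den_witnessP (M := M) (i := n) (s := s'.setReg rI n) (by simp)
        (by rw [hG']; exact hM.2 n hn)
      have d1 := (hr rN (by decide)).trans hN
      have d2 := hr rU (by decide)
      have d3 := hr rK (by decide)
      have d4 := ha aFr (by decide)
      have d5 := ha aZ (by decide)
      have d6 := ha aVal (by decide)
      have d7 := ha aOv (by decide)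
      simp only [hG', State.setReg_arr, State.setReg_reg, Nat.reduceEqDiff, if_false, d1, d2, d3,
        d4, d5, d6, d7] at hw
      have hw' : (den M witnessP (s'.setReg rI n)).reg rR ≠ 0 ↔ s'.reg rR ≠ 0 ∧ C n := by
        rw [hw, hC]
      have hsplit : (∀ i < n + 1, s.arr aFr i ≠ 0 → C i) ↔
          (∀ i < n, s.arr aFr i ≠ 0 → C i) ∧ (s.arr aFr n ≠ 0 → C n) := by
        simp only [Nat.lt_succ_iff_lt_or_eq, or_imp, forall_and, forall_eq]
      rw [hsplit]
      simp only [den_ite, Ex.ev_arr, Ex.ev_var, State.setReg_reg, if_true, State.setReg_arr, d4,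
        den_skip]
      by_cases c : s.arr aFr n = 0
      · rw [if_pos c]
        simp only [State.setReg_reg, Nat.reduceEqDiff, if_false]
        rw [ih]
        simp [c]
      · rw [if_neg c, hw', ih, and_assoc]
        simp [c])
  rw [key, hC]

theorem den_testP {M : ℕ} {s : State} {G : Net} (hG : netOf s = G) (h : G.Ok) (hM : Fits M G)
    (hK : s.reg rK ≤ M) (hu : s.reg rU < G.N) :
    (den M testP s).reg rR ≠ 0 ↔ G.Test (s.reg rK) (s.arr aFr) (s.reg rU) (s.arr aZ) := by
  have hN : s.reg rN = G.N := by rw [← hG]; rfl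
  have hN0 := h.pos
  obtain ⟨hAs, hOv, hVal⟩ := den_prepareP hG h hM hK
  unfold testP
  simp only [den_seq]
  set s₁ := den M prepareP s with hs₁
  set s₂ := den M choiceP s₁ with hs₂
  have hG₁ : netOf s₁ = G := by rw [hs₁, netOf_den (by decide), hG]
  have hG₂ : netOf s₂ = G := by rw [hs₂, netOf_den (by decide), hG₁]
  have b1 : s₂.reg rK = s.reg rK := by rw [hs₂, den_reg (by decide), hs₁, den_reg (by decide)]
  have b2 : s₂.reg rU = s.reg rU := by rw [hs₂, den_reg (by decide), hs₁, den_reg (by decide)]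
  have b3 : s₂.arr aFr = s.arr aFr := by rw [hs₂, den_arr (by decide), hs₁, den_arr (by decide)]
  have b4 : s₂.arr aZ = s.arr aZ := by rw [hs₂, den_arr (by decide), hs₁, den_arr (by decide)]
  have b5 : s₂.arr aVal = s₁.arr aVal := by rw [hs₂, den_arr (by decide)]
  have b6 : s₂.arr aOv = s₁.arr aOv := by rw [hs₂, den_arr (by decide)]
  have c1 : s₁.reg rN = G.N := by rw [hs₁, den_reg (by decide), hN]
  have c2 : s₁.reg rU = s.reg rU := by rw [hs₁, den_reg (by decide)]
  have c3 : s₁.arr aTyp = G.typ := by rw [← hG₁]; rfl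
  rw [den_witnessesP hG₂ hM, hs₂, den_choiceP, ← hs₂, b1, b2, b3, b4, b5, b6, c1, c2, c3,
    hVal _ (by omega), hAs _ le_rfl, hAs _ hu.le, hVal _ hu]
  constructor
  · rintro ⟨⟨h1, h2, h3, h4⟩, h5⟩
    refine ⟨h1, h2, h3, h4, fun i hi h0 => ?_, fun i hi h0 => ?_⟩
    · rw [← hOv i hi]; exact (h5 i hi h0).1
    · rw [← hOv i hi]; exact (h5 i hi h0).2
  · rintro ⟨h1, h2, h3, h4, h5, h6⟩
    exact ⟨⟨h1, h2, h3, h4⟩, fun i hi h0 => by rw [hOv i hi]; exact ⟨h5 i hi h0, h6 i hi h0⟩⟩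

/-! ### Writing the instance of Selectivity+ -/

/-- Append the value of `e` to the instance. -/
def pushP (e : Ex) : St := .put aOut (.var rW) e ;; .set rW (.var rW + 1)

/-- Append the box with the corners `aZ` and `aW` and the selectivity `t` to the instance. -/
def emitP (t : ℕ) : St :=
  .rep rJ (.var rDim)
    (pushP (.arr aZ (.var rJ)) ;; pushP 0 ;; pushP 1 ;;
      pushP (.arr aW (.var rJ) + 1) ;; pushP 0 ;; pushP 1) ;;
  pushP (.lit t) ;; pushP 0 ;; pushP 1

/-- The part of the instance behind its first three entries is `l`, and the writer stands behind
it. -/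
def Wrote (s : State) (l : List ℕ) : Prop :=
  s.reg rW = 3 + l.length ∧ ∀ i, s.arr aOut (3 + i) = l.getD i 0

theorem Wrote.push {M : ℕ} {s : State} {l : List ℕ} (h : Wrote s l) {e : Ex} {v : ℕ}
    (he : e.ev s = v) : Wrote (den M (pushP e) s) (l ++ [v]) := by
  obtain ⟨h1, h2⟩ := h
  refine ⟨by simp [pushP, h1]; omega, fun i => ?_⟩
  simp only [pushP, den_seq, den_put, den_set, State.setReg_arr, State.setArr_arr, if_true,
    Ex.ev_var, h1, he, Function.update_apply]
  by_cases hi : i = l.length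
  · subst hi; simp [List.getD_eq_getElem?_getD]
  · rw [if_neg (by omega), h2]
    simp only [List.getD_eq_getElem?_getD]
    rcases lt_or_gt_of_ne hi with h3 | h3
    · rw [List.getElem?_append_left h3]
    · rw [List.getElem?_eq_none h3.le, List.getElem?_eq_none (by simp; omega)]

theorem Wrote.congr {s s' : State} {l : List ℕ} (h : Wrote s l) (h1 : s'.reg rW = s.reg rW)
    (h2 : s'.arr aOut = s.arr aOut) : Wrote s' l := by
  rw [Wrote, h1, h2]; exact h

theorem Wrote.emit {M t : ℕ} {s : State} {l : List ℕ} (h : Wrote s l) (hM : s.reg rDim ≤ M) :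
    Wrote (den M (emitP t) s) (l ++ boxWord (s.reg rDim) (s.arr aZ, s.arr aW) t) := by
  unfold emitP boxWord
  set s₁ := den M (.rep rJ (.var rDim) (pushP (.arr aZ (.var rJ)) ;; pushP 0 ;; pushP 1 ;;
      pushP (.arr aW (.var rJ) + 1) ;; pushP 0 ;; pushP 1)) s with hs₁
  have h₁ : Wrote s₁ (l ++ ((List.range (s.reg rDim)).map
      fun j => [s.arr aZ j, 0, 1, s.arr aW j + 1, 0, 1]).flatten) := by
    rw [hs₁]
    refine den_rep (fun n s' => Wrote s' (l ++ ((List.range n).map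
      fun j => [s.arr aZ j, 0, 1, s.arr aW j + 1, 0, 1]).flatten)) (s.reg rDim) rfl hM
      (by simpa using h) ?_
    intro n s' hn hr ha ih
    have e1 : s'.arr aZ = s.arr aZ := ha _ (by decide)
    have e2 : s'.arr aW = s.arr aW := ha _ (by decide)
    have := (((((((ih.congr (s' := s'.setReg rJ n) (by simp) rfl).push (M := M)
      (e := .arr aZ (.var rJ)) rfl).push (M := M) (e := 0) rfl).push (M := M) (e := 1) rfl).push
      (M := M) (e := .arr aW (.var rJ) + 1) rfl).push (M := M) (e := 0) rfl).push (M := M) (e := 1)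
      rfl)
    rw [List.range_succ, List.map_append, List.flatten_append]
    simpa [pushP, e1, e2] using this
  rw [den_seq, den_seq, den_seq, ← hs₁]
  have := ((h₁.push (M := M) (e := .lit t) rfl).push (M := M) (e := 0) rfl).push (M := M) (e := 1)
    rfl
  simpa using this

/-- Compute the number of the vectors of cells. -/
def totalP : St :=
  .set rTot 1 ;; .rep rJ (.var rDim) (.rep rI (.var rBeta) (.set rTot (.var rTot + .var rTot)))

theorem den_totalP {M : ℕ} {s : State} (hd : s.reg rDim ≤ M) (hb : s.reg rBeta ≤ M) :
    (den M totalP s).reg rTot = (2 ^ s.reg rBeta) ^ s.reg rDim := by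
  unfold totalP
  rw [den_seq]
  refine den_rep (fun n s' => s'.reg rTot = (2 ^ s.reg rBeta) ^ n) (s.reg rDim) (by simp) hd
    (by simp) ?_
  intro n s' hn hr ha ih
  have hβ : s'.reg rBeta = s.reg rBeta := by rw [hr _ (by decide)]; simp
  rw [den_double (by decide) (by simpa [hβ] using hb)]
  simp [hβ, ih, pow_succ]

/-- The boxes for gate `rU`. -/
def gateBoxesP : St :=
  breaksP ;; cellsP ;;
  .rep rE (.var rTot)
    (decodeP ;; testP ;; .ite (.var rR) .skip (emitP 0 ;; .set rNum (.var rNum + 1)))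

/-- The box that contains all others. -/
def domainP : St :=
  .rep rJ (.var rDim) (.put aZ (.var rJ) 0 ;; .put aW (.var rJ) (.var rN)) ;; emitP 1

/-- Write the instance of Selectivity+. -/
def reduceP : St :=
  frontP ;; totalP ;; .set rW 3 ;; .set rNum 1 ;; domainP ;;
  .rep rU (.var rN) gateBoxesP ;;
  .put aOut 0 (.var rDim) ;; .put aOut 1 (.var rNum) ;; .put aOut 2 1 ;; .set rOut (.var rW)

theorem Uniform.eq_iff {B : ℕ → Prop} {r t x y b : ℕ} (h : Uniform B r t) (hx : r ≤ x) (hx' : x ≤ t)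
    (hy : r ≤ y) (hy' : y ≤ t) (hb : B b) : x = b ↔ y = b := by
  rcases h with rfl | h
  · have : x = y := by omega
    rw [this]
  · constructor
    · rintro rfl; exact absurd hb (h x hx hx')
    · rintro rfl; exact absurd hb (h y hy hy')

/-- What is fixed while the boxes are written: the circuit has admissible depth and weft, and the
constants of the construction are in place. -/
structure Setting (M D k : ℕ) (G : Net) (f₂ : ℕ → ℕ) (s : State) : Prop where
  net : netOf s = G
  ok : G.Ok
  fits : Fits M G
  height : G.IsHeight (fun _ => 1) (s.arr aHt)
  weft : G.IsHeight G.large f₂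
  depth_le : s.arr aHt (G.N - 1) ≤ D + 1
  weft_le : f₂ (G.N - 1) ≤ 1
  depth_eq : s.reg rD = D
  weight_eq : s.reg rK = k
  dim : s.reg rDim = k + 2 ^ (D + 1)
  beta : s.reg rBeta = D + 4
  pow : s.reg rPow = 2 ^ (D + 4)
  dim_le : k + 2 ^ (D + 1) ≤ M
  pow_le : (2 ^ (D + 4)) ^ (k + 2 ^ (D + 1)) ≤ M

theorem Setting.congr {M D k : ℕ} {G : Net} {f₂ : ℕ → ℕ} {s s' : State} (h : Setting M D k G f₂ s)
    (hr : ∀ r ∈ [rN, rD, rK, rDim, rBeta, rPow], s'.reg r = s.reg r)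
    (ha : ∀ a ∈ [aIn, aTyp, aDeg, aOff, aHt], s'.arr a = s.arr a) : Setting M D k G f₂ s' := by
  have hH := ha aHt (by decide)
  exact { h with
    net := by
      rw [← h.net]
      exact netOf_congr (hr _ (by decide)) (ha _ (by decide)) (ha _ (by decide)) (ha _ (by decide))
        (ha _ (by decide))
    height := hH ▸ h.height
    depth_le := hH ▸ h.depth_le
    depth_eq := by rw [hr _ (by decide), h.depth_eq]
    weight_eq := by rw [hr _ (by decide), h.weight_eq]
    dim := by rw [hr _ (by decide), h.dim]
    beta := by rw [hr _ (by decide), h.beta]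
    pow := by rw [hr _ (by decide), h.pow] }

/-- A statement that does not write what is fixed while the boxes are written. -/
def St.KeepsSetting (p : St) : Prop :=
  (∀ r ∈ [rN, rD, rK, rDim, rBeta, rPow], r ∉ p.wReg) ∧
    ∀ a ∈ [aIn, aTyp, aDeg, aOff, aHt], a ∉ p.wArr

instance (p : St) : Decidable p.KeepsSetting := by unfold St.KeepsSetting; infer_instance

theorem Setting.den {M D k : ℕ} {G : Net} {f₂ : ℕ → ℕ} {s : State} (h : Setting M D k G f₂ s)
    {p : St} (hp : p.KeepsSetting) : Setting M D k G f₂ (Ram.den M p s) :=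
  h.congr (fun r hr => den_reg (hp.1 r hr) s) fun a ha => den_arr (hp.2 a ha) s

theorem Setting.small {M D k : ℕ} {G : Net} {f₂ : ℕ → ℕ} {s : State} (h : Setting M D k G f₂ s) :
    D + 4 ≤ M ∧ 2 ^ (D + 4) ≤ M ∧ k ≤ M := by
  have h1 : 1 ≤ 2 ^ (D + 1) := Nat.one_le_two_pow
  have h2 : (2 ^ (D + 4)) ^ 1 ≤ (2 ^ (D + 4)) ^ (k + 2 ^ (D + 1)) :=
    Nat.pow_le_pow_right (by positivity) (by omega)
  rw [pow_one] at h2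
  have h3 := h.pow_le
  have h4 : D + 4 < 2 ^ (D + 4) := Nat.lt_two_pow_self
  have h5 := h.dim_le
  omega

/-- The boxes that have been written: none of them contains a vector that passes all tests, and
every vector that fails the test at a gate before `u` is contained in one of them. -/
structure Boxes (G : Net) (k d : ℕ) (fr : ℕ → ℕ) (u : ℕ) (Bs : List ((ℕ → ℕ) × (ℕ → ℕ))) :
    Prop where
  le : ∀ b ∈ Bs, ∀ j < d, b.1 j ≤ b.2 j
  le_N : ∀ b ∈ Bs, ∀ j < d, b.2 j ≤ G.N
  sound : ∀ b ∈ Bs, ∀ z, InBox d b z → ∃ u < G.N, ¬ G.Test k fr u z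
  complete : ∀ u' < u, ∀ z, (∀ j < d, z j ≤ G.N) → ¬ G.Test k fr u' z → ∃ b ∈ Bs, InBox d b z

/-- The instance that has been written consists of the bounding box and the boxes `Bs`. -/
structure Written (N d : ℕ) (Bs : List ((ℕ → ℕ) × (ℕ → ℕ))) (s : State) : Prop where
  wrote : Wrote s (boxWord d (fun _ => 0, fun _ => N) 1 ++ Bs.flatMap fun b => boxWord d b 0)
  num : s.reg rNum = Bs.length + 1

theorem Written.congr {N d : ℕ} {Bs : List ((ℕ → ℕ) × (ℕ → ℕ))} {s s' : State}
    (h : Written N d Bs s) (h1 : s'.reg rW = s.reg rW) (h2 : s'.arr aOut = s.arr aOut)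
    (h3 : s'.reg rNum = s.reg rNum) : Written N d Bs s' :=
  ⟨h.wrote.congr h1 h2, h3.trans h.num⟩

theorem den_gateBoxesP {M D k u : ℕ} {G : Net} {f₂ : ℕ → ℕ} {s : State} {fr : ℕ → ℕ}
    (hs : Setting M D k G f₂ s) (hu : s.reg rU = u) (huN : u < G.N) (hfr : s.arr aFr = fr)
    (hF : G.IsFrontier (2 ^ (D + 1)) fr)
    (htot : s.reg rTot = (2 ^ (D + 4)) ^ (k + 2 ^ (D + 1)))
    {Bs : List ((ℕ → ℕ) × (ℕ → ℕ))} (hB : Boxes G k (k + 2 ^ (D + 1)) fr u Bs)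
    (hW : Written G.N (k + 2 ^ (D + 1)) Bs s) :
    ∃ Bs', Boxes G k (k + 2 ^ (D + 1)) fr (u + 1) Bs' ∧
      Bs'.length ≤ Bs.length + (2 ^ (D + 4)) ^ (k + 2 ^ (D + 1)) ∧
      Written G.N (k + 2 ^ (D + 1)) Bs' (den M gateBoxesP s) := by
  obtain ⟨m1, m2, m3⟩ := hs.small
  have hN : s.reg rN = G.N := by rw [← hs.net]; rfl
  set d := k + 2 ^ (D + 1) with hd
  set P := 2 ^ (D + 4) with hP
  have hM1 := hs.fits.1
  have hMd := hs.dim_le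
  have hMP := hs.pow_le
  rw [← hd] at hMd hMP
  rw [← hP] at hMP
  have hbreak := den_breaksP hs.net hs.ok hs.fits (by rw [hu]; exact huN)
  rw [hs.depth_eq, hu] at hbreak
  set B := G.IsBreak D (s.arr aHt) u with hBr
  obtain ⟨F, hFB, cF⟩ := Net.exists_isBreak_bound hs.ok hs.height hs.depth_le huN
  unfold gateBoxesP
  simp only [den_seq]
  set s₁ := den M breaksP s with hs₁
  have hs1 : Setting M D k G f₂ s₁ := hs.den (by decide)
  have hN₁ : s₁.reg rN = G.N := by rw [← hs1.net]; rfl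
  have hcells := den_cellsP (M := M) (s := s₁) (B := B) (F := F) (by rw [hN₁]; exact hM1)
    (by rw [hs1.pow]; exact m2) (by rw [hN₁]; exact hbreak) hFB
    (by rw [hs1.pow]; have : 2 ^ (D + 4) = 4 * 2 ^ (D + 2) := by ring
        have := Nat.one_le_two_pow (n := D + 2); omega)
  rw [hN₁, hs1.pow, ← hP] at hcells
  obtain ⟨hc1, hc2⟩ := hcells
  set s₂ := den M cellsP s₁ with hs₂
  have hs2 : Setting M D k G f₂ s₂ := hs1.den (by decide)
  set rep := s₂.arr aRep with hrep
  set hi := s₂.arr aHi with hhi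
  have hU₂ : s₂.reg rU = u := by rw [hs₂, den_reg (by decide), hs₁, den_reg (by decide), hu]
  have hT₂ : s₂.reg rTot = P ^ d := by
    rw [hs₂, den_reg (by decide), hs₁, den_reg (by decide), htot]
  have hfr₂ : s₂.arr aFr = fr := by rw [hs₂, den_arr (by decide), hs₁, den_arr (by decide), hfr]
  have hW₂ : Written G.N d Bs s₂ := hW.congr
    (by rw [hs₂, den_reg (by decide), hs₁, den_reg (by decide)])
    (by rw [hs₂, den_arr (by decide), hs₁, den_arr (by decide)])
    (by rw [hs₂, den_reg (by decide), hs₁, den_reg (by decide)])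
  -- the corners of box number `e`
  obtain ⟨lo, hlo⟩ : ∃ lo : ℕ → ℕ → ℕ, lo = fun e j => rep (e / P ^ j % P) := ⟨_, rfl⟩
  obtain ⟨up, hup⟩ : ∃ up : ℕ → ℕ → ℕ, up = fun e j => hi (e / P ^ j % P) := ⟨_, rfl⟩
  have hPpos : 0 < P := by positivity
  have hcell : ∀ e j, lo e j ≤ up e j ∧ up e j ≤ G.N ∧ Uniform B (lo e j) (up e j) := fun e j => by
    rw [hlo, hup]; exact hc1 _ (Nat.mod_lt _ hPpos)
  -- the test depends only on the cells
  have hsame : ∀ e, ∀ z z' : ℕ → ℕ, InBox d (lo e, up e) z → InBox d (lo e, up e) z' →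
      G.Test k fr u z → G.Test k fr u z' := fun e z z' hz hz' =>
    hF.test_congr hs.ok hs.height hs.weft hs.depth_le hs.weft_le huN fun j hj b hb =>
      (hcell e j).2.2.eq_iff (hz j hj).1 (hz j hj).2 (hz' j hj).1 (hz' j hj).2 hb
  have hself : ∀ e, InBox d (lo e, up e) (lo e) := fun e j _ => ⟨le_rfl, (hcell e j).1⟩
  clear_value s₂ s₁
  obtain ⟨Bs', h1, h2, h3, h4⟩ := den_rep (M := M) (x := rE) (e := .var rTot)
    (p := decodeP ;; testP ;; .ite (.var rR) .skip (emitP 0 ;; .set rNum (.var rNum + 1)))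
    (s := s₂) (fun n s' => ∃ Bs', Boxes G k d fr u Bs' ∧ Bs'.length ≤ Bs.length + n ∧
      Written G.N d Bs' s' ∧ ∀ e < n, ¬ G.Test k fr u (lo e) →
        ∃ b ∈ Bs', ∀ z, InBox d (lo e, up e) z → InBox d b z) (P ^ d) hT₂ hMP
    ⟨Bs, hB, le_rfl, hW₂, by simp⟩ (by
      rintro n s' hn hr ha ⟨Bs', h1, h2, h3, h4⟩
      have hs' : Setting M D k G f₂ (s'.setReg rE n) := by
        refine hs2.congr (fun r hmem => ?_) (fun a hmem => ?_)
        · rw [State.setReg_reg, if_neg (by revert r; decide)]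
          exact hr r (by revert r; decide)
        · exact ha a (by revert a; decide)
      have e1 : (s'.setReg rE n).arr aRep = rep := ha _ (by decide)
      have e2 : (s'.setReg rE n).arr aHi = hi := ha _ (by decide)
      have e3 : (s'.setReg rE n).reg rE = n := by simp
      have e4 : (s'.setReg rE n).reg rU = u := by
        rw [State.setReg_reg, if_neg (by decide), hr _ (by decide), hU₂]
      have e5 : (s'.setReg rE n).arr aFr = fr := (ha _ (by decide)).trans hfr₂
      have hW' : Written G.N d Bs' (s'.setReg rE n) := h3.congr (by simp) rfl (by simp)
      set t := s'.setReg rE n with ht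
      clear_value t
      have hdec := den_decodeP (M := M) (s := t) (by rw [hs'.dim]; exact hMd)
        (by rw [hs'.beta]; exact m1)
      rw [hs'.dim, hs'.beta, e1, e2, e3, ← hP, ← hd] at hdec
      simp only [den_seq]
      set t₁ := den M decodeP t with ht₁
      have ht1 : Setting M D k G f₂ t₁ := hs'.den (by decide)
      have htest := den_testP (M := M) ht1.net hs.ok hs.fits (by rw [ht1.weight_eq]; exact m3)
        (by rw [ht₁, den_reg (by decide), e4]; exact huN)
      have f1 : t₁.reg rU = u := by rw [ht₁, den_reg (by decide), e4]
      have f2 : t₁.arr aFr = fr := by rw [ht₁, den_arr (by decide), e5]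
      rw [ht1.weight_eq, f1, f2] at htest
      have hz1 : InBox d (lo n, up n) (t₁.arr aZ) := fun j hj => by
        rw [(hdec j hj).1]
        have := (hcell n j).1
        simp only [hlo, hup] at this ⊢
        exact ⟨le_rfl, this⟩
      have htest' : (den M testP t₁).reg rR ≠ 0 ↔ G.Test k fr u (lo n) :=
        htest.trans ⟨hsame n _ _ hz1 (hself n), hsame n _ _ (hself n) hz1⟩
      set t₂ := den M testP t₁ with ht₂
      have ht2 : Setting M D k G f₂ t₂ := ht1.den (by decide)
      have hW2 : Written G.N d Bs' t₂ := hW'.congr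
        (by rw [ht₂, den_reg (by decide), ht₁, den_reg (by decide)])
        (by rw [ht₂, den_arr (by decide), ht₁, den_arr (by decide)])
        (by rw [ht₂, den_reg (by decide), ht₁, den_reg (by decide)])
      have f3 : t₂.arr aZ = t₁.arr aZ := by rw [ht₂, den_arr (by decide)]
      have f4 : t₂.arr aW = t₁.arr aW := by rw [ht₂, den_arr (by decide)]
      rw [den_ite, den_skip]
      by_cases c : t₂.reg rR = 0
      · -- the vector fails the test: its box is written
        have hnt : ¬ G.Test k fr u (lo n) := fun hc => htest'.2 hc c
        rw [if_pos (show Ex.ev t₂ (.var rR) = 0 from c)]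
        have hbox : ∀ z, InBox d (t₂.arr aZ, t₂.arr aW) z ↔ InBox d (lo n, up n) z := fun z => by
          refine forall₂_congr fun j hj => ?_
          rw [f3, f4]
          dsimp only
          rw [(hdec j hj).1, (hdec j hj).2, hlo, hup]
        refine ⟨Bs' ++ [(t₂.arr aZ, t₂.arr aW)], ⟨?_, ?_, ?_, ?_⟩, ?_, ⟨?_, ?_⟩, ?_⟩
        · intro b hb j hj
          rcases List.mem_append.1 hb with hb | hb
          · exact h1.le b hb j hj
          · obtain rfl := List.mem_singleton.1 hb
            have := (hcell n j).1
            rw [f3, f4]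
            dsimp only
            rw [(hdec j hj).1, (hdec j hj).2]
            simpa [hlo, hup] using this
        · intro b hb j hj
          rcases List.mem_append.1 hb with hb | hb
          · exact h1.le_N b hb j hj
          · obtain rfl := List.mem_singleton.1 hb
            have := (hcell n j).2.1
            rw [f4]
            dsimp only
            rw [(hdec j hj).2]
            simpa [hup] using this
        · intro b hb z hz
          rcases List.mem_append.1 hb with hb | hb
          · exact h1.sound b hb z hz
          · obtain rfl := List.mem_singleton.1 hb
            exact ⟨u, huN, fun hc => hnt (hsame n _ _ ((hbox z).1 hz) (hself n) hc)⟩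
        · intro u' hu' z hz hnz
          obtain ⟨b, hb, hzb⟩ := h1.complete u' hu' z hz hnz
          exact ⟨b, List.mem_append_left _ hb, hzb⟩
        · rw [List.length_append, List.length_singleton]; omega
        · have := hW2.wrote.emit (M := M) (t := 0) (by rw [ht2.dim]; exact hMd)
          rw [ht2.dim, ← hd, List.append_assoc] at this
          rw [den_seq, List.flatMap_append, List.flatMap_singleton]
          exact this.congr (by simp) rfl
        · rw [den_seq, den_set]
          simp only [State.setReg_reg, if_true, Ex.ev_add, Ex.ev_var, Ex.ev_one]
          rw [den_reg (by decide), hW2.num, List.length_append, List.length_singleton]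
        · intro e he hne
          by_cases hen : e = n
          · subst hen
            exact ⟨_, List.mem_append_right _ (List.mem_singleton_self _), fun z => (hbox z).2⟩
          · obtain ⟨b, hb, hzb⟩ := h4 e (by omega) hne
            exact ⟨b, List.mem_append_left _ hb, hzb⟩
      · rw [if_neg (show ¬ Ex.ev t₂ (.var rR) = 0 from c)]
        refine ⟨Bs', h1, by omega, hW2, fun e he hne => ?_⟩
        by_cases hen : e = n
        · subst hen
          exact absurd (htest'.1 c) hne
        · exact h4 e (by omega) hne)
  refine ⟨Bs', ⟨h1.le, h1.le_N, h1.sound, fun u' hu' z hz hnz => ?_⟩, h2, h3⟩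
  by_cases huu : u' = u
  · subst huu
    choose! g hg1 hg2 using fun j (hj : j < d) => hc2 (z j) (hz j hj)
    obtain ⟨e, he, hdig⟩ := exists_digits hg1
    have hzbox : InBox d (lo e, up e) z := fun j hj => by
      simp only [hlo, hup]
      rw [hdig j hj]; exact hg2 j hj
    obtain ⟨b, hb, hzb⟩ := h4 e he fun hc => hnz (hsame e _ _ (hself e) hzbox hc)
    exact ⟨b, hb, hzb z hzbox⟩
  · exact h1.complete u' (by omega) z hz hnz

theorem den_domainP {M N d : ℕ} {s : State} (hN : s.reg rN = N) (hd : s.reg rDim = d) (hM : d ≤ M)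
    (hW : s.reg rW = 3) (h1 : s.reg rNum = 1) (h0 : ∀ i, 3 ≤ i → s.arr aOut i = 0) :
    Written N d [] (den M domainP s) := by
  unfold domainP
  rw [den_seq]
  set s₁ := den M (.rep rJ (.var rDim) (.put aZ (.var rJ) 0 ;; .put aW (.var rJ) (.var rN))) s
    with hs₁
  have hc : ∀ j < d, s₁.arr aZ j = 0 ∧ s₁.arr aW j = N := by
    rw [hs₁]
    refine den_rep (fun n s' => ∀ j < n, s'.arr aZ j = 0 ∧ s'.arr aW j = N) d hd hM (by simp) ?_
    intro n s' hn hr ha ih j hj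
    have e1 : s'.reg rN = N := (hr _ (by decide)).trans hN
    by_cases hjn : j = n
    · subst hjn; simp [e1]
    · have := ih j (by omega)
      simpa [hjn] using this
  have e0 : Wrote s₁ [] := by
    refine ⟨by rw [hs₁, den_reg (by decide)]; simpa using hW, fun i => ?_⟩
    rw [hs₁, den_arr (by decide), h0 _ (by omega)]; rfl
  have e1 : s₁.reg rDim = d := by rw [hs₁, den_reg (by decide), hd]
  have e2 : s₁.reg rNum = 1 := by rw [hs₁, den_reg (by decide), h1]
  clear_value s₁
  constructor
  · have := e0.emit (M := M) (t := 1) (by rw [e1]; exact hM)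
    rw [e1] at this
    have hb : boxWord d (s₁.arr aZ, s₁.arr aW) 1 = boxWord d (fun _ => 0, fun _ => N) 1 := by
      unfold boxWord
      congr 2
      refine List.map_congr_left fun j hj => ?_
      have := hc j (List.mem_range.1 hj)
      simp only [this.1, this.2]
    rw [hb] at this
    simpa using this
  · rw [den_reg (by decide), e2]; rfl

/-- The word that encodes the boxes `Bs` and the bounding box. -/
def instWord (d N : ℕ) (Bs : List ((ℕ → ℕ) × (ℕ → ℕ))) : List ℕ :=
  d :: (Bs.length + 1) :: 1 ::
    (boxWord d (fun _ => 0, fun _ => N) 1 ++ Bs.flatMap fun b => boxWord d b 0)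

/-- The program writes the word of an instance whose boxes cover, among the vectors with entries in
`{0, …, N}`, exactly those that fail some test. -/
theorem den_reduceP {M D k : ℕ} {G : Net} {f₂ : ℕ → ℕ} {s : State}
    (hs : Setting M D k G f₂ s) (h0 : ∀ i, 3 ≤ i → s.arr aOut i = 0) :
    ∃ fr Bs, G.IsFrontier (2 ^ (D + 1)) fr ∧ Boxes G k (k + 2 ^ (D + 1)) fr G.N Bs ∧
      Bs.length ≤ G.N * (2 ^ (D + 4)) ^ (k + 2 ^ (D + 1)) ∧
      (den M reduceP s).reg rOut = (instWord (k + 2 ^ (D + 1)) G.N Bs).length ∧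
      ∀ i, (den M reduceP s).arr aOut i = (instWord (k + 2 ^ (D + 1)) G.N Bs).getD i 0 := by
  obtain ⟨m1, m2, m3⟩ := hs.small
  have hMd := hs.dim_le
  have hM1 := hs.fits.1
  have hF := den_frontP hs.net hs.ok hs.fits hs.height hs.depth_le
  have hN : s.reg rN = G.N := by rw [← hs.net]; rfl
  unfold reduceP
  simp only [den_seq]
  set s₁ := den M frontP s with hs₁
  have hs1 : Setting M D k G f₂ s₁ := hs.den (by decide)
  have a1 : s₁.arr aOut = s.arr aOut := by rw [hs₁, den_arr (by decide)]
  clear_value s₁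
  have hT := den_totalP (M := M) (s := s₁) (by rw [hs1.dim]; exact hMd) (by rw [hs1.beta]; exact m1)
  rw [hs1.beta, hs1.dim] at hT
  set s₂ := den M totalP s₁ with hs₂
  have hs2 : Setting M D k G f₂ s₂ := hs1.den (by decide)
  have a2 : s₂.arr aOut = s.arr aOut := by rw [hs₂, den_arr (by decide), a1]
  have f2 : s₂.arr aFr = s₁.arr aFr := by rw [hs₂, den_arr (by decide)]
  clear_value s₂
  set s₃ := den M (.set rNum 1) (den M (.set rW 3) s₂) with hs₃
  have hs3 : Setting M D k G f₂ s₃ := by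
    rw [hs₃]; exact (hs2.den (by decide)).den (by decide)
  have a3 : s₃.arr aOut = s.arr aOut := by rw [hs₃, den_arr (by decide), den_arr (by decide), a2]
  have f3 : s₃.arr aFr = s₁.arr aFr := by rw [hs₃, den_arr (by decide), den_arr (by decide), f2]
  have t3 : s₃.reg rTot = (2 ^ (D + 4)) ^ (k + 2 ^ (D + 1)) := by
    rw [hs₃, den_reg (by decide), den_reg (by decide), hT]
  have w3 : s₃.reg rW = 3 := by rw [hs₃]; rfl
  have n3 : s₃.reg rNum = 1 := by rw [hs₃]; rfl
  have N3 : s₃.reg rN = G.N := by rw [← hs3.net]; rfl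
  clear_value s₃
  have hW := den_domainP N3 hs3.dim hMd w3 n3 fun i hi => by rw [a3, h0 i hi]
  set s₄ := den M domainP s₃ with hs₄
  have hs4 : Setting M D k G f₂ s₄ := hs3.den (by decide)
  have f4 : s₄.arr aFr = s₁.arr aFr := by rw [hs₄, den_arr (by decide), f3]
  have t4 : s₄.reg rTot = (2 ^ (D + 4)) ^ (k + 2 ^ (D + 1)) := by
    rw [hs₄, den_reg (by decide), t3]
  have N4 : s₄.reg rN = G.N := by rw [← hs4.net]; rfl
  clear_value s₄
  obtain ⟨Bs, hB, hl, hWr⟩ := den_rep (M := M) (x := rU) (e := .var rN) (p := gateBoxesP) (s := s₄)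
    (fun n s' => ∃ Bs, Boxes G k (k + 2 ^ (D + 1)) (s₁.arr aFr) n Bs ∧
      Bs.length ≤ n * (2 ^ (D + 4)) ^ (k + 2 ^ (D + 1)) ∧ Written G.N (k + 2 ^ (D + 1)) Bs s')
    G.N N4 (by omega)
    ⟨[], ⟨by simp, by simp, by simp, by simp⟩, by simp, hW⟩ (by
      rintro n s' hn hr ha ⟨Bs, hB, hl, hWr⟩
      have hs' : Setting M D k G f₂ (s'.setReg rU n) := by
        refine hs4.congr (fun r hmem => ?_) (fun a hmem => ?_)
        · rw [State.setReg_reg, if_neg (by revert r; decide)]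
          exact hr r (by revert r; decide)
        · exact ha a (by revert a; decide)
      obtain ⟨Bs', h1, h2, h3⟩ := den_gateBoxesP hs' (u := n) (by simp) hn
        ((ha aFr (by decide)).trans f4) hF
        (by rw [State.setReg_reg, if_neg (by decide), hr _ (by decide), t4]) hB
        (hWr.congr (by simp) rfl (by simp))
      refine ⟨Bs', h1, ?_, h3⟩
      rw [Nat.add_mul]; omega)
  set s₅ := den M (.rep rU (.var rN) gateBoxesP) s₄ with hs₅
  have hs5 : Setting M D k G f₂ s₅ := hs4.den (by decide)
  clear_value s₅
  refine ⟨s₁.arr aFr, Bs, hF, hB, hl, ?_, fun i => ?_⟩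
  · simp [hWr.wrote.1, instWord]; omega
  · have e3 := hWr.wrote.2
    simp only [den_put, den_set, State.setReg_arr, State.setArr_arr, if_true, Ex.ev_ofNat,
      Ex.ev_var, Function.update_apply, State.setArr_reg, hs5.dim, hWr.num]
    match i with
    | 0 => simp [instWord]
    | 1 => simp [instWord]
    | 2 => simp [instWord]
    | i + 3 =>
      have := e3 i
      rw [Nat.add_comm 3 i] at this
      simpa [instWord] using this

/-! ### Reading off the answer -/

/-- `min n ⌊(a - b) / c⌋` for `c ≠ 0` and `b ≤ a`. -/
def floorTo (a b c : ℕ) : ℕ → ℕ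
  | 0 => 0
  | n + 1 => if b + (n + 1) * c ≤ a then n + 1 else floorTo a b c n

theorem floorTo_le (a b c n : ℕ) : floorTo a b c n ≤ n := by
  induction n with
  | zero => exact le_rfl
  | succ n ih => rw [floorTo]; split_ifs <;> omega

theorem floorTo_spec {a b c : ℕ} (h : b ≤ a) (n : ℕ) :
    b + floorTo a b c n * c ≤ a ∧ ∀ m, floorTo a b c n < m → m ≤ n → a < b + m * c := by
  induction n with
  | zero => exact ⟨by simpa [floorTo] using h, fun m h1 h2 => by simp [floorTo] at h1; omega⟩
  | succ n ih =>
    rw [floorTo]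
    split_ifs with h1
    · exact ⟨h1, fun m h2 h3 => by omega⟩
    · refine ⟨ih.1, fun m h2 h3 => ?_⟩
      rcases Nat.lt_or_ge n m with h4 | h4
      · obtain rfl : m = n + 1 := by omega
        omega
      · exact ih.2 m h2 h4

/-- The rounded coordinates of the first point that is described by `y`. -/
def roundOff (N : ℕ) (y : ℕ → ℕ) (j : ℕ) : ℕ :=
  floorTo (y (j + j + j + 1)) (y (j + j + j + 2)) (y (j + j + j + 3)) N

/-- Compute the rounded coordinates. -/
def roundP : St :=
  .rep rJ (.var rK)
    (.set rA (.arr aOut (.var rJ + .var rJ + .var rJ + 1)) ;;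
      .set rB (.arr aOut (.var rJ + .var rJ + .var rJ + 2)) ;;
      .set rT (.arr aOut (.var rJ + .var rJ + .var rJ + 3)) ;;
      .put aZ (.var rJ) 0 ;;
      .rep rI (.var rN) (.set rB (.var rB + .var rT) ;;
        .ite (.var rB - .var rA) .skip (.put aZ (.var rJ) (.var rI + 1))))

/-- Check whether the first `k` entries of `aZ` form a solution. -/
def checkP : St :=
  countP ;; clearP aOv ;; evalP ;; .set rR (.arr aVal (.var rN - 1)) ;;
  rejectP (.arr aAs (.var rN)) ;;
  .rep rU (.var rN) (rejectP (.arr aAs (.var rU) - 1) ;;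
    .ite (.arr aAs (.var rU)) (rejectP (.arr aTyp (.var rU))) .skip)

/-- Decide whether the description in `aOut` yields a solution. -/
def answerP : St :=
  roundP ;; checkP ;; .ite (.var rR) (.put aIn 0 1) (.put aIn 0 0) ;; .set rLen 1

theorem den_roundP {M : ℕ} {s : State} (hN : s.reg rN ≤ M) (hK : s.reg rK ≤ M) :
    ∀ j < s.reg rK, (den M roundP s).arr aZ j = roundOff (s.reg rN) (s.arr aOut) j := by
  unfold roundP
  refine den_rep (fun n s' => ∀ j < n, s'.arr aZ j = roundOff (s.reg rN) (s.arr aOut) j)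
    (s.reg rK) rfl hK (by simp) ?_
  intro n s' hn hr ha ih
  have e1 : s'.arr aOut = s.arr aOut := ha _ (by decide)
  have e2 : s'.reg rN = s.reg rN := hr _ (by decide)
  simp only [den_seq]
  set t := den M (.put aZ (.var rJ) 0) (den M (.set rT (.arr aOut (.var rJ + .var rJ + .var rJ + 3)))
    (den M (.set rB (.arr aOut (.var rJ + .var rJ + .var rJ + 2)))
      (den M (.set rA (.arr aOut (.var rJ + .var rJ + .var rJ + 1))) (s'.setReg rJ n)))) with ht
  have t1 : t.reg rA = s.arr aOut (n + n + n + 1) := by simp [ht, e1]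
  have t2 : t.reg rB = s.arr aOut (n + n + n + 2) := by simp [ht, e1]
  have t3 : t.reg rT = s.arr aOut (n + n + n + 3) := by simp [ht, e1]
  have t4 : t.reg rJ = n := by simp [ht]
  have t5 : t.reg rN = s.reg rN := by simp [ht, e2]
  have t6 : ∀ j < n, t.arr aZ j = roundOff (s.reg rN) (s.arr aOut) j := fun j hj => by
    have : j ≠ n := by omega
    simpa [ht, this] using ih j hj
  have t7 : t.arr aZ n = 0 := by simp [ht]
  clear_value t
  have := den_rep (M := M) (x := rI) (e := .var rN) (p := .set rB (.var rB + .var rT) ;;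
        .ite (.var rB - .var rA) .skip (.put aZ (.var rJ) (.var rI + 1))) (s := t)
    (fun m s' => s'.reg rB = s.arr aOut (n + n + n + 2) + m * s.arr aOut (n + n + n + 3) ∧
      s'.arr aZ n = floorTo (s.arr aOut (n + n + n + 1)) (s.arr aOut (n + n + n + 2))
        (s.arr aOut (n + n + n + 3)) m ∧
      ∀ j < n, s'.arr aZ j = roundOff (s.reg rN) (s.arr aOut) j) (s.reg rN) t5 hN
    ⟨by simpa using t2, by simpa [floorTo] using t7, t6⟩ (by
      rintro m s'' hm hr' ha' ⟨h1, h2, h3⟩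
      have u1 : s''.reg rA = s.arr aOut (n + n + n + 1) := (hr' _ (by decide)).trans t1
      have u3 : s''.reg rT = s.arr aOut (n + n + n + 3) := (hr' _ (by decide)).trans t3
      have u4 : s''.reg rJ = n := (hr' _ (by decide)).trans t4
      rw [floorTo, Nat.add_mul m 1, ← Nat.add_assoc, one_mul]
      simp only [den_seq, den_set, den_ite, den_skip, den_put, Ex.ev_add, Ex.ev_sub, Ex.ev_var,
        Ex.ev_one, State.setReg_reg, if_true]
      norm_num only [if_true, if_false]
      rw [h1, u1, u3, u4]
      split_ifs with c1 c2 c2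
      · refine ⟨by simp, by simp, fun j hj => ?_⟩
        have : j ≠ n := by omega
        simpa [this] using h3 j hj
      · omega
      · omega
      · exact ⟨by simp, h2, h3⟩)
  intro j hj
  rcases Nat.lt_succ_iff_lt_or_eq.1 hj with hj | rfl
  · exact this.2.2 j hj
  · exact this.2.1

theorem _root_.Net.IsSol.congr {G : Net} {k : ℕ} {z z' : ℕ → ℕ} (h : ∀ j < k, z j = z' j)
    (hz : G.IsSol k z) : G.IsSol k z' := by
  have : Net.cnt k z = Net.cnt k z' := by
    funext i
    unfold Net.cnt
    congr 1
    exact Finset.filter_congr fun j hj => by rw [h j (Finset.mem_range.1 hj)]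
  exact ⟨this ▸ hz.cnt_le, this ▸ hz.typ_eq, fun j hj => h j hj ▸ hz.lt j hj, this ▸ hz.val_ne⟩

theorem den_checkP {M : ℕ} {s : State} {G : Net} (hG : netOf s = G) (h : G.Ok) (hM : Fits M G)
    (hK : s.reg rK ≤ M) (hz : ∀ j < s.reg rK, s.arr aZ j ≤ G.N) :
    (den M checkP s).reg rR ≠ 0 ↔ G.IsSol (s.reg rK) (s.arr aZ) := by
  have hN : s.reg rN = G.N := by rw [← hG]; rfl
  have hM1 := hM.1
  unfold checkP
  simp only [den_seq]
  have hc := den_countP (M := M) (s := s) (by rw [hN]; exact hM1) hK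
  rw [hN] at hc
  set k := s.reg rK
  set z := s.arr aZ
  set s₁ := den M countP s with hs₁
  have g1 : netOf s₁ = G := by rw [hs₁, netOf_den (by decide), hG]
  have N1 : s₁.reg rN = G.N := by rw [← g1]; rfl
  clear_value s₁
  have hcl := den_clearP (M := M) (a := aOv) (s := s₁) (by rw [N1]; exact hM1)
  rw [N1] at hcl
  set s₂ := den M (clearP aOv) s₁ with hs₂
  have g2 : netOf s₂ = G := by rw [hs₂, netOf_den (by decide), g1]
  have N2 : s₂.reg rN = G.N := by rw [← g2]; rfl
  have a2 : s₂.arr aAs = s₁.arr aAs := by rw [hs₂, den_arr (by decide)]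
  clear_value s₂
  have hev := den_evalP g2 h hM
  set s₃ := den M evalP s₂ with hs₃
  have g3 : netOf s₃ = G := by rw [hs₃, netOf_den (by decide), g2]
  have N3 : s₃.reg rN = G.N := by rw [← g3]; rfl
  have T3 : s₃.arr aTyp = G.typ := by rw [← g3]; rfl
  have a3 : ∀ i ≤ G.N, s₃.arr aAs i = Net.cnt k z i := fun i hi => by
    rw [hs₃, den_arr (by decide), a2, hc i hi]
  have hNp := h.pos
  have v3 : s₃.arr aVal (G.N - 1) = G.val (Net.cnt k z) (fun _ => 0) (G.N - 1) := by
    rw [hev _ (by omega)]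
    refine h.val_congr (fun i => i < G.N) (h.val_eq _ _) (h.val_eq _ _) (fun i hi _ => ?_) _
      (by omega) (by omega)
    refine ⟨hcl i hi.le, by rw [a2, hc i hi.le], fun _ j hj => (h.prd_lt i hi j hj).trans hi⟩
  clear_value s₃
  set s₄ := den M (rejectP (.arr aAs (.var rN))) (den M (.set rR (.arr aVal (.var rN - 1))) s₃)
    with hs₄
  have N4 : s₄.reg rN = G.N := by rw [hs₄, den_reg (by decide), den_reg (by decide), N3]
  have T4 : s₄.arr aTyp = G.typ := by rw [hs₄, den_arr (by decide), den_arr (by decide), T3]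
  have a4 : ∀ i ≤ G.N, s₄.arr aAs i = Net.cnt k z i := fun i hi => by
    rw [hs₄, den_arr (by decide), den_arr (by decide), a3 i hi]
  have r4 : s₄.reg rR ≠ 0 ↔ G.val (Net.cnt k z) (fun _ => 0) (G.N - 1) ≠ 0 ∧
      Net.cnt k z G.N = 0 := by
    rw [hs₄, den_rejectP]
    simp [N3, v3, a3]
  clear_value s₄
  have := den_rep (M := M) (x := rU) (e := .var rN) (p := rejectP (.arr aAs (.var rU) - 1) ;;
    .ite (.arr aAs (.var rU)) (rejectP (.arr aTyp (.var rU))) .skip) (s := s₄)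
    (fun n s' => s'.reg rR ≠ 0 ↔ s₄.reg rR ≠ 0 ∧ ∀ u < n, Net.cnt k z u ≤ 1 ∧
      (Net.cnt k z u ≠ 0 → G.typ u = 0)) G.N N4 (by omega) (by simp) (by
      intro n s' hn hr ha ih
      have b1 : s'.arr aAs n = Net.cnt k z n := by rw [ha _ (by decide), a4 n hn.le]
      have b2 : s'.arr aTyp n = G.typ n := by rw [ha _ (by decide), T4]
      rw [den_seq, den_ite]
      set t := s'.setReg rU n with ht
      have t1 := den_rejectP (M := M) (e := .arr aAs (.var rU) - 1) (s := t)
      set t' := den M (rejectP (.arr aAs (.var rU) - 1)) t with ht'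
      have u1 : t'.reg rU = n := by rw [ht', den_reg (by decide), ht]; simp
      have u2 : t'.arr aAs n = Net.cnt k z n := by rw [ht', den_arr (by decide), ht]; exact b1
      have u3 : t'.arr aTyp n = G.typ n := by rw [ht', den_arr (by decide), ht]; exact b2
      have u4 : t'.reg rR ≠ 0 ↔ (s₄.reg rR ≠ 0 ∧ ∀ u < n, Net.cnt k z u ≤ 1 ∧
          (Net.cnt k z u ≠ 0 → G.typ u = 0)) ∧ Net.cnt k z n ≤ 1 := by
        rw [t1, ← ih]
        simp [ht, b1, Nat.sub_eq_zero_iff_le]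
      clear_value t'
      have u5 : (∀ u < n + 1, Net.cnt k z u ≤ 1 ∧ (Net.cnt k z u ≠ 0 → G.typ u = 0)) ↔
          (∀ u < n, Net.cnt k z u ≤ 1 ∧ (Net.cnt k z u ≠ 0 → G.typ u = 0)) ∧
          Net.cnt k z n ≤ 1 ∧ (Net.cnt k z n ≠ 0 → G.typ n = 0) := by
        simp only [Nat.lt_succ_iff_lt_or_eq, or_imp, forall_and, forall_eq]
        tauto
      rw [u5]
      split_ifs with c
      · simp only [Ex.ev_arr, Ex.ev_var, u1, u2] at c
        rw [den_skip, u4, c]; simp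
      · simp only [Ex.ev_arr, Ex.ev_var, u1, u2] at c
        rw [den_rejectP, u4]
        simp only [Ex.ev_arr, Ex.ev_var, u1, u3, ne_eq, c, not_false_eq_true, true_imp_iff,
          and_assoc])
  rw [this, r4]
  constructor
  · rintro ⟨⟨h1, h2⟩, h3⟩
    refine ⟨fun i hi => (h3 i hi).1, fun i hi => (h3 i hi).2, fun j hj => ?_, h1⟩
    rcases (hz j hj).lt_or_eq with h4 | h4
    · exact h4
    · exact absurd h2 (Net.cnt_ne_zero.2 ⟨j, hj, h4⟩)
  · intro hS
    refine ⟨⟨hS.val_ne, ?_⟩, fun u hu => ⟨hS.cnt_le u hu, hS.typ_eq u hu⟩⟩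
    by_contra hc
    obtain ⟨j, hj, e⟩ := Net.cnt_ne_zero.1 hc
    have := hS.lt j hj
    omega

open scoped Classical in
theorem den_answerP {M : ℕ} {s : State} {G : Net} (hG : netOf s = G) (h : G.Ok) (hM : Fits M G)
    (hK : s.reg rK ≤ M) :
    (den M answerP s).reg rLen = 1 ∧ (den M answerP s).arr aIn 0 =
      if G.IsSol (s.reg rK) (roundOff G.N (s.arr aOut)) then 1 else 0 := by
  have hN : s.reg rN = G.N := by rw [← hG]; rfl
  have hM1 := hM.1
  have hr := den_roundP (M := M) (s := s) (by omega) hK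
  rw [hN] at hr
  unfold answerP
  simp only [den_seq]
  set s₁ := den M roundP s with hs₁
  have g1 : netOf s₁ = G := by rw [hs₁, netOf_den (by decide), hG]
  have k1 : s₁.reg rK = s.reg rK := by rw [hs₁, den_reg (by decide)]
  clear_value s₁
  have hc := den_checkP g1 h hM (by rw [k1]; exact hK) (fun j hj => by
    rw [k1] at hj; rw [hr j hj]; exact floorTo_le _ _ _ _)
  rw [k1] at hc
  have hiff : G.IsSol (s.reg rK) (s₁.arr aZ) ↔ G.IsSol (s.reg rK) (roundOff G.N (s.arr aOut)) :=
    ⟨.congr hr, .congr fun j hj => (hr j hj).symm⟩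
  rw [hiff] at hc
  set s₂ := den M checkP s₁
  clear_value s₂
  refine ⟨by simp, ?_⟩
  rw [den_set, State.setReg_arr, den_ite]
  by_cases c : s₂.reg rR = 0
  · rw [if_pos (show Ex.ev s₂ (.var rR) = 0 from c), if_neg fun h' => hc.2 h' c]
    simp
  · rw [if_neg (show ¬ Ex.ev s₂ (.var rR) = 0 from c), if_pos (hc.1 c)]
    simp

theorem roundOff_le (N : ℕ) (y : ℕ → ℕ) (j : ℕ) : roundOff N y j ≤ N := floorTo_le _ _ _ _

/-- A coordinate lies in the unit cell of its rounded value; the coordinate `N + 1` is rounded to `N`,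
so that it belongs to the last cell. -/
theorem roundOff_spec {N j : ℕ} {y : ℕ → ℕ} {x : ℝ} (h0 : y (3 * j + 3) ≠ 0)
    (hx : x = ((y (3 * j + 1) : ℝ) - (y (3 * j + 2) : ℝ)) / (y (3 * j + 3) : ℝ)) (h1 : 0 ≤ x)
    (h2 : x ≤ N + 1) : (roundOff N y j : ℝ) ≤ x ∧ x ≤ roundOff N y j + 1 := by
  have e : j + j + j = 3 * j := by ring
  unfold roundOff
  rw [e]
  have hc : (0 : ℝ) < y (3 * j + 3) := by exact_mod_cast Nat.pos_of_ne_zero h0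
  rw [eq_div_iff hc.ne'] at hx
  have hab : y (3 * j + 2) ≤ y (3 * j + 1) := by
    have : (0 : ℝ) ≤ x * y (3 * j + 3) := by positivity
    have h : (y (3 * j + 2) : ℝ) ≤ y (3 * j + 1) := by linarith
    exact_mod_cast h
  obtain ⟨f1, f2⟩ := floorTo_spec (c := y (3 * j + 3)) hab N
  have f3 := floorTo_le (y (3 * j + 1)) (y (3 * j + 2)) (y (3 * j + 3)) N
  set r := floorTo (y (3 * j + 1)) (y (3 * j + 2)) (y (3 * j + 3)) N
  constructor
  · have h : (y (3 * j + 2) : ℝ) + r * y (3 * j + 3) ≤ y (3 * j + 1) := by exact_mod_cast f1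
    refine le_of_mul_le_mul_right ?_ hc
    linarith
  · rcases f3.lt_or_eq with h | h
    · have h3 : (y (3 * j + 1) : ℝ) < y (3 * j + 2) + (r + 1) * y (3 * j + 3) := by
        exact_mod_cast f2 (r + 1) (by omega) (by omega)
      refine le_of_mul_le_mul_right ?_ hc
      linarith
    · rw [h]; exact h2

/-- If there is a solution, then the least error is zero, so every approximately optimal
distribution has error zero, and its first point is rounded to a solution. -/
theorem Boxes.isSol_roundOff {G : Net} (hG : G.Ok) {k Q n : ℕ} {fr : ℕ → ℕ}
    (hF : G.IsFrontier Q fr) {Bs : List ((ℕ → ℕ) × (ℕ → ℕ))} (hB : Boxes G k (k + Q) fr G.N Bs)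
    {p : ENNReal} (hp : 1 ≤ p) {y : List ℕ} {μ : DiscreteDist (k + Q)} (hy : Describes y μ)
    (hμ : empErr p μ (boxInstance (k + Q) G.N Bs) ≤
      (n : ℝ) * optErr p 1 (boxInstance (k + Q) G.N Bs)) (hS : ∃ z, G.IsSol k z) :
    G.IsSol k (roundOff G.N fun i => y.getD i 0) := by
  obtain ⟨z₀, hz₀⟩ := hS
  obtain ⟨z, hz1, hz2⟩ := hF.exists_test hG hz₀
  obtain ⟨x, hx, hxy⟩ := hy.exists_point
  obtain ⟨h1, h2⟩ := mem_supp_of_empErr_le hp hB.le ⟨z, hz1, fun b hb hzb => by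
    obtain ⟨u, hu, hn⟩ := hB.sound b hb z hzb
    exact hn (hz2 u hu)⟩ hμ x hx
  have hr : ∀ j : Fin (k + Q), (roundOff G.N (fun i => y.getD i 0) j : ℝ) ≤ x j ∧
      x j ≤ roundOff G.N (fun i => y.getD i 0) j + 1 := fun j =>
    roundOff_spec (y := fun i => y.getD i 0) (hxy j).1 (hxy j).2 (h1 j).1 (h1 j).2
  refine hF.isSol hG (fun j _ => roundOff_le _ _ _) fun u hu => ?_
  by_contra hc
  obtain ⟨b, hb, hzb⟩ := hB.complete u hu _ (fun j _ => roundOff_le _ _ _) hc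
  refine h2 b hb fun j => ⟨le_trans ?_ (hr j).1, (hr j).2.trans ?_⟩
  · exact_mod_cast (hzb j j.2).1
  · have : (roundOff G.N (fun i => y.getD i 0) j : ℝ) ≤ b.2 j := by exact_mod_cast (hzb j j.2).2
    linarith

/-! ### Parsing circuits -/

/-- The entries `a, a + 1, …, b - 1` of a sequence. -/
def segment (w : ℕ → ℕ) (a b : ℕ) : List ℕ := (List.range' a (b - a)).map w

theorem segment_append {w : ℕ → ℕ} {a b c : ℕ} (h1 : a ≤ b) (h2 : b ≤ c) :
    segment w a b ++ segment w b c = segment w a c := by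
  unfold segment
  rw [← List.map_append]
  congr 1
  have := List.range'_append_1 (s := a) (m := b - a) (n := c - b)
  rw [show a + (b - a) = b by omega, show b - a + (c - b) = c - a by omega] at this
  exact this

theorem segment_eq_cons {w : ℕ → ℕ} {a b x : ℕ} {l : List ℕ} :
    segment w a b = x :: l ↔ a < b ∧ w a = x ∧ segment w (a + 1) b = l := by
  unfold segment
  rcases Nat.lt_or_ge a b with h | h
  · rw [show b - a = b - (a + 1) + 1 by omega, List.range'_succ]
    simp [h]
  · rw [show b - a = 0 by omega]
    simp; omega

theorem length_segment {w : ℕ → ℕ} {a b : ℕ} : (segment w a b).length = b - a := by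
  simp [segment]

theorem segment_eq_append {w : ℕ → ℕ} {a b : ℕ} {l l' : List ℕ} (h : segment w a b = l ++ l') :
    a + l.length ≤ max a b ∧ segment w (a + l.length) b = l' := by
  induction l generalizing a with
  | nil => simpa using h
  | cons x l ih =>
    rw [List.cons_append, segment_eq_cons] at h
    obtain ⟨h1, -, h2⟩ := h
    obtain ⟨h3, h4⟩ := ih h2
    rw [List.length_cons, show a + (l.length + 1) = a + 1 + l.length by omega]
    exact ⟨by omega, h4⟩

theorem segment_add (w : ℕ → ℕ) (a n : ℕ) :
    segment w a (a + n) = (List.range n).map fun j => w (a + j) := by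
  rw [segment, Nat.add_sub_cancel_left, List.range'_eq_map_range, List.map_map]
  rfl

/-- The number of in-neighbours of the gate that is encoded at position `P`. -/
def degAt (w : ℕ → ℕ) (P : ℕ) : ℕ := if w P ≤ 1 then w P else w (P + 1)

/-- The position of the first in-neighbour of the gate that is encoded at position `P`. -/
def offAt (w : ℕ → ℕ) (P : ℕ) : ℕ := if w P ≤ 1 then P + 1 else P + 2

/-- The position behind the gate that is encoded at position `P`. -/
def nextPos (w : ℕ → ℕ) (P : ℕ) : ℕ := offAt w P + degAt w P

/-- A gate with an admissible indegree is encoded at position `P`. -/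
def GoodAt (w : ℕ → ℕ) (P : ℕ) : Prop := w P ≤ 3 ∧ (2 ≤ w P → 2 ≤ w (P + 1))

theorem lt_nextPos (w : ℕ → ℕ) (P : ℕ) : P < nextPos w P := by
  unfold nextPos offAt; split_ifs <;> omega

/-- The parser accepts every circuit. -/
theorem iterate_nextPos_of_encode {w : ℕ → ℕ} {b : ℕ} {C : Circuit} (hC : ∀ g ∈ C, g.FanInOk)
    {a : ℕ} (hab : a ≤ b) (h : C.encode = segment w a b) :
    (nextPos w)^[C.length] a = b ∧ ∀ i < C.length, GoodAt w ((nextPos w)^[i] a) := by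
  induction C generalizing a with
  | nil =>
    have := congrArg List.length h
    rw [length_segment] at this
    simp [Circuit.encode] at this
    exact ⟨by simp; omega, by simp⟩
  | cons g C ih =>
    have key : GoodAt w a ∧ nextPos w a ≤ b ∧ Circuit.encode C = segment w (nextPos w a) b := by
      have hg := hC g (by simp)
      have h' : segment w a b = g.encode ++ Circuit.encode C := h.symm
      cases g with
      | input =>
        simp only [Gate.encode, List.cons_append, List.nil_append, segment_eq_cons] at h'
        obtain ⟨h1, h2, h3⟩ := h'
        simp [GoodAt, nextPos, offAt, degAt, h2, ← h3]; omega
      | not u =>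
        simp only [Gate.encode, List.cons_append, List.nil_append, segment_eq_cons] at h'
        obtain ⟨h1, h2, h3, h4, h5⟩ := h'
        simp [GoodAt, nextPos, offAt, degAt, h2, ← h5]; omega
      | and us =>
        simp only [Gate.encode, List.cons_append, segment_eq_cons] at h'
        obtain ⟨h1, h2, h3, h4, h5⟩ := h'
        obtain ⟨h6, h7⟩ := segment_eq_append h5
        simp only [Gate.FanInOk] at hg
        simp [GoodAt, nextPos, offAt, degAt, h2, h4, hg]
        exact ⟨by omega, h7.symm⟩
      | or us =>
        simp only [Gate.encode, List.cons_append, segment_eq_cons] at h'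
        obtain ⟨h1, h2, h3, h4, h5⟩ := h'
        obtain ⟨h6, h7⟩ := segment_eq_append h5
        simp only [Gate.FanInOk] at hg
        simp [GoodAt, nextPos, offAt, degAt, h2, h4, hg]
        exact ⟨by omega, h7.symm⟩
    obtain ⟨h1, h2, h3⟩ := key
    obtain ⟨h4, h5⟩ := ih (fun g hg => hC g (by simp [hg])) h2 h3
    refine ⟨by rw [List.length_cons, Function.iterate_succ_apply, h4], fun i hi => ?_⟩
    match i with
    | 0 => exact h1
    | i + 1 =>
      rw [Function.iterate_succ_apply]
      exact h5 i (by simpa using hi)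

/-- Circuits are determined by their encodings. -/
theorem _root_.Circuit.encode_injective : Function.Injective Circuit.encode := by
  intro C
  induction C with
  | nil =>
    intro C' h
    cases C' with
    | nil => rfl
    | cons g C' => cases g <;> simp [Circuit.encode, Gate.encode] at h
  | cons g C ih =>
    intro C' h
    cases C' with
    | nil => cases g <;> simp [Circuit.encode, Gate.encode] at h
    | cons g' C' =>
      have h' : g.encode ++ Circuit.encode C = g'.encode ++ Circuit.encode C' := h
      cases g <;> cases g' <;> simp [Gate.encode] at h' ⊢
      · exact ih h'
      · exact ⟨h'.1, ih h'.2⟩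
      · obtain ⟨h1, h2⟩ := List.append_inj h'.2 h'.1
        exact ⟨h1, ih h2⟩
      · obtain ⟨h1, h2⟩ := List.append_inj h'.2 h'.1
        exact ⟨h1, ih h2⟩

/-- The gates `G` are those that the parser finds in `w` from position `a` on. -/
structure ParsedFrom (w : ℕ → ℕ) (a : ℕ) (G : Net) : Prop where
  typ : ∀ i < G.N, G.typ i = w ((nextPos w)^[i] a)
  deg : ∀ i < G.N, G.deg i = degAt w ((nextPos w)^[i] a)
  prd : ∀ i < G.N, ∀ j, G.prd i j = w (offAt w ((nextPos w)^[i] a) + j)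

theorem ParsedFrom.encode_gate {w : ℕ → ℕ} {a : ℕ} {G : Net} (h : ParsedFrom w a G) {i : ℕ}
    (hi : i < G.N) (hg : GoodAt w ((nextPos w)^[i] a)) :
    (G.gate i).encode = segment w ((nextPos w)^[i] a) ((nextPos w)^[i + 1] a) := by
  have h1 := h.typ i hi
  have h2 := h.deg i hi
  have h3 := h.prd i hi
  rw [Function.iterate_succ_apply']
  set P := (nextPos w)^[i] a
  unfold Net.gate nextPos
  unfold offAt degAt at *
  obtain ⟨g1, g2⟩ := hg
  rw [← h1] at g1
  symm
  by_cases t0 : G.typ i = 0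
  · have e : w P = 0 := by omega
    rw [if_pos t0]
    simp [e, Gate.encode, segment_eq_cons]
    simp [segment]
  by_cases t1 : G.typ i = 1
  · have e : w P = 1 := by omega
    rw [if_neg t0, if_pos t1]
    simp [e, Gate.encode, segment_eq_cons, h3]
    simp [segment]
  have e : ¬ w P ≤ 1 := by omega
  have hs := segment_add w (P + 2) (w (P + 1))
  simp only [if_neg e] at h2 h3 ⊢
  have hd : (List.map (G.prd i) (List.range (G.deg i))) = segment w (P + 2) (P + 2 + w (P + 1)) := by
    rw [hs, h2]; exact List.map_congr_left fun j _ => h3 j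
  by_cases t2 : G.typ i = 2
  · rw [if_neg t0, if_neg t1, if_pos t2]
    simp only [Gate.encode, segment_eq_cons, hd, length_segment]
    refine ⟨by omega, by omega, by omega, by omega, trivial⟩
  · rw [if_neg t0, if_neg t1, if_neg t2]
    simp only [Gate.encode, segment_eq_cons, hd, length_segment]
    refine ⟨by omega, by omega, by omega, by omega, trivial⟩

theorem iterate_nextPos_mono (w : ℕ → ℕ) (a : ℕ) : StrictMono fun i => (nextPos w)^[i] a :=
  strictMono_nat_of_lt_succ fun i => by
    rw [Function.iterate_succ_apply']; exact lt_nextPos w _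

theorem ParsedFrom.encode_circuit {w : ℕ → ℕ} {a : ℕ} {G : Net} (h : ParsedFrom w a G)
    (hg : ∀ i < G.N, GoodAt w ((nextPos w)^[i] a)) :
    G.circuit.encode = segment w a ((nextPos w)^[G.N] a) := by
  have key : ∀ n ≤ G.N, ((List.range n).map G.gate).flatMap Gate.encode =
      segment w a ((nextPos w)^[n] a) := by
    intro n
    induction n with
    | zero => intro _; simp [segment]
    | succ n ih =>
      intro hn
      have hm := (iterate_nextPos_mono w a).monotone
      rw [List.range_succ, List.map_append, List.flatMap_append, ih (by omega), List.map_singleton,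
        List.flatMap_singleton, h.encode_gate (by omega) (hg n (by omega))]
      exact segment_append (hm (Nat.zero_le n)) (hm (Nat.le_succ n))
  exact key _ le_rfl

theorem ParsedFrom.ok {w : ℕ → ℕ} {a : ℕ} {G : Net} (h : ParsedFrom w a G)
    (hg : ∀ i < G.N, GoodAt w ((nextPos w)^[i] a)) (h0 : 0 < G.N)
    (hp : ∀ i < G.N, ∀ j < G.deg i, G.prd i j < i) : G.Ok where
  pos := h0
  typ_le i hi := by rw [h.typ i hi]; exact (hg i hi).1
  deg_input i hi ht := by
    rw [h.typ i hi] at ht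
    rw [h.deg i hi, degAt, if_pos (by omega), ht]
  deg_not i hi ht := by
    rw [h.typ i hi] at ht
    rw [h.deg i hi, degAt, if_pos (by omega), ht]
  deg_big i hi ht := by
    rw [h.typ i hi] at ht
    rw [h.deg i hi, degAt, if_neg (by omega)]
    exact (hg i hi).2 ht
  prd_lt := hp

theorem ParsedFrom.deg_le {w : ℕ → ℕ} {a : ℕ} {G : Net} (h : ParsedFrom w a G) {i : ℕ}
    (hi : i < G.N) : G.deg i ≤ (nextPos w)^[G.N] a := by
  have := (iterate_nextPos_mono w a).monotone (show i + 1 ≤ G.N by omega)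
  simp only [Function.iterate_succ_apply'] at this
  rw [h.deg i hi]
  exact le_trans (by unfold nextPos; omega) this

/-- Read the gate at position `rP` as gate number `rN`. -/
def readGateP : St :=
  .put aTyp (.var rN) (.arr aIn (.var rP)) ;;
  .ite (.arr aIn (.var rP) - 1)
    (.put aDeg (.var rN) (.arr aIn (.var rP + 1)) ;; .put aOff (.var rN) (.var rP + 2) ;;
      .ite (2 - .arr aIn (.var rP + 1)) (.set rOk 0) .skip)
    (.put aDeg (.var rN) (.arr aIn (.var rP)) ;; .put aOff (.var rN) (.var rP + 1)) ;;
  .ite (.arr aIn (.var rP) - 3) (.set rOk 0) .skip ;;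
  .set rP (.arr aOff (.var rN) + .arr aDeg (.var rN)) ;; .set rN (.var rN + 1)

/-- Read the circuit. -/
def readP : St :=
  .set rP 1 ;; .set rN 0 ;; .set rOk 1 ;;
  .rep rU (.var rLen) (.ite (.var rLen - .var rP) readGateP .skip) ;;
  .ite (Ex.ne (.var rP) (.var rLen)) (.set rOk 0) .skip ;;
  .ite (.var rN) .skip (.set rOk 0)

/-- Check that the circuit is in topological order, and compute the heights. -/
def heightP : St :=
  .rep rI (.var rN)
    (.set rA 0 ;; .set rB 0 ;;
      .rep rJ (.arr aDeg (.var rI))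
        (.set rT (.arr aIn (.arr aOff (.var rI) + .var rJ)) ;;
          .ite (.var rI - .var rT) .skip (.set rOk 0) ;;
          .set rA (.var rA + (.arr aHt (.var rT) - .var rA)) ;;
          .set rB (.var rB + (.arr aWt (.var rT) - .var rB))) ;;
      .put aHt (.var rI) (.var rA + 1) ;;
      .ite (.arr aDeg (.var rI) - 2) (.put aWt (.var rI) (.var rB + 1))
        (.put aWt (.var rI) (.var rB)))

/-- Read the circuit, and check that it is valid and has admissible depth and weft. -/
def parseP : St :=
  readP ;;
  .ite (.var rOk)
    (heightP ;;
      .ite (.arr aHt (.var rN - 1) - (.var rD + 1)) (.set rOk 0) .skip ;;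
      .ite (.arr aWt (.var rN - 1) - 1) (.set rOk 0) .skip)
    .skip

theorem den_readGateP {M : ℕ} (s : State) :
    let s' := den M readGateP s
    let w := s.arr aIn
    s'.reg rN = s.reg rN + 1 ∧ s'.reg rP = nextPos w (s.reg rP) ∧
    s'.arr aTyp = Function.update (s.arr aTyp) (s.reg rN) (w (s.reg rP)) ∧
    s'.arr aDeg = Function.update (s.arr aDeg) (s.reg rN) (degAt w (s.reg rP)) ∧
    s'.arr aOff = Function.update (s.arr aOff) (s.reg rN) (offAt w (s.reg rP)) ∧
    (s'.reg rOk ≠ 0 ↔ s.reg rOk ≠ 0 ∧ GoodAt w (s.reg rP)) := by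
  intro s' w
  by_cases h1 : s.arr aIn (s.reg rP) ≤ 1
  · have e1 : s.arr aIn (s.reg rP) - 1 = 0 := by omega
    have e3 : s.arr aIn (s.reg rP) - 3 = 0 := by omega
    have e4 : GoodAt w (s.reg rP) := ⟨by simp only [w]; omega, fun h => by simp only [w] at h; omega⟩
    simp only [and_iff_left e4]
    simp [s', w, readGateP, nextPos, degAt, offAt, h1, e1, e3]
  · have e1 : s.arr aIn (s.reg rP) - 1 ≠ 0 := by omega
    have e4 : GoodAt w (s.reg rP) ↔ s.arr aIn (s.reg rP) - 3 = 0 ∧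
        2 - s.arr aIn (s.reg rP + 1) = 0 := by
      simp only [GoodAt, w]; omega
    rw [e4]
    by_cases e2 : 2 - s.arr aIn (s.reg rP + 1) = 0 <;>
      by_cases e3 : s.arr aIn (s.reg rP) - 3 = 0 <;>
      simp [s', w, readGateP, nextPos, degAt, offAt, h1, e1, e2, e3]

theorem den_readP {M : ℕ} {s : State} (hM : s.reg rLen ≤ M) :
    ParsedFrom (s.arr aIn) 1 (netOf (den M readP s)) ∧
    (∀ i < (den M readP s).reg rN, (nextPos (s.arr aIn))^[i] 1 < s.reg rLen) ∧
    ((den M readP s).reg rOk ≠ 0 ↔ (∀ i < (den M readP s).reg rN,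
      GoodAt (s.arr aIn) ((nextPos (s.arr aIn))^[i] 1)) ∧
      (nextPos (s.arr aIn))^[(den M readP s).reg rN] 1 = s.reg rLen ∧
      (den M readP s).reg rN ≠ 0) ∧
    s.reg rLen ≤ (nextPos (s.arr aIn))^[(den M readP s).reg rN] 1 := by
  unfold readP
  simp only [den_seq]
  set w := s.arr aIn
  set L := s.reg rLen
  set pos := fun i => (nextPos w)^[i] 1 with hpos
  set s₁ := den M (.set rOk 1) (den M (.set rN 0) (den M (.set rP 1) s)) with hs₁
  have key := den_rep (M := M) (x := rU) (e := .var rLen)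
    (p := .ite (.var rLen - .var rP) readGateP .skip) (s := s₁)
    (fun n s' => s'.reg rP = pos (s'.reg rN) ∧
      (∀ i < s'.reg rN, s'.arr aTyp i = w (pos i) ∧ s'.arr aDeg i = degAt w (pos i) ∧
        s'.arr aOff i = offAt w (pos i)) ∧ (∀ i < s'.reg rN, pos i < L) ∧
      (s'.reg rOk ≠ 0 ↔ ∀ i < s'.reg rN, GoodAt w (pos i)) ∧ (n ≤ s'.reg rN ∨ L ≤ s'.reg rP)) L
    (by simp [hs₁, L]) hM (by simp [hs₁, hpos]) (by
      rintro n s' hn hr ha ⟨h1, h2, h3, h4, h5⟩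
      have e1 : s'.reg rLen = L := (hr _ (by decide)).trans (by simp [hs₁, L])
      have e2 : s'.arr aIn = w := ha _ (by decide)
      rw [den_ite]
      have hc : Ex.ev (s'.setReg rU n) (.var rLen - .var rP) = L - s'.reg rP := by simp [e1]
      rw [hc]
      split_ifs with c
      · refine ⟨h1, h2, h3, h4, .inr ?_⟩
        show L ≤ s'.reg rP
        omega
      · obtain ⟨g1, g2, g3, g4, g5, g6⟩ := den_readGateP (M := M) (s'.setReg rU n)
        set t := den M readGateP (s'.setReg rU n)
        have k1 : (s'.setReg rU n).reg rN = s'.reg rN := by simp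
        have k2 : (s'.setReg rU n).reg rP = s'.reg rP := by simp
        have k3 : (s'.setReg rU n).reg rOk = s'.reg rOk := by simp
        simp only [State.setReg_arr, e2, k1, k2, k3] at g1 g2 g3 g4 g5 g6
        have hlt : ∀ i < s'.reg rN + 1, i ≠ s'.reg rN → i < s'.reg rN := fun i _ _ => by omega
        rw [g1, g2, g3, g4, g5, g6, h1]
        refine ⟨?_, fun i hi => ?_, fun i hi => ?_, ?_, ?_⟩
        · simp only [hpos, Function.iterate_succ_apply']
        · by_cases hin : i = s'.reg rN
          · subst hin; simp
          · simp only [Function.update_of_ne hin]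
            exact h2 i (hlt i hi hin)
        · by_cases hin : i = s'.reg rN
          · subst hin; rw [← h1]; omega
          · exact h3 i (hlt i hi hin)
        · rw [h4, Nat.forall_lt_succ_right]
        · left
          rcases h5 with h5 | h5 <;> omega)
  set s₂ := den M (.rep rU (.var rLen) (.ite (.var rLen - .var rP) readGateP .skip)) s₁ with hs₂
  have L2 : s₂.reg rLen = L := by rw [hs₂, den_reg (by decide)]; simp [hs₁, L]
  have w2 : s₂.arr aIn = w := by rw [hs₂, den_arr (by decide)]; rfl
  clear_value s₂
  obtain ⟨h1, h2, h3, h4, h5⟩ := key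
  set s₃ := den M (.ite (.var rN) .skip (.set rOk 0))
    (den M (.ite (Ex.ne (.var rP) (.var rLen)) (.set rOk 0) .skip) s₂) with hs₃
  have N3 : s₃.reg rN = s₂.reg rN := by rw [hs₃, den_reg (by decide), den_reg (by decide)]
  have hnet : netOf s₃ = netOf s₂ := by rw [hs₃, netOf_den (by decide), netOf_den (by decide)]
  have hge : L ≤ pos (s₂.reg rN) := by
    rcases h5 with h5 | h5
    · have := (iterate_nextPos_mono w 1).id_le (s₂.reg rN)
      exact h5.trans this
    · rwa [← h1]
  rw [hnet, N3]
  refine ⟨⟨fun i hi => (h2 i hi).1, fun i hi => (h2 i hi).2.1, fun i hi j => ?_⟩, h3, ?_, hge⟩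
  · show s₂.arr aIn (s₂.arr aOff i + j) = _
    rw [w2, (h2 i hi).2.2]
  · have e1 : Ex.ev s₂ (Ex.ne (.var rP) (.var rLen)) = 0 ↔ pos (s₂.reg rN) = L := by
      rw [Ex.ev_ne_eq_zero, Ex.ev_var, Ex.ev_var, h1, L2]
    change _ ↔ (∀ i < s₂.reg rN, GoodAt w (pos i)) ∧ pos (s₂.reg rN) = L ∧ s₂.reg rN ≠ 0
    rw [← h4, hs₃]
    clear_value pos
    by_cases c1 : pos (s₂.reg rN) = L
    · have c1' := e1.2 c1
      by_cases c2 : s₂.reg rN = 0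
      · simp [c1', c2]
      · simp [c1', c2, c1]
    · have c1' : ¬ Ex.ev s₂ (Ex.ne (.var rP) (.var rLen)) = 0 := fun h => c1 (e1.1 h)
      by_cases c2 : s₂.reg rN = 0
      · simp [c1', c2]
      · simp [c1', c2, c1]

theorem den_heightP {M : ℕ} {s : State} {G : Net} (hG : netOf s = G) (hM : Fits M G) :
    ((den M heightP s).reg rOk ≠ 0 ↔
      s.reg rOk ≠ 0 ∧ ∀ i < G.N, ∀ j < G.deg i, G.prd i j < i) ∧
    ((∀ i < G.N, ∀ j < G.deg i, G.prd i j < i) →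
      G.IsHeight (fun _ => 1) ((den M heightP s).arr aHt) ∧
      G.IsHeight G.large ((den M heightP s).arr aWt)) := by
  have hN : s.reg rN = G.N := by rw [← hG]; rfl
  have hM1 := hM.1
  unfold heightP
  set p := (.set rA 0 ;; .set rB 0 ;;
      .rep rJ (.arr aDeg (.var rI))
        (.set rT (.arr aIn (.arr aOff (.var rI) + .var rJ)) ;;
          .ite (.var rI - .var rT) .skip (.set rOk 0) ;;
          .set rA (.var rA + (.arr aHt (.var rT) - .var rA)) ;;
          .set rB (.var rB + (.arr aWt (.var rT) - .var rB))) ;;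
      .put aHt (.var rI) (.var rA + 1) ;;
      .ite (.arr aDeg (.var rI) - 2) (.put aWt (.var rI) (.var rB + 1))
        (.put aWt (.var rI) (.var rB)) : St) with hp
  -- one gate
  have gate : ∀ t : State, ∀ i < G.N, netOf t = G → t.reg rI = i →
      ((den M p t).reg rOk ≠ 0 ↔ t.reg rOk ≠ 0 ∧ ∀ j < G.deg i, G.prd i j < i) ∧
      (den M p t).arr aHt = Function.update (t.arr aHt) i
        (1 + (Finset.range (G.deg i)).sup fun j => t.arr aHt (G.prd i j)) ∧
      (den M p t).arr aWt = Function.update (t.arr aWt) i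
        (G.large i + (Finset.range (G.deg i)).sup fun j => t.arr aWt (G.prd i j)) := by
    intro t i hi ht htI
    rw [hp]
    simp only [den_seq]
    set t₁ := den M (.set rB 0) (den M (.set rA 0) t) with ht₁
    have D1 : t.arr aDeg = G.deg := by rw [← ht]; rfl
    have P1 : ∀ i j, t.arr aIn (t.arr aOff i + j) = G.prd i j := fun i j => by rw [← ht]; rfl
    have key := den_rep (M := M) (x := rJ) (e := .arr aDeg (.var rI))
      (p := .set rT (.arr aIn (.arr aOff (.var rI) + .var rJ)) ;;
          .ite (.var rI - .var rT) .skip (.set rOk 0) ;;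
          .set rA (.var rA + (.arr aHt (.var rT) - .var rA)) ;;
          .set rB (.var rB + (.arr aWt (.var rT) - .var rB))) (s := t₁)
      (fun n s' => (s'.reg rOk ≠ 0 ↔ t.reg rOk ≠ 0 ∧ ∀ j < n, G.prd i j < i) ∧
        s'.reg rA = ((Finset.range n).sup fun j => t.arr aHt (G.prd i j)) ∧
        s'.reg rB = ((Finset.range n).sup fun j => t.arr aWt (G.prd i j))) (G.deg i)
      (by simp [ht₁, htI, D1]) (hM.2 i hi) (by simp [ht₁]) (by
        rintro n s' hn hr ha ⟨h1, h2, h3⟩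
        have e1 : s'.reg rI = i := (hr _ (by decide)).trans (by simp [ht₁, htI])
        have e2 : s'.arr aIn = t.arr aIn := ha _ (by decide)
        have e3 : s'.arr aOff = t.arr aOff := ha _ (by decide)
        have e4 : s'.arr aHt = t.arr aHt := ha _ (by decide)
        have e5 : s'.arr aWt = t.arr aWt := ha _ (by decide)
        have hmax : ∀ a b : ℕ, a + (b - a) = b ⊔ a := fun a b => by
          rcases le_total a b with h | h
          · rw [sup_of_le_left h]; omega
          · rw [sup_of_le_right h]; omega
        rw [show (t.reg rOk ≠ 0 ∧ ∀ j < n + 1, G.prd i j < i) ↔ s'.reg rOk ≠ 0 ∧ G.prd i n < i by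
          rw [Nat.forall_lt_succ_right, ← and_assoc, ← h1]]
        by_cases c : G.prd i n < i
        · have c' : i - G.prd i n ≠ 0 := by omega
          simp [e1, e2, e3, e4, e5, P1, c, c', Finset.range_add_one, ← h2, ← h3, hmax]
        · have c' : i - G.prd i n = 0 := by omega
          simp [e1, e2, e3, e4, e5, P1, c, c', Finset.range_add_one, ← h2, ← h3, hmax])
    set t₂ := den M (.rep rJ (.arr aDeg (.var rI))
        (.set rT (.arr aIn (.arr aOff (.var rI) + .var rJ)) ;;
          .ite (.var rI - .var rT) .skip (.set rOk 0) ;;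
          .set rA (.var rA + (.arr aHt (.var rT) - .var rA)) ;;
          .set rB (.var rB + (.arr aWt (.var rT) - .var rB)))) t₁ with ht₂
    have f1 : t₂.reg rI = i := by rw [ht₂, den_reg (by decide), ht₁]; simp [htI]
    have f2 : t₂.arr aDeg = G.deg := by rw [ht₂, den_arr (by decide), ht₁]; exact D1
    have f3 : t₂.arr aHt = t.arr aHt := by rw [ht₂, den_arr (by decide), ht₁]; rfl
    have f4 : t₂.arr aWt = t.arr aWt := by rw [ht₂, den_arr (by decide), ht₁]; rfl
    clear_value t₂
    obtain ⟨h1, h2, h3⟩ := key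
    rw [← h1, ← h2, ← h3]
    by_cases c : G.deg i ≤ 2
    · have c' : G.deg i - 2 = 0 := by omega
      have c'' : ¬ 2 < G.deg i := by omega
      simp [f1, f2, f3, f4, c', Net.large, c'', Nat.add_comm]
    · have c' : G.deg i - 2 ≠ 0 := by omega
      have c'' : 2 < G.deg i := by omega
      simp [f1, f2, f3, f4, c', Net.large, c'', Nat.add_comm]
  have hw1 : ∀ r ∈ [rN], r ∉ rI :: p.wReg := by rw [hp]; decide
  have hw2 : ∀ a ∈ [aIn, aTyp, aDeg, aOff], a ∉ p.wArr := by rw [hp]; decide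
  clear_value p
  have key := den_rep (M := M) (x := rI) (e := .var rN) (p := p) (s := s)
    (fun n s' => (s'.reg rOk ≠ 0 ↔ s.reg rOk ≠ 0 ∧ ∀ i < n, ∀ j < G.deg i, G.prd i j < i) ∧
      ((∀ i < G.N, ∀ j < G.deg i, G.prd i j < i) → ∀ i < n,
        s'.arr aHt i = 1 + ((Finset.range (G.deg i)).sup fun j => s'.arr aHt (G.prd i j)) ∧
        s'.arr aWt i = G.large i + ((Finset.range (G.deg i)).sup fun j => s'.arr aWt (G.prd i j))))
    G.N hN (by omega) (by simp) (by
      rintro n s' hn hr ha ⟨h1, h2⟩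
      have hnet : netOf (s'.setReg rI n) = G := by
        rw [← hG]
        exact netOf_congr
          (by rw [State.setReg_reg, if_neg (by decide)]; exact hr _ (hw1 _ (by decide)))
          (ha _ (hw2 _ (by decide))) (ha _ (hw2 _ (by decide))) (ha _ (hw2 _ (by decide)))
          (ha _ (hw2 _ (by decide)))
      obtain ⟨g1, g2, g3⟩ := gate _ n hn hnet (by simp)
      rw [g1, g2, g3]
      refine ⟨?_, fun hall i hi => ?_⟩
      · rw [Nat.forall_lt_succ_right, ← and_assoc, ← h1]
        simp
      · -- the in-neighbours of gate `i` precede gate `n`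
        have hs : ∀ v : ℕ → ℕ, ∀ x, ((Finset.range (G.deg i)).sup fun j =>
            Function.update v n x (G.prd i j)) = (Finset.range (G.deg i)).sup fun j =>
              v (G.prd i j) := fun v x => by
          refine Finset.sup_congr rfl fun j hj => Function.update_of_ne ?_ _ _
          have := hall i (by omega) j (Finset.mem_range.1 hj)
          omega
        simp only [State.setReg_arr, hs]
        by_cases hin : i = n
        · subst hin; simp
        · simp only [Function.update_of_ne hin]
          exact h2 hall i (by omega))
  exact ⟨key.1, fun hall => ⟨fun i hi => (key.2 hall i hi).1, fun i hi => (key.2 hall i hi).2⟩⟩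

/-- The parser accepts exactly the encodings of the valid circuits of weft at most one and depth at
most `D`, and then it leaves the circuit and its heights in the memory. -/
theorem den_parseP {M D : ℕ} {s : State} {x : List ℕ} (hM : s.reg rLen + 1 ≤ M)
    (hx : segment (s.arr aIn) 1 (s.reg rLen) = x) (hD : s.reg rD = D) (h1 : 1 ≤ s.reg rLen) :
    ((den M parseP s).reg rOk ≠ 0 → ∃ G f₂, netOf (den M parseP s) = G ∧ G.Ok ∧ Fits M G ∧
      G.N + 1 ≤ s.reg rLen ∧
      G.IsHeight (fun _ => 1) ((den M parseP s).arr aHt) ∧ G.IsHeight G.large f₂ ∧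
      (den M parseP s).arr aHt (G.N - 1) ≤ D + 1 ∧ f₂ (G.N - 1) ≤ 1 ∧ G.circuit.encode = x) ∧
    ((∃ C : Circuit, C.Valid ∧ C.WeftLE 1 ∧ C.DepthLE D ∧ C.encode = x) →
      (den M parseP s).reg rOk ≠ 0) := by
  unfold parseP
  rw [den_seq, den_ite]
  obtain ⟨hp, hlt, hok, hge⟩ := den_readP (M := M) (s := s) (by omega)
  set s₁ := den M readP s with hs₁
  have D1 : s₁.reg rD = D := by rw [hs₁, den_reg (by decide), hD]
  clear_value s₁
  have hm := iterate_nextPos_mono (s.arr aIn) 1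
  set G := netOf s₁ with hG
  have hN : s₁.reg rN = G.N := rfl
  rw [hN] at hlt hok hge
  by_cases c : s₁.reg rOk = 0
  · -- a circuit would have been read
    rw [if_pos (show Ex.ev s₁ (.var rOk) = 0 from c), den_skip]
    refine ⟨fun h => absurd c h, ?_⟩
    rintro ⟨C, hC, -, -, hCx⟩ -
    obtain ⟨c1, c2⟩ := iterate_nextPos_of_encode (w := s.arr aIn) (a := 1) (b := s.reg rLen)
      (C := C) (fun g hg => by
        obtain ⟨i, hi, rfl⟩ := List.mem_iff_getElem.1 hg
        exact (hC.2 i _ (List.getElem?_eq_getElem hi)).2) h1 (by rw [hCx, hx])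
    have hlen : G.N = C.length := by
      refine le_antisymm (le_of_not_gt fun h => ?_) (hm.le_iff_le.1 (by simp only [c1]; exact hge))
      have := hlt _ h
      omega
    refine hok.2 ⟨fun i hi => c2 i (by omega), by rw [hlen, c1], ?_⟩ c
    rw [hlen]
    simpa using hC.1
  · obtain ⟨o1, o2, o3⟩ := hok.1 c
    rw [if_neg (show ¬ Ex.ev s₁ (.var rOk) = 0 from c)]
    simp only [den_seq]
    have hN1 : G.N + 1 ≤ s.reg rLen := by
      have key : ∀ n, n + 1 ≤ (nextPos (s.arr aIn))^[n] 1 := by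
        intro n
        induction n with
        | zero => simp
        | succ n ih =>
          have := hm (show n < n + 1 by omega)
          dsimp only at this
          omega
      have := key G.N
      omega
    have hfit : Fits M G := ⟨by omega, fun i hi => (hp.deg_le hi).trans (by rw [o2]; omega)⟩
    have henc : G.circuit.encode = x := by rw [hp.encode_circuit o1, o2, hx]
    obtain ⟨g1, g2⟩ := den_heightP hG.symm hfit
    set s₂ := den M heightP s₁ with hs₂
    have G2 : netOf s₂ = G := by rw [hs₂, netOf_den (by decide)]
    have D2 : s₂.reg rD = D := by rw [hs₂, den_reg (by decide), D1]
    have N2 : s₂.reg rN = G.N := by rw [← G2]; rfl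
    clear_value s₂
    set s₃ := den M (.ite (.arr aWt (.var rN - 1) - 1) (.set rOk 0) .skip)
      (den M (.ite (.arr aHt (.var rN - 1) - (.var rD + 1)) (.set rOk 0) .skip) s₂) with hs₃
    have G3 : netOf s₃ = G := by rw [hs₃, netOf_den (by decide), netOf_den (by decide), G2]
    have H3 : s₃.arr aHt = s₂.arr aHt := by rw [hs₃, den_arr (by decide), den_arr (by decide)]
    have k3 : s₃.reg rOk ≠ 0 ↔ s₂.reg rOk ≠ 0 ∧ s₂.arr aHt (G.N - 1) ≤ D + 1 ∧
        s₂.arr aWt (G.N - 1) ≤ 1 := by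
      rw [hs₃]
      by_cases c1 : s₂.arr aHt (G.N - 1) ≤ D + 1
      · have c1' : s₂.arr aHt (G.N - 1) - (D + 1) = 0 := by omega
        by_cases c2 : s₂.arr aWt (G.N - 1) ≤ 1
        · have c2' : s₂.arr aWt (G.N - 1) - 1 = 0 := by omega
          simp [N2, D2, c1, c1', c2, c2']
        · have c2' : s₂.arr aWt (G.N - 1) - 1 ≠ 0 := by omega
          simp [N2, D2, c1, c1', c2, c2']
      · have c1' : s₂.arr aHt (G.N - 1) - (D + 1) ≠ 0 := by omega
        by_cases c2 : s₂.arr aWt (G.N - 1) ≤ 1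
        · have c2' : s₂.arr aWt (G.N - 1) - 1 = 0 := by omega
          simp [N2, D2, c1, c1', c2']
        · have c2' : s₂.arr aWt (G.N - 1) - 1 ≠ 0 := by omega
          simp [N2, D2, c1, c1', c2']
    clear_value s₃
    rw [k3, g1]
    constructor
    · rintro ⟨⟨-, e1⟩, e2, e3⟩
      obtain ⟨i1, i2⟩ := g2 e1
      exact ⟨G, s₂.arr aWt, G3, hp.ok o1 (by omega) e1, hfit, hN1, H3 ▸ i1, i2, H3 ▸ e2, e3, henc⟩
    · rintro ⟨C, hC, hCw, hCd, hCx⟩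
      obtain rfl : G.circuit = C := Circuit.encode_injective (henc.trans hCx.symm)
      have e1 : ∀ i < G.N, ∀ j < G.deg i, G.prd i j < i := by
        intro i hi j hj
        refine (hC.2 i _ (Net.getElem?_circuit.2 ⟨hi, rfl⟩)).1 _ ?_
        have hty := hp.typ i hi
        have hdg := hp.deg i hi
        unfold degAt at hdg
        rw [← hty] at hdg
        have hj1 : G.typ i = 0 → False := fun h => by rw [h] at hdg; simp at hdg; omega
        have hj2 : G.typ i = 1 → j = 0 := fun h => by rw [h] at hdg; simp at hdg; omega
        unfold Net.gate
        split_ifs with h0 h1 h2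
        · exact (hj1 h0).elim
        · rw [hj2 h1]; simp [Gate.preds]
        · exact List.mem_map.2 ⟨j, List.mem_range.2 hj, rfl⟩
        · exact List.mem_map.2 ⟨j, List.mem_range.2 hj, rfl⟩
      obtain ⟨i1, i2⟩ := g2 e1
      have hGok := hp.ok o1 (by omega) e1
      exact ⟨⟨c, e1⟩, (hGok.depthLE_iff i1 D).1 hCd, (hGok.weftLE_iff i2 1).1 hCw⟩

/-! ### The decision procedure -/

/-- Set the constants of the construction for circuits of depth at most `D`. -/
def setupP (D : ℕ) : St :=
  .set rD (.lit D) ;; .set rK (.arr aIn 0) ;; .set rDim (.var rK + .lit (2 ^ (D + 1))) ;;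
  .set rBeta (.lit (D + 4)) ;; .set rPow (.lit (2 ^ (D + 4)))

/-- Answer no. -/
def noP : St := .put aIn 0 0 ;; .set rLen 1

/-- Read and check the input. -/
def inputP (D : ℕ) : St := setupP D ;; parseP

theorem den_inputP {M D k : ℕ} {x : List ℕ} {s : State} (hlen : s.reg rLen = x.length + 1)
    (hx : segment (s.arr aIn) 0 (x.length + 1) = k :: x) (hM : x.length + 2 ≤ M)
    (hd : k + 2 ^ (D + 1) ≤ M) (hP : (2 ^ (D + 4)) ^ (k + 2 ^ (D + 1)) ≤ M) :
    ((den M (inputP D) s).reg rOk ≠ 0 → ∃ G f₂, Setting M D k G f₂ (den M (inputP D) s) ∧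
      G.circuit.encode = x ∧ G.N ≤ x.length) ∧
    ((∃ C : Circuit, C.Valid ∧ C.WeftLE 1 ∧ C.DepthLE D ∧ C.encode = x) →
      (den M (inputP D) s).reg rOk ≠ 0) := by
  obtain ⟨-, hk, hx'⟩ := segment_eq_cons.1 hx
  unfold inputP
  rw [den_seq]
  set s₁ := den M (setupP D) s with hs₁
  have e1 : s₁.reg rLen = x.length + 1 := by simp [hs₁, setupP, hlen]
  have e2 : s₁.arr aIn = s.arr aIn := by simp [hs₁, setupP]
  have e3 : s₁.reg rD = D := by simp [hs₁, setupP]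
  have e4 : s₁.reg rK = k := by simp [hs₁, setupP, hk]
  have e5 : s₁.reg rDim = k + 2 ^ (D + 1) := by simp [hs₁, setupP, hk]
  have e6 : s₁.reg rBeta = D + 4 := by simp [hs₁, setupP]
  have e7 : s₁.reg rPow = 2 ^ (D + 4) := by simp [hs₁, setupP]
  clear_value s₁
  obtain ⟨h1, h2⟩ := den_parseP (M := M) (D := D) (s := s₁) (x := x) (by omega)
    (by rw [e1, e2]; exact hx') e3 (by omega)
  refine ⟨fun h => ?_, h2⟩
  obtain ⟨G, f₂, g1, g2, g3, g4, g5, g6, g7, g8, g9⟩ := h1 h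
  exact ⟨G, f₂, ⟨g1, g2, g3, g5, g6, g7, g8, by rw [den_reg (by decide), e3],
    by rw [den_reg (by decide), e4], by rw [den_reg (by decide), e5],
    by rw [den_reg (by decide), e6], by rw [den_reg (by decide), e7], hd, hP⟩, g9, by omega⟩

/-- Double register `x`, `n` times. -/
def doubleTimes (x : ℕ) : ℕ → Prog
  | 0 => .skip
  | n + 1 => .seq (.add x x x) (doubleTimes x n)

/-- Compute the cap `(L + 1) * 2 ^ ((D + 4) * d)`, where `L` is the length of the input and `d` is
the dimension. -/
def capProg (D : ℕ) : Prog :=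
  .seq (.const (tmp 1) 0) (.seq (.load (tmp 2) aIn (tmp 1)) (.seq (.const (tmp 3) (2 ^ (D + 1)))
    (.seq (.add (tmp 2) (tmp 2) (tmp 3)) (.seq (.const (tmp 4) 1)
    (.seq (.add (tmp 0) 0 (tmp 4))
    (.loop (tmp 2) (.seq (doubleTimes (tmp 0) (D + 4)) (.sub (tmp 2) (tmp 2) (tmp 4)))))))))

/-- `σ` and `σ'` differ only in the auxiliary registers. -/
def SameMem (σ σ' : State) : Prop := (∀ r, σ'.reg (2 * r) = σ.reg (2 * r)) ∧ σ'.arr = σ.arr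

theorem SameMem.trans {σ₁ σ₂ σ₃ : State} (h : SameMem σ₁ σ₂) (h' : SameMem σ₂ σ₃) : SameMem σ₁ σ₃ :=
  ⟨fun r => (h'.1 r).trans (h.1 r), h'.2.trans h.2⟩

theorem sameMem_setTmp (σ : State) (j v : ℕ) : SameMem σ (σ.setReg (tmp j) v) :=
  ⟨fun r => by rw [State.setReg_reg, if_neg (tmp_ne _ _)], rfl⟩

theorem runs_doubleTimes (n : ℕ) (σ : State) : ∃ σ', Runs (doubleTimes (tmp 0) n) σ σ' (n + 1) ∧
    SameMem σ σ' ∧ σ'.reg (tmp 0) = σ.reg (tmp 0) * 2 ^ n ∧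
    ∀ j, j ≠ 0 → σ'.reg (tmp j) = σ.reg (tmp j) := by
  induction n generalizing σ with
  | zero => exact ⟨σ, .skip σ, ⟨fun _ => rfl, rfl⟩, by simp, fun _ _ => rfl⟩
  | succ n ih =>
    obtain ⟨σ', h1, h2, h3, h4⟩ := ih (σ.setReg (tmp 0) (σ.reg (tmp 0) + σ.reg (tmp 0)))
    refine ⟨σ', ?_, (sameMem_setTmp σ _ _).trans h2, ?_, fun j hj => ?_⟩
    · rw [show n + 1 + 1 = 1 + (n + 1) by omega]; exact .seq (.add _ _ _ _) h1
    · rw [h3, State.setReg_reg, if_pos rfl]; ring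
    · rw [h4 j hj, State.setReg_reg, if_neg (by rw [tmp_inj]; exact hj)]

theorem runs_capLoop (D n : ℕ) (σ : State) (hn : σ.reg (tmp 2) = n) (h1 : σ.reg (tmp 4) = 1) :
    ∃ σ', Runs (.loop (tmp 2) (.seq (doubleTimes (tmp 0) (D + 4)) (.sub (tmp 2) (tmp 2) (tmp 4))))
      σ σ' (n * (D + 7) + 1) ∧ SameMem σ σ' ∧
      σ'.reg (tmp 0) = σ.reg (tmp 0) * 2 ^ ((D + 4) * n) := by
  induction n generalizing σ with
  | zero => exact ⟨σ, by simpa using Runs.loop_done hn, ⟨fun _ => rfl, rfl⟩, by simp⟩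
  | succ n ih =>
    obtain ⟨σ₁, r1, m1, v1, k1⟩ := runs_doubleTimes (D + 4) σ
    have e2 : σ₁.reg (tmp 2) = n + 1 := by rw [k1 2 (by decide), hn]
    have e4 : σ₁.reg (tmp 4) = 1 := by rw [k1 4 (by decide), h1]
    obtain ⟨σ₂, r2, m2, v2⟩ := ih
      (σ₁.setReg (tmp 2) (σ₁.reg (tmp 2) - σ₁.reg (tmp 4)))
      (by simp [e2, e4])
      (by rw [State.setReg_reg, if_neg (by rw [tmp_inj]; decide), e4])
    refine ⟨σ₂, ?_, (m1.trans (sameMem_setTmp _ _ _)).trans m2, ?_⟩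
    · have := Runs.loop_step (by rw [hn]; omega) (.seq r1 (.sub _ _ _ _)) r2
      convert this using 1
      ring
    · rw [v2, State.setReg_reg, if_neg (by rw [tmp_inj]; decide), v1]
      ring

theorem runs_capProg (D : ℕ) (σ : State) : ∃ σ',
    Runs (capProg D) σ σ' ((σ.arr aIn 0 + 2 ^ (D + 1)) * (D + 7) + 7) ∧ SameMem σ σ' ∧
      σ'.reg (tmp 0) = (σ.reg 0 + 1) * 2 ^ ((D + 4) * (σ.arr aIn 0 + 2 ^ (D + 1))) := by
  set σ₁ := (σ.setReg (tmp 1) 0).setReg (tmp 2) (σ.arr aIn 0) with hσ₁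
  set σ₂ := ((σ₁.setReg (tmp 3) (2 ^ (D + 1))).setReg (tmp 2)
    (σ.arr aIn 0 + 2 ^ (D + 1))).setReg (tmp 4) 1 with hσ₂
  set σ₃ := σ₂.setReg (tmp 0) (σ.reg 0 + 1) with hσ₃
  obtain ⟨σ', h1, h2, h3⟩ := runs_capLoop D (σ.arr aIn 0 + 2 ^ (D + 1)) σ₃
    (by simp [hσ₃, hσ₂, hσ₁, tmp]) (by simp [hσ₃, hσ₂, hσ₁, tmp])
  refine ⟨σ', ?_, ?_, ?_⟩
  · unfold capProg
    rw [show (σ.arr aIn 0 + 2 ^ (D + 1)) * (D + 7) + 7 =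
      1 + (1 + (1 + (1 + (1 + (1 + ((σ.arr aIn 0 + 2 ^ (D + 1)) * (D + 7) + 1)))))) by ring]
    refine .seq (.const _ _ _) (.seq (s₁ := σ₁) ?_ (.seq (.const _ _ _)
      (.seq (s₁ := (σ₁.setReg (tmp 3) (2 ^ (D + 1))).setReg (tmp 2) (σ.arr aIn 0 + 2 ^ (D + 1))) ?_
      (.seq (.const _ _ _) (.seq (s₁ := σ₃) ?_ h1)))))
    · convert Runs.load _ _ _ _ using 2
      simp
    · convert Runs.add _ _ _ _ using 2
      simp [hσ₁, tmp]
    · convert Runs.add _ _ _ _ using 2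
      simp [hσ₁, tmp]
  · refine SameMem.trans ?_ h2
    exact ((((((sameMem_setTmp _ _ _).trans (sameMem_setTmp _ _ _)).trans
      (sameMem_setTmp _ _ _)).trans (sameMem_setTmp _ _ _)).trans (sameMem_setTmp _ _ _)).trans
      (sameMem_setTmp _ _ _))
  · rw [h3]; simp [hσ₃]

theorem size_le_length_mul {l : List ℕ} {M : ℕ} (h : ∀ a ∈ l, a ≤ M) :
    size l ≤ l.length * (M + 1) := by
  unfold size
  have := List.sum_le_card_nsmul (l.map fun a => Nat.size a + 1) (M + 1) (by
    intro a ha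
    obtain ⟨b, hb, rfl⟩ := List.mem_map.1 ha
    have : Nat.size b ≤ b := Nat.size_le.2 Nat.lt_two_pow_self
    have := h b hb
    omega)
  simpa using this

theorem length_boxWord (d : ℕ) (b : (ℕ → ℕ) × (ℕ → ℕ)) (t : ℕ) :
    (boxWord d b t).length = 6 * d + 3 := by
  unfold boxWord
  rw [List.length_append, List.length_flatten, List.map_map]
  have : (List.length ∘ fun j => [b.1 j, 0, 1, b.2 j + 1, 0, 1]) = fun _ => 6 := rfl
  simp [this, mul_comm]

theorem mem_boxWord_le {d M t : ℕ} {b : (ℕ → ℕ) × (ℕ → ℕ)} (ht : t ≤ 1) (hM : 1 ≤ M)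
    (h1 : ∀ j < d, b.1 j ≤ M) (h2 : ∀ j < d, b.2 j + 1 ≤ M) : ∀ a ∈ boxWord d b t, a ≤ M := by
  intro a ha
  simp only [boxWord, List.mem_append, List.mem_flatten, List.mem_map, List.mem_range] at ha
  rcases ha with ⟨l, ⟨j, hj, rfl⟩, ha⟩ | ha
  · have := h1 j hj
    have := h2 j hj
    simp only [List.mem_cons, List.not_mem_nil, or_false] at ha
    rcases ha with rfl | rfl | rfl | rfl | rfl | rfl <;> omega
  · simp only [List.mem_cons, List.not_mem_nil, or_false] at ha
    rcases ha with rfl | rfl | rfl <;> omega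

theorem size_instWord_le {d N M : ℕ} {Bs : List ((ℕ → ℕ) × (ℕ → ℕ))} (hd : d ≤ M)
    (hN : N + 1 ≤ M) (hl : Bs.length + 1 ≤ M) (h1 : ∀ b ∈ Bs, ∀ j < d, b.1 j ≤ b.2 j)
    (h2 : ∀ b ∈ Bs, ∀ j < d, b.2 j ≤ N) : size (instWord d N Bs) ≤ 6 * (M + 1) ^ 3 := by
  have hlen : (instWord d N Bs).length = 3 + (6 * d + 3) * (Bs.length + 1) := by
    have : (Bs.flatMap fun b => boxWord d b 0).length = Bs.length * (6 * d + 3) := by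
      rw [List.length_flatMap]; simp [length_boxWord]
    simp only [instWord, List.length_cons, List.length_append, length_boxWord, this]
    ring
  refine (size_le_length_mul (M := M) fun a ha => ?_).trans ?_
  · simp only [instWord, List.mem_cons, List.mem_append, List.mem_flatMap] at ha
    rcases ha with rfl | rfl | rfl | ha | ⟨b, hb, ha⟩
    · exact hd
    · exact hl
    · omega
    · exact mem_boxWord_le le_rfl (by omega) (by simp) (fun _ _ => hN) a ha
    · exact mem_boxWord_le (by omega) (by omega)
        (fun j hj => by have := h1 b hb j hj; have := h2 b hb j hj; omega)
        (fun j hj => by have := h2 b hb j hj; omega) a ha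
  · rw [hlen]
    calc (3 + (6 * d + 3) * (Bs.length + 1)) * (M + 1)
        ≤ (3 + (6 * M + 3) * M) * (M + 1) := by gcongr
      _ ≤ 6 * (M + 1) ^ 3 := by ring_nf; omega

/-- The memory of a structured program that is stored in `σ`. -/
def view (σ : State) : State := ⟨fun r => σ.reg (2 * r), σ.arr⟩

theorem Sim.view_eq {M : ℕ} {s σ : State} (h : Sim M s σ) : view σ = s := by
  obtain ⟨h1, h2, -⟩ := h
  unfold view
  rw [h2]
  congr 1
  funext r; exact h1 r

theorem sim_view {M : ℕ} {σ : State} (h : σ.reg (tmp 0) = M) : Sim M (view σ) σ :=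
  ⟨fun _ => rfl, rfl, h⟩

theorem SameMem.view_eq {σ σ' : State} (h : SameMem σ σ') : view σ' = view σ := by
  unfold view
  rw [h.2]
  congr 1
  funext r; exact h.1 r

/-- Decide weighted satisfiability for the circuits that are computed by the program `red`, by means
of a program `sol` for Selectivity+. The registers and arrays `3 r` of the structured programs are
reserved for `red`, and the registers and arrays `3 r + 1` for `sol`; register `r` of a structured
program is register `2 r` of the machine. -/
def decider (D : ℕ) (red sol : Prog) : Prog :=
  .seq (red.rename (fun r => 6 * r) fun a => 3 * a) (.seq (capProg D) (.seq ((inputP D).comp 1)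
    (.ite (2 * rOk)
      (.seq (reduceP.comp 1)
        (.seq (sol.rename (fun r => 6 * r + 2) fun a => 3 * a + 1) (answerP.comp 1)))
      (noP.comp 1))))

theorem roundOff_congr {N d : ℕ} {w : ℕ → ℕ} {y : List ℕ}
    (hw : ∀ i < y.length, w i = y.getD i 0) (hy : ∀ j < d, y.getD (3 * j + 3) 0 ≠ 0) :
    ∀ j < d, roundOff N (fun i => y.getD i 0) j = roundOff N w j := by
  intro j hj
  have hlt : 3 * j + 3 < y.length := by
    by_contra hc
    exact hy j hj (by simp [List.getD_eq_getElem?_getD, List.getElem?_eq_none (not_lt.1 hc)])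
  unfold roundOff
  rw [hw _ (by omega), hw _ (by omega), hw _ (by omega)]

theorem output_getD {s : State} {y : List ℕ} (h : s.output = y) :
    s.reg 0 = y.length ∧ ∀ i < y.length, s.arr 0 i = y.getD i 0 := by
  subst h
  refine ⟨by simp [State.output], fun i hi => ?_⟩
  have : i < s.reg 0 := by simpa [State.output] using hi
  simp [State.output, List.getD_eq_getElem?_getD, this]

/-- The part of the decision procedure that consults the program for Selectivity+. -/
theorem runs_solve {M D k T : ℕ} {G : Net} {f₂ : ℕ → ℕ} {sol : Prog} {p : ENNReal} (hp : 1 ≤ p)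
    {f g : ℕ → ℕ} {C : ℝ} (hC : ∀ n : ℕ, 1 ≤ n → (g n : ℝ) ≤ C * (n : ℝ)) {h : ℕ → ℕ} {c : ℕ}
    (hsol : SolvesSelectivityPlus p f g C h c sol) {s σ : State} (hσ : Sim M s σ)
    (hs : Setting M D k G f₂ s) (hN : (G.N + 1) * (2 ^ (D + 4)) ^ (k + 2 ^ (D + 1)) ≤ M)
    (hr : ∀ r, s.reg (3 * r + 1) = 0) (ha : ∀ a, s.arr (3 * a + 1) = fun _ => 0)
    (hT : h (k + 2 ^ (D + 1)) * (6 * (M + 1) ^ 3) ^ c ≤ T) :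
    ∃ σ' t b, Runs (.seq (reduceP.comp 1)
        (.seq (sol.rename (fun r => 6 * r + 2) fun a => 3 * a + 1) (answerP.comp 1))) σ σ' t ∧
      σ'.output = [b] ∧ t ≤ reduceP.time M + T + answerP.time M ∧
      ((∃ z, G.IsSol k z) → b = 1) ∧ ((¬ ∃ z, G.IsSol k z) → b = 0) := by
  classical
  obtain ⟨m1, m2, m3⟩ := hs.small
  have hd1 : 1 ≤ k + 2 ^ (D + 1) := by have := Nat.one_le_two_pow (n := D + 1); omega
  have hPd : 1 ≤ (2 ^ (D + 4)) ^ (k + 2 ^ (D + 1)) := Nat.one_le_pow _ _ (by positivity)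
  -- the instance is written
  obtain ⟨fr, Bs, hF, hB, hl, w1, w2⟩ := den_reduceP hs fun i _ => by rw [ha 0]
  obtain ⟨σ₁, t₁, r1, S1, -, T1⟩ := reduceP.runs_comp (j := 1) le_rfl hσ
  have hs1 : Setting M D k G f₂ (den M reduceP s) := hs.den (by decide)
  have f1 : ∀ r, r ≠ 0 → (den M reduceP s).reg (3 * r + 1) = 0 := fun r h0 => by
    have key : ∀ r' ∈ reduceP.wReg, r' % 3 = 1 → r' = 1 := by decide
    rw [den_reg fun hc => h0 (by have := key _ hc (by omega); omega), hr]
  have f2 : ∀ a, a ≠ 0 → (den M reduceP s).arr (3 * a + 1) = fun _ => 0 := fun a h0 => by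
    have key : ∀ a' ∈ reduceP.wArr, a' % 3 = 1 → a' = 1 := by decide
    rw [den_arr fun hc => h0 (by have := key _ hc (by omega); omega), ha]
  set s₁ := den M reduceP s
  clear_value s₁
  set d := k + 2 ^ (D + 1) with hd
  -- the program for Selectivity+ runs
  obtain ⟨y, μ, ⟨sy, ty, ry, oy, Ty⟩, hy, -, hμ⟩ := hsol d (Bs.length + 1) 1 hd1 (by omega) le_rfl
    (by simpa using hC (Bs.length + 1) (by omega)) (boxInstance d G.N Bs)
  rw [encode_boxInstance hB.le] at ry Ty
  change Runs sol (start (instWord d G.N Bs)) sy ty at ry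
  change ty + y.length ≤ h d * size (instWord d G.N Bs) ^ c at Ty
  have hemb : (start (instWord d G.N Bs)).Embeds (fun r => 6 * r + 2) (fun a => 3 * a + 1) σ₁ := by
    refine ⟨fun r => ?_, fun a => ?_⟩
    · show σ₁.reg (6 * r + 2) = _
      rw [show 6 * r + 2 = 2 * (3 * r + 1) by ring, S1.reg]
      by_cases h0 : r = 0
      · subst h0; rw [mul_zero, zero_add, w1]; simp [start]
      · rw [f1 r h0]; simp [start, h0]
    · show σ₁.arr (3 * a + 1) = _
      rw [S1.arr]
      by_cases h0 : a = 0
      · subst h0; funext i; rw [mul_zero, zero_add, w2]; simp [start]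
      · rw [f2 a h0]; simp [start, h0]
  obtain ⟨σ₂, r2, e2, o2⟩ := ry.rename (ρ := fun r => 6 * r + 2) (α := fun a => 3 * a + 1)
    (fun a b hab => by simpa using hab) (fun a b hab => by simpa using hab) σ₁ hemb
  have v1 : view σ₁ = s₁ := S1.view_eq
  have hreg : ∀ r, r % 3 ≠ 1 → (view σ₂).reg r = s₁.reg r := fun r h3 => by
    rw [← v1]
    exact o2.1 _ (by rintro ⟨r', h'⟩; simp only at h'; omega)
  have harr : ∀ a, a % 3 ≠ 1 → (view σ₂).arr a = s₁.arr a := fun a h3 => by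
    rw [← v1]
    exact o2.2 _ (by rintro ⟨a', h'⟩; simp only at h'; omega)
  have hcap : σ₂.reg (tmp 0) = M := by
    rw [o2.1 _ (by rintro ⟨r', h'⟩; simp only [tmp] at h'; omega), S1.cap]
  have hs2 : Setting M D k G f₂ (view σ₂) :=
    hs1.congr (fun r hmem => hreg r (by revert r; decide)) fun a hmem => harr a (by revert a; decide)
  -- the answer is read off
  obtain ⟨b1, b2⟩ := den_answerP hs2.net hs2.ok hs2.fits (by rw [hs2.weight_eq]; exact m3)
  rw [hs2.weight_eq] at b2
  obtain ⟨σ₃, t₃, r3, S3, -, T3⟩ := answerP.runs_comp (j := 1) le_rfl (sim_view hcap)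
  refine ⟨σ₃, _, if G.IsSol k (roundOff G.N ((view σ₂).arr aOut)) then 1 else 0,
    .seq r1 (.seq r2 r3), ?_, ?_, ?_⟩
  · unfold State.output
    have := S3.reg 0
    rw [mul_zero, b1] at this
    rw [this, S3.arr]
    simp [b2]
  · have hsz := size_instWord_le hs.dim_le hs.fits.1 (by
      refine le_trans ?_ hN
      rw [Nat.add_mul, one_mul]
      omega) hB.le hB.le_N
    have : h d * size (instWord d G.N Bs) ^ c ≤ T :=
      le_trans (Nat.mul_le_mul_left _ (Nat.pow_le_pow_left hsz c)) hT
    omega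
  · refine ⟨fun hz => if_pos ?_, fun hz => if_neg fun h' => hz ⟨_, h'⟩⟩
    have hsol' := hB.isSol_roundOff hs.ok hF hp hy hμ hz
    obtain ⟨x₀, -, hx₀⟩ := hy.exists_point
    obtain ⟨-, oy2⟩ := output_getD oy
    refine hsol'.congr fun j hj => roundOff_congr (d := d) (w := (view σ₂).arr aOut) (fun i hi => ?_)
      (fun j hj => (hx₀ ⟨j, hj⟩).1) j (hj.trans_le (Nat.le_add_right _ _))
    have : σ₂.arr (3 * 0 + 1) = sy.arr 0 := e2.2 0
    rw [mul_zero, zero_add] at this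
    show σ₂.arr 1 i = _
    rw [this, oy2 i hi]

theorem Setting.mem_weightedCircuitSat {M D k : ℕ} {G : Net} {f₂ : ℕ → ℕ} {s : State} {x : List ℕ}
    (hs : Setting M D k G f₂ s) (hx : G.circuit.encode = x) :
    (x, k) ∈ ParamProblem.WeightedCircuitSat 1 D ↔ ∃ z, G.IsSol k z := by
  rw [← hs.ok.hasSat_iff]
  constructor
  · rintro ⟨C, -, -, -, hC, hsat⟩
    obtain rfl : G.circuit = C := Circuit.encode_injective (hx.trans hC.symm)
    exact hsat
  · intro hsat
    exact ⟨G.circuit, hs.ok.valid, (hs.ok.weftLE_iff hs.weft 1).2 hs.weft_le,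
      (hs.ok.depthLE_iff hs.height D).2 hs.depth_le, hx, hsat⟩

/-- The decision procedure is correct. Apart from the time for the reduction and for the program for
Selectivity+, it takes time polynomial in the cap `M`. -/
theorem outputsIn_decider {D : ℕ} {red sol : Prog} {p : ENNReal} (hp : 1 ≤ p)
    {f g : ℕ → ℕ} {C : ℝ} (hC : ∀ n : ℕ, 1 ≤ n → (g n : ℝ) ≤ C * (n : ℝ)) {h : ℕ → ℕ} {c : ℕ}
    (hsol : SolvesSelectivityPlus p f g C h c sol) {w x : List ℕ} {k T₁ T M : ℕ}
    (hred : OutputsIn red w (k :: x) T₁)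
    (hM : M = (x.length + 2) * (2 ^ (D + 4)) ^ (k + 2 ^ (D + 1)))
    (hT : h (k + 2 ^ (D + 1)) * (6 * (M + 1) ^ 3) ^ c ≤ T) :
    ∃ b, OutputsIn (decider D red sol) w [b] (T₁ + (M + 1) * (D + 7) + 9 + (inputP D).time M +
        reduceP.time M + T + answerP.time M + noP.time M) ∧
      ((x, k) ∈ ParamProblem.WeightedCircuitSat 1 D → b = 1) ∧
      ((x, k) ∉ ParamProblem.WeightedCircuitSat 1 D → b = 0) := by
  -- the cap exceeds the length of the input, the dimension, and the number of boxes per gate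
  have hPd : 1 ≤ (2 ^ (D + 4)) ^ (k + 2 ^ (D + 1)) := Nat.one_le_pow _ _ (by positivity)
  have hM1 : x.length + 2 ≤ M := by rw [hM]; exact Nat.le_mul_of_pos_right _ hPd
  have hM2 : (2 ^ (D + 4)) ^ (k + 2 ^ (D + 1)) ≤ M := by
    rw [hM]; exact Nat.le_mul_of_pos_left _ (by omega)
  have hM3 : k + 2 ^ (D + 1) ≤ M := by
    refine le_trans (Nat.lt_pow_self ?_).le hM2
    exact Nat.one_lt_two_pow (by omega)
  -- the reduction runs
  obtain ⟨s, t, r0, o0, T0⟩ := hred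
  obtain ⟨σ₁, r1, e1, a1⟩ := r0.rename (ρ := fun r => 6 * r) (α := fun a => 3 * a)
    (fun a b hab => by simpa using hab) (fun a b hab => by simpa using hab) (start w)
    ⟨fun r => by simp [start], fun a => by simp [start]⟩
  obtain ⟨l1, -⟩ := output_getD o0
  rw [List.length_cons] at l1
  have L1 : σ₁.reg 0 = x.length + 1 := (e1.1 0).trans l1
  have A1 : σ₁.arr 0 = s.arr 0 := e1.2 0
  have hseg : segment (σ₁.arr 0) 0 (x.length + 1) = k :: x := by
    rw [A1, ← o0, State.output, l1, List.range_eq_range']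
    rfl
  have K1 : σ₁.arr 0 0 = k := (segment_eq_cons.1 hseg).2.1
  -- the cap is computed
  obtain ⟨σ₂, r2, m2, c2⟩ := runs_capProg D σ₁
  rw [L1, K1, pow_mul, show x.length + 1 + 1 = x.length + 2 from rfl, ← hM] at c2
  rw [K1] at r2
  have v2 : view σ₂ = view σ₁ := m2.view_eq
  -- the input is read
  obtain ⟨h1, h2⟩ := den_inputP (M := M) (D := D) (k := k) (x := x) (s := view σ₂)
    (by rw [v2]; exact L1) (by rw [v2]; exact hseg) hM1 hM3 hM2
  obtain ⟨σ₃, t₃, r3, S3, -, T3⟩ := (inputP D).runs_comp (j := 1) le_rfl (sim_view c2)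
  have z1 : ∀ r, (den M (inputP D) (view σ₂)).reg (3 * r + 1) = 0 := fun r => by
    have key : ∀ r' ∈ [rD, rK, rDim, rBeta, rPow] ++ parseP.wReg, r' % 3 ≠ 1 := by decide
    rw [den_reg fun hc => key _ hc (by omega), v2]
    show σ₁.reg (2 * (3 * r + 1)) = 0
    rw [a1.1 _ (by rintro ⟨r', h'⟩; simp only at h'; omega)]
    simp [start]
  have z2 : ∀ a, (den M (inputP D) (view σ₂)).arr (3 * a + 1) = fun _ => 0 := fun a => by
    have key : ∀ a' ∈ parseP.wArr, a' % 3 ≠ 1 := by decide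
    rw [den_arr (p := inputP D) fun hc => key _ hc (by omega), v2]
    show σ₁.arr (3 * a + 1) = _
    rw [a1.2 _ (by rintro ⟨r', h'⟩; simp only at h'; omega)]
    simp [start]
  set s₃ := den M (inputP D) (view σ₂)
  clear_value s₃
  have hcap : (k + 2 ^ (D + 1)) * (D + 7) ≤ (M + 1) * (D + 7) := Nat.mul_le_mul_right _ (by omega)
  rw [List.length_cons] at T0
  by_cases ok : s₃.reg rOk = 0
  · obtain ⟨σ₄, t₄, r4, S4, -, T4⟩ := noP.runs_comp (j := 1) le_rfl S3
    refine ⟨0, ⟨σ₄, _, .seq r1 (.seq r2 (.seq r3 (.ite_false (by rw [S3.reg, ok]) r4))), ?_, ?_⟩,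
      fun hx => ?_, fun _ => rfl⟩
    · have := S4.reg 0
      rw [mul_zero] at this
      rw [State.output, this, S4.arr]
      simp [noP]
    · rw [List.length_singleton]; omega
    · obtain ⟨C, d1, d2, d3, d4, -⟩ := hx
      exact absurd ok (h2 ⟨C, d1, d2, d3, d4⟩)
  · obtain ⟨G, f₂, hs, hG, hN⟩ := h1 ok
    obtain ⟨σ₄, t₄, b, r4, o4, T4, b1, b2⟩ := runs_solve hp hC hsol S3 hs
      (by rw [hM]; exact Nat.mul_le_mul_right _ (by omega)) z1 z2 hT
    refine ⟨b, ⟨σ₄, _, .seq r1 (.seq r2 (.seq r3 (.ite_true (by rw [S3.reg]; exact ok) r4))), o4, ?_⟩,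
      fun hx => b1 ((hs.mem_weightedCircuitSat hG).1 hx), fun hx => b2 fun hc =>
        hx ((hs.mem_weightedCircuitSat hG).2 hc)⟩
    rw [List.length_singleton]; omega

theorem OutputsIn.mono {q : Prog} {x y : List ℕ} {T T' : ℕ} (h : OutputsIn q x y T) (hT : T ≤ T') :
    OutputsIn q x y T' := by
  obtain ⟨s, t, h1, h2, h3⟩ := h
  exact ⟨s, t, h1, h2, h3.trans hT⟩

/-! ### Comparison of the classes -/

theorem computable_add {f g : ℕ → ℕ} (hf : Computable f) (hg : Computable g) :
    Computable fun n => f n + g n := Primrec.nat_add.to_comp.comp hf hg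

theorem computable_mul {f g : ℕ → ℕ} (hf : Computable f) (hg : Computable g) :
    Computable fun n => f n * g n := Primrec.nat_mul.to_comp.comp hf hg

theorem computable_pow {f g : ℕ → ℕ} (hf : Computable f) (hg : Computable g) :
    Computable fun n => f n ^ g n := by
  have := Computable.nat_rec hg (Computable.const 1) (h := fun n (p : ℕ × ℕ) => p.2 * f n)
    (Primrec.nat_mul.to_comp.comp (Computable.snd.comp .snd) (hf.comp .fst))
  refine this.of_eq fun n => ?_
  induction g n with
  | zero => simp
  | succ m ih => rw [pow_succ, ← ih]

theorem computable_sum {h : ℕ → ℕ} (hh : Computable h) :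
    Computable fun n => ∑ j ∈ Finset.range n, h j := by
  have := Computable.nat_rec (Computable.id (α := ℕ)) (Computable.const 0)
    (h := fun _ (p : ℕ × ℕ) => p.2 + h p.1)
    (Primrec.nat_add.to_comp.comp (Computable.snd.comp .snd) (hh.comp (Computable.fst.comp .snd)))
  refine this.of_eq fun n => ?_
  simp only [id]
  induction n with
  | zero => simp
  | succ m ih => rw [Finset.sum_range_succ, ← ih]

theorem one_le_size_cons (k : ℕ) (x : List ℕ) : 1 ≤ size (k :: x) := by
  simp only [size, List.map_cons, List.sum_cons]; omega

/-- The circuit that consists of one input node is satisfiable with weight one, but not with weight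
zero. -/
theorem singleton_mem_weightedCircuitSat_iff {b : ℕ} (hb : b ≤ 1) :
    ([0], b) ∈ ParamProblem.WeightedCircuitSat 1 1 ↔ b = 1 := by
  have henc : Circuit.encode [Gate.input] = [0] := rfl
  have hpath : ∀ l, Circuit.IsPath [Gate.input] l → l.length ≤ 1 := by
    rintro l ⟨hl, -, -⟩
    match l, hl with
    | [], _ => simp
    | [a], _ => simp
    | a :: a' :: l, hl =>
      obtain ⟨g, hg, ha⟩ := (List.isChain_cons_cons.1 hl).1
      have : g = Gate.input := by
        match a' with
        | 0 => simpa using hg.symm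
        | a' + 1 => simp at hg
      subst this
      simp [Gate.preds] at ha
  constructor
  · rintro ⟨C, -, -, -, hC, v, -, hv, hc⟩
    obtain rfl : [Gate.input] = C := Circuit.encode_injective (henc.trans hC.symm)
    have hfin : {i | ([Gate.input] : Circuit)[i]? = some Gate.input ∧ v i = true}.Finite :=
      (Set.finite_lt_nat 1).subset fun i hi => by
        have := (List.getElem?_eq_some_iff.1 hi.1).1
        simpa using this
    have h0 : b ≠ 0 := by
      rintro rfl
      rw [Set.ncard_eq_zero hfin] at hc
      have : 0 ∈ {i | ([Gate.input] : Circuit)[i]? = some Gate.input ∧ v i = true} := ⟨rfl, hv⟩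
      rw [hc] at this
      exact this
    omega
  · rintro rfl
    refine ⟨[Gate.input], ⟨by simp, fun i g hg => ?_⟩, fun l hl => ?_, fun l hl => ?_, henc,
      fun _ => true, fun i g hg => ?_, rfl, ?_⟩
    · match i with
      | 0 => obtain rfl : Gate.input = g := by simpa using hg
             exact ⟨by simp [Gate.preds], trivial⟩
      | i + 1 => simp at hg
    · exact List.countP_le_length.trans (hpath l hl)
    · exact (hpath l hl).trans (by omega)
    · match i with
      | 0 => obtain rfl : Gate.input = g := by simpa using hg
             trivial
      | i + 1 => simp at hg
    · have : {i | ([Gate.input] : Circuit)[i]? = some Gate.input ∧ (fun _ : ℕ => true) i = true} =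
          {0} := by
        ext i
        match i with
        | 0 => simp
        | i + 1 => simp
      rw [this, Set.ncard_singleton]

theorem FPT_subset_W1 : ParamProblem.FPT ⊆ ParamProblem.W1 := by
  rintro L ⟨q, f, c, hf, hq⟩
  -- the answer becomes the weight, and the circuit with the encoding `[0]` is appended
  refine ⟨1, le_rfl, .seq q (.seq (.const 1 1) (.seq (.const 2 0) (.seq (.store 0 1 2)
    (.const 0 2)))), fun k => f k + 5, fun _ => 1, c, computable_add hf (.const 5), .const 1,
    fun x k => ?_⟩
  have key : ∀ b, OutputsIn q (k :: x) [b] (f k * size (k :: x) ^ c) →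
      OutputsIn (.seq q (.seq (.const 1 1) (.seq (.const 2 0) (.seq (.store 0 1 2)
        (.const 0 2))))) (k :: x) [b, 0] ((f k + 5) * size (k :: x) ^ c) := by
    rintro b ⟨s, t, h1, h2, h3⟩
    obtain ⟨o1, o2⟩ := output_getD h2
    have ob : s.arr 0 0 = b := by simpa using o2 0 (by simp)
    have hS : 1 ≤ size (k :: x) ^ c := Nat.one_le_pow _ _ (one_le_size_cons k x)
    refine ⟨_, _, .seq h1 (.seq (.const _ _ _) (.seq (.const _ _ _) (.seq (.store _ _ _ _)
      (.const _ _ _)))), ?_, ?_⟩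
    · simp [State.output, List.range_succ, ob]
    · simp only [List.length_cons, List.length_nil] at h3 ⊢
      rw [Nat.add_mul]
      omega
  by_cases hx : (x, k) ∈ L
  · exact ⟨[0], 1, key 1 ((hq x k).1 hx), le_rfl, by
      simp [hx, singleton_mem_weightedCircuitSat_iff]⟩
  · exact ⟨[0], 0, key 0 ((hq x k).2 hx), by omega, by
      simp [hx, singleton_mem_weightedCircuitSat_iff]⟩

/-- A program for Selectivity+ makes every problem in W[1] fixed-parameter tractable. -/
theorem W1_subset_FPT {sol : Prog} {p : ENNReal} (hp : 1 ≤ p) {f g : ℕ → ℕ} {C : ℝ}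
    (hC : ∀ n : ℕ, 1 ≤ n → (g n : ℝ) ≤ C * (n : ℝ)) {h : ℕ → ℕ} {c : ℕ} (hh : Computable h)
    (hsol : SolvesSelectivityPlus p f g C h c sol) : ParamProblem.W1 ⊆ ParamProblem.FPT := by
  rintro L ⟨D, -, red, f₀, g₀, c₀, hf₀, hg₀, hred⟩
  obtain ⟨K, E, hKE⟩ := (inputP D ;; reduceP ;; answerP ;; noP).time_le
  set Q := 2 ^ (D + 1)
  set P := 2 ^ (D + 4) with hP
  -- bounds for the cap and for the factor `h` that depend only on the parameter
  set A : ℕ → ℕ := fun k => (f₀ k + 2) * P ^ (g₀ k + Q) with hA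
  set H : ℕ → ℕ := fun k => ∑ j ∈ Finset.range (g₀ k + 1), h (j + Q) with hH
  set e := 1 + E + 3 * c with he
  refine ⟨decider D red sol, fun k => (17 + D + K + H k * 6 ^ c) * A k ^ e, c₀ * e, ?_,
    fun x k => ?_⟩
  · have cA : Computable A := computable_mul (computable_add hf₀ (.const 2))
      (computable_pow (.const P) (computable_add hg₀ (.const Q)))
    have cH : Computable H :=
      (computable_sum (hh.comp (computable_add .id (.const Q)))).comp
        (computable_add hg₀ (.const 1))
    exact computable_mul (computable_add (.const _) (computable_mul cH (.const _)))
      (computable_pow cA (.const e))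
  · obtain ⟨x', k', hout, hk', hiff⟩ := hred x k
    set S := size (k :: x) with hS
    have hSc : 1 ≤ S ^ c₀ := Nat.one_le_pow _ _ (one_le_size_cons k x)
    set d := k' + Q with hd
    set M := (x'.length + 2) * P ^ d with hM
    set Y := A k * S ^ c₀ with hY
    have hPpos : 1 ≤ P := Nat.one_le_two_pow
    have hlen : x'.length + 1 ≤ f₀ k * S ^ c₀ := by
      obtain ⟨s, t, -, -, h3⟩ := hout
      rw [List.length_cons] at h3
      omega
    have hMY : M + 1 ≤ Y := by
      have h1 : 1 ≤ P ^ d := Nat.one_le_pow _ _ hPpos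
      calc M + 1 ≤ (x'.length + 2) * P ^ d + P ^ d := by omega
        _ = (x'.length + 1 + 2) * P ^ d := by ring
        _ ≤ (f₀ k * S ^ c₀ + 2 * S ^ c₀) * P ^ (g₀ k + Q) :=
          Nat.mul_le_mul (by omega) (Nat.pow_le_pow_right hPpos (by omega))
        _ = Y := by rw [hY, hA]; ring
    have hY1 : 1 ≤ Y := by omega
    have hYe : ∀ i ≤ e, Y ^ i ≤ Y ^ e := fun i hi => Nat.pow_le_pow_right hY1 hi
    have hhH : h d ≤ H k :=
      Finset.single_le_sum (f := fun j => h (j + Q)) (fun _ _ => Nat.zero_le _)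
        (Finset.mem_range.2 (by omega))
    have hT : h d * (6 * (M + 1) ^ 3) ^ c ≤ H k * 6 ^ c * Y ^ e :=
      calc h d * (6 * (M + 1) ^ 3) ^ c ≤ H k * (6 * Y ^ 3) ^ c := by gcongr
        _ = H k * 6 ^ c * Y ^ (3 * c) := by rw [mul_pow, pow_mul, mul_assoc]
        _ ≤ _ := Nat.mul_le_mul_left _ (hYe _ (by omega))
    obtain ⟨b, hb, hb1, hb0⟩ := outputsIn_decider hp hC hsol hout hM hT
    have hb' : OutputsIn (decider D red sol) (k :: x) [b]
        ((17 + D + K + H k * 6 ^ c) * A k ^ e * S ^ (c₀ * e)) := by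
      refine hb.mono ?_
      have t1 : f₀ k * S ^ c₀ ≤ Y ^ e := by
        refine le_trans ?_ (hYe 1 (by omega))
        rw [pow_one, hY, hA]
        refine Nat.mul_le_mul_right _ ?_
        have := Nat.one_le_pow (g₀ k + Q) P hPpos
        nlinarith
      have t2 : (M + 1) * (D + 7) ≤ Y ^ e * (D + 7) :=
        Nat.mul_le_mul_right _ (hMY.trans ((pow_one Y).symm.le.trans (hYe 1 (by omega))))
      have t3 : 9 ≤ 9 * Y ^ e := Nat.le_mul_of_pos_right _ (Nat.one_le_pow _ _ hY1)
      have t4 : (inputP D).time M + (reduceP.time M + (answerP.time M + noP.time M)) ≤ K * Y ^ e :=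
        (hKE M).trans (Nat.mul_le_mul_left _
          ((Nat.pow_le_pow_left hMY _).trans (hYe _ (by omega))))
      calc _ ≤ Y ^ e + Y ^ e * (D + 7) + 9 * Y ^ e + K * Y ^ e + H k * 6 ^ c * Y ^ e := by omega
        _ = (17 + D + K + H k * 6 ^ c) * Y ^ e := by ring
        _ = _ := by rw [hY, mul_pow, ← pow_mul, mul_assoc]
    exact ⟨fun hx => hb1 (hiff.1 hx) ▸ hb', fun hx => hb0 (fun hc => hx (hiff.2 hc)) ▸ hb'⟩

end Ram

theorem mainTheorem4
    (hW : ParamProblem.FPT ≠ ParamProblem.W1)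
    (p : ENNReal) (hp : 1 ≤ p)
    (f g : ℕ → ℕ) (hf : ∀ n, 1 ≤ f n) (hg : ∀ n, 1 ≤ g n)
    (C : ℝ) (hC : ∀ n : ℕ, 1 ≤ n → (g n : ℝ) ≤ C * (n : ℝ)) :
    ¬ ∃ (prog : Ram.Prog) (h : ℕ → ℕ) (c : ℕ),
      Computable h ∧ SolvesSelectivityPlus p f g C h c prog := by
  rintro ⟨prog, h, c, hh, hsol⟩
  exact hW (Set.Subset.antisymm Ram.FPT_subset_W1 (Ram.W1_subset_FPT hp hC hh hsol))
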